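/- **Conventions.** Vocabularies are many-sorted: a vocabulary is a set of sorts, relation symbols and function symbols, each symbol with specified argument (and value) sorts (constants are $0$-ary function symbols). All domains of structures are nonempty sets, and $|\mathcal A|$ is the total number of elements in the domains of $\mathcal A$. If $\tau\subseteq\tau'$ and $\mathcal B$ is a $\tau'$-structure, then $\mathcal B\restriction\tau$ is its reduct: the sorts and symbols not in $\tau$ are dropped. A *logic* $\mathcal L^*$ assigns to each vocabulary $\tau$ a class of $\tau$-sentences, together with a satisfaction relation $\models$ between $\tau$-structures and $\tau$-sentences, such that: satisfaction is invariant under isomorphism; whenever $\sigma\subseteq\tau$ (possibly after an injective, type-preserving renaming of symbols), each $\sigma$-sentence $\phi$ has a $\tau$-sentence $\psi$ with $\mathcal B\models\psi\Leftrightarrow\mathcal B\restriction\sigma\models\phi$ for all $\tau$-structures $\mathcal B$; each sentence of first-order logic $\mathcal L_{\omega\omega}$ is equivalent to an $\mathcal L^*$-sentence; and $\mathcal L^*$ is closed under conjunction. A class $\mathcal K$ of $\tau$-structures is $\Sigma^{B}(\mathcal L^*)$-*axiomatisable* if there are a vocabulary $\tau'\supseteq\tau$ and an $\mathcal L^*$-sentence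 $\phi$ of $\tau'$ such that $\mathcal K=\{\mathcal A : \exists\mathcal B\,(\mathcal B\models\phi\text{ and }\mathcal A=\mathcal B\restriction\tau)\}$ and, for each $\tau$-structure $\mathcal A$, there is a cardinal $\lambda_{\mathcal A}$ with $|\mathcal B|\le\lambda_{\mathcal A}$ for all $\mathcal B\models\phi$ with $\mathcal B\restriction\tau=\mathcal A$. It is $\Delta^{B}(\mathcal L^*)$-*axiomatisable* if both $\mathcal K$ and its complement in the class of $\tau$-structures are $\Sigma^{B}(\mathcal L^*)$-axiomatisable. (Structures are taken up to isomorphism here.) A nondecreasing class function $F$ from cardinals to cardinals is *definably bounding* if the class of two-sorted structures $(A,B)$ without symbols such that $|B|\le F(|A|)$ is $\Sigma^{B}(\mathcal L_{\omega\omega})$-axiomatisable. A *$\Pi_1$ predicate* $R$ is a $k$-ary predicate given by a formula $\forall y_1\cdots\forall y_m\,\delta(x_1,\dots,x_k,y_1,\dots,y_m)$ of the language $\{\in\}$ with $\delta$ a $\Delta_0$ formula. A $\Delta_0(R)$ formula is a formula with only bounded quantifiers in the language $\{\in,R\}$. For a set $x$, the $\mathbf H$-rank $\rho_{\mathbf H}(x)$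 is the least infinite cardinal $\kappa$ with $x\in\mathbf H_{\kappa^+}$, i.e. $\max(\aleph_0,|\mathrm{trcl}(x)|)$. For $F$ from cardinals to cardinals, a class $C$ of sets is $\Sigma_1^F(R)$ if there is a $\Delta_0(R)$ formula $\psi(x,y)$, without parameters, such that for all $x$: $x\in C\Leftrightarrow\exists y\,\psi(x,y)$, and if $x\in C$ then there is $y$ with $\rho_{\mathbf H}(y)\le F(\rho_{\mathbf H}(x))$ and $\psi(x,y)$. The class $C$ is $\Delta_1^F(R)$ if $C$ and its complement in the class of all sets are both $\Sigma_1^F(R)$. For a finite vocabulary $\tau$, with its sorts and symbols listed in some order, a $\tau$-structure whose elements are sets is identified with the set coding it: the tuple of its domains, its relations (sets of tuples) and its functions (graphs). In this way a class of $\tau$-structures is a class of sets. A transitive set $M$ is *$R$-correct* if for all $m_1,\dots,m_k\in M$: $(M,\in)\models R(m_1,\dots,m_k)$ if and only if $R(m_1,\dots,m_k)$. **Lemma.** Let $\mathcal L^*$ be a logic and $R$ a $\Pi_1$ predicate. The following are equivalent: (a) for every definably bounding $F$ and every finite vocabulary $\tau$, every $\Delta_1^{F}(R)$ class of $\tau$-structures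 that is closed under isomorphisms is $\Delta^{B}(\mathcal L^*)$-axiomatisable; (b) for every finite vocabulary $\tau$, every $\Delta_1^{\mathrm{id}}(R)$ class of $\tau$-structures that is closed under isomorphisms is $\Delta^{B}(\mathcal L^*)$-axiomatisable; (c) the class $\mathcal Q_R$ of all structures $(A,E)$, with $E$ a binary relation on $A$, that are isomorphic to $(M,\in)$ for some transitive $R$-correct set $M$ is $\Delta^{B}(\mathcal L^*)$-axiomatisable. -/

import Mathlib

universe u w

namespace BoundedSymbiosis

open Cardinal

/-! ### Many-sorted vocabularies and structures -/

/-- A (set-sized) many-sorted vocabulary. Relation symbols are listed by the sorts of their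
arguments, function symbols by the sorts of their arguments and of their value. Constant symbols
are the function symbols with no arguments. -/
structure Vocabulary : Type (u + 1) where
  Sorts : Type u
  Rel : {n : ℕ} → (Fin n → Sorts) → Type u
  Fun : {n : ℕ} → (Fin n → Sorts) → Sorts → Type u

/-- An inclusion `σ ⊆ τ` of vocabularies, given as an injective renaming of the symbols of `σ` as
symbols of `τ` of the same type. -/
structure Vocabulary.Embedding (σ τ : Vocabulary.{u}) : Type u where
  onSort : σ.Sorts → τ.Sorts
  onSort_injective : Function.Injective onSort
  onRel : ∀ {n : ℕ} {s : Fin n → σ.Sorts}, σ.Rel s → τ.Rel (fun i => onSort (s i))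
  onRel_injective : ∀ {n : ℕ} {s : Fin n → σ.Sorts},
    Function.Injective (fun r : σ.Rel s => onRel r)
  onFun : ∀ {n : ℕ} {s : Fin n → σ.Sorts} {t : σ.Sorts},
    σ.Fun s t → τ.Fun (fun i => onSort (s i)) (onSort t)
  onFun_injective : ∀ {n : ℕ} {s : Fin n → σ.Sorts} {t : σ.Sorts},
    Function.Injective (fun f : σ.Fun s t => onFun f)

/-- Structures of a vocabulary: a nonempty domain for each sort, and interpretations of the
symbols. -/
structure Struc (τ : Vocabulary.{u}) : Type (u + 1) where
  dom : τ.Sorts → Type u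
  nonempty : ∀ s, Nonempty (dom s)
  rel : ∀ {n : ℕ} {s : Fin n → τ.Sorts}, τ.Rel s → (∀ i, dom (s i)) → Prop
  fn : ∀ {n : ℕ} {s : Fin n → τ.Sorts} {t : τ.Sorts}, τ.Fun s t → (∀ i, dom (s i)) → dom t

/-- The cardinality of a many-sorted structure: the number of elements in all of its domains. -/
def Struc.card {τ : Vocabulary.{u}} (A : Struc τ) : Cardinal.{u} :=
  Cardinal.sum fun s => #(A.dom s)

/-- The reduct of a structure to a smaller vocabulary. -/
def Struc.reduct {σ τ : Vocabulary.{u}} (B : Struc τ) (ι : σ.Embedding τ) : Struc σ where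
  dom s := B.dom (ι.onSort s)
  nonempty s := B.nonempty (ι.onSort s)
  rel r v := B.rel (ι.onRel r) v
  fn f v := B.fn (ι.onFun f) v

/-- Isomorphisms of many-sorted structures. -/
structure Struc.Iso {τ : Vocabulary.{u}} (A B : Struc τ) : Type u where
  equiv : ∀ s, A.dom s ≃ B.dom s
  map_rel : ∀ {n : ℕ} {s : Fin n → τ.Sorts} (r : τ.Rel s) (v : ∀ i, A.dom (s i)),
    A.rel r v ↔ B.rel r (fun i => equiv (s i) (v i))
  map_fn : ∀ {n : ℕ} {s : Fin n → τ.Sorts} {t : τ.Sorts} (f : τ.Fun s t)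
    (v : ∀ i, A.dom (s i)), equiv t (A.fn f v) = B.fn f (fun i => equiv (s i) (v i))

/-- A class of structures is closed under isomorphisms. -/
def IsoClosed {τ : Vocabulary.{u}} (K : Set (Struc τ)) : Prop :=
  ∀ A B : Struc τ, Nonempty (A.Iso B) → A ∈ K → B ∈ K

/-! ### First-order logic -/

/-- Many-sorted first-order terms with `n` free variables, of the sorts `Γ 0, …, Γ (n - 1)`. -/
inductive Term (τ : Vocabulary.{u}) {n : ℕ} (Γ : Fin n → τ.Sorts) : τ.Sorts → Type u
  | var (i : Fin n) : Term τ Γ (Γ i)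
  | app {k : ℕ} {s : Fin k → τ.Sorts} {t : τ.Sorts} (f : τ.Fun s t)
      (a : ∀ i, Term τ Γ (s i)) : Term τ Γ t

/-- Many-sorted first-order formulas with free variables of the sorts `Γ`. The variable bound by
a quantifier becomes variable `0`, the others are shifted by one. -/
inductive Formula (τ : Vocabulary.{u}) : {n : ℕ} → (Fin n → τ.Sorts) → Type u
  | falsum {n : ℕ} {Γ : Fin n → τ.Sorts} : Formula τ Γ
  | eq {n : ℕ} {Γ : Fin n → τ.Sorts} {s : τ.Sorts} (t₁ t₂ : Term τ Γ s) : Formula τ Γ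
  | rel {n : ℕ} {Γ : Fin n → τ.Sorts} {k : ℕ} {s : Fin k → τ.Sorts} (r : τ.Rel s)
      (a : ∀ i, Term τ Γ (s i)) : Formula τ Γ
  | imp {n : ℕ} {Γ : Fin n → τ.Sorts} (φ ψ : Formula τ Γ) : Formula τ Γ
  | all {n : ℕ} {Γ : Fin n → τ.Sorts} (s : τ.Sorts)
      (φ : Formula τ (Fin.cons s Γ : Fin (n + 1) → τ.Sorts)) : Formula τ Γ

/-- The value of a term. -/
def Term.eval {τ : Vocabulary.{u}} (A : Struc τ) {n : ℕ} {Γ : Fin n → τ.Sorts}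
    (v : ∀ i, A.dom (Γ i)) : {s : τ.Sorts} → Term τ Γ s → A.dom s
  | _, .var i => v i
  | _, .app f a => A.fn f (fun i => (a i).eval A v)

/-- Extend a list of values of variables by a value of a new variable `0`. -/
def extend {τ : Vocabulary.{u}} (A : Struc τ) {n : ℕ} {Γ : Fin n → τ.Sorts} {s : τ.Sorts}
    (a : A.dom s) (v : ∀ i, A.dom (Γ i)) :
    ∀ i, A.dom ((Fin.cons s Γ : Fin (n + 1) → τ.Sorts) i) :=
  fun i => Fin.cases (motive := fun i => A.dom ((Fin.cons s Γ : Fin (n + 1) → τ.Sorts) i))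
    a v i

/-- Tarski's satisfaction relation. -/
def Formula.Realize {τ : Vocabulary.{u}} (A : Struc τ) : {n : ℕ} → {Γ : Fin n → τ.Sorts} →
    Formula τ Γ → (∀ i, A.dom (Γ i)) → Prop
  | _, _, .falsum, _ => False
  | _, _, .eq t₁ t₂, v => t₁.eval A v = t₂.eval A v
  | _, _, .rel r a, v => A.rel r (fun i => (a i).eval A v)
  | _, _, .imp φ ψ, v => φ.Realize A v → ψ.Realize A v
  | _, _, .all s φ, v => ∀ a : A.dom s, φ.Realize A (extend A a v)

/-! ### Abstract logics -/

/-- The data of a logic: sentences of each vocabulary, and a satisfaction relation. -/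
structure Semantics : Type (max (u + 1) (w + 1)) where
  Sentence : Vocabulary.{u} → Type w
  Sat : {τ : Vocabulary.{u}} → Struc τ → Sentence τ → Prop

/-- First-order (finitary) logic `L_ωω`. -/
def firstOrder : Semantics.{u, u} where
  Sentence τ := Formula τ (Fin.elim0 : Fin 0 → τ.Sorts)
  Sat A φ := φ.Realize A (fun i => i.elim0)

/-- An abstract logic. -/
structure AbstractLogic : Type (max (u + 1) (w + 1)) extends Semantics.{u, w} where
  /-- Satisfaction is invariant under isomorphisms. -/
  sat_iso : ∀ {τ : Vocabulary.{u}} {A B : Struc τ} (φ : Sentence τ),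
    Nonempty (A.Iso B) → Sat A φ → Sat B φ
  /-- Sentences of `σ` are, up to renaming, sentences of every vocabulary that extends `σ`, and
  their truth depends only on the reduct to `σ`. -/
  reduct : ∀ {σ τ : Vocabulary.{u}} (ι : σ.Embedding τ) (φ : Sentence σ),
    ∃ ψ : Sentence τ, ∀ B : Struc τ, Sat B ψ ↔ Sat (B.reduct ι) φ
  /-- The logic extends first-order logic. -/
  first_order : ∀ {τ : Vocabulary.{u}} (φ : firstOrder.Sentence τ),
    ∃ ψ : Sentence τ, ∀ A : Struc τ, Sat A ψ ↔ firstOrder.Sat A φ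
  /-- The logic is closed under conjunction. -/
  conj : ∀ {τ : Vocabulary.{u}} (φ ψ : Sentence τ),
    ∃ χ : Sentence τ, ∀ A : Struc τ, Sat A χ ↔ Sat A φ ∧ Sat A ψ

/-- `K` is a bounded projection of the class of models of a sentence of an extended vocabulary.
As structures are taken up to isomorphism, `A = B ↾ τ` is read as `A ≅ B ↾ τ`. -/
def SigmaB (L : Semantics.{u, w}) {τ : Vocabulary.{u}} (K : Set (Struc τ)) : Prop :=
  ∃ (τ' : Vocabulary.{u}) (ι : τ.Embedding τ') (φ : L.Sentence τ'),
    (∀ A : Struc τ, A ∈ K ↔ ∃ B : Struc τ', L.Sat B φ ∧ Nonempty (A.Iso (B.reduct ι))) ∧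
    ∀ A : Struc τ, ∃ κ : Cardinal.{u}, ∀ B : Struc τ',
      L.Sat B φ → Nonempty (A.Iso (B.reduct ι)) → B.card ≤ κ

/-- Both `K` and its complement are bounded projections. -/
def DeltaB (L : Semantics.{u, w}) {τ : Vocabulary.{u}} (K : Set (Struc τ)) : Prop :=
  SigmaB L K ∧ SigmaB L Kᶜ

/-- The vocabulary with two sorts and no symbols. -/
def twoSorts : Vocabulary.{u} where
  Sorts := ULift Bool
  Rel _ := PEmpty
  Fun _ _ := PEmpty

/-- `F` is nondecreasing, and the class of all `(A, B)` with `|B| ≤ F(|A|)` is a bounded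
projection of a first-order model class. -/
def DefinablyBounding (F : Cardinal.{u} → Cardinal.{u}) : Prop :=
  Monotone F ∧
    SigmaB firstOrder {S : Struc twoSorts.{u} | #(S.dom ⟨true⟩) ≤ F #(S.dom ⟨false⟩)}

/-! ### Formulas of set theory

The universe of sets is `ZFSet.{u}`. -/

/-- `Δ₀` formulas with `n` free variables in the language of `∈`, `=` and extra predicate symbols
`P` with arities `ar`. The variable bound by a bounded quantifier becomes variable `0`, the others
are shifted by one. -/
inductive Delta0 (P : Type) (ar : P → ℕ) : ℕ → Type
  | falsum {n : ℕ} : Delta0 P ar n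
  | eq {n : ℕ} (i j : Fin n) : Delta0 P ar n
  | mem {n : ℕ} (i j : Fin n) : Delta0 P ar n
  | pred {n : ℕ} (p : P) (a : Fin (ar p) → Fin n) : Delta0 P ar n
  | imp {n : ℕ} (φ ψ : Delta0 P ar n) : Delta0 P ar n
  /-- For all `y` in variable `i`, `φ`. -/
  | ball {n : ℕ} (i : Fin n) (φ : Delta0 P ar (n + 1)) : Delta0 P ar n

/-- Satisfaction of `Δ₀` formulas in `(A, E)`, with interpretations `I` of the extra predicate
symbols. -/
def Delta0.Realize {P : Type} {ar : P → ℕ} {A : Type w} (E : A → A → Prop)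
    (I : ∀ p, (Fin (ar p) → A) → Prop) : {n : ℕ} → Delta0 P ar n → (Fin n → A) → Prop
  | _, .falsum, _ => False
  | _, .eq i j, v => v i = v j
  | _, .mem i j, v => E (v i) (v j)
  | _, .pred p a, v => I p (fun k => v (a k))
  | _, .imp φ ψ, v => φ.Realize E I v → ψ.Realize E I v
  | _, .ball i φ, v => ∀ a, E a (v i) → φ.Realize E I (Matrix.vecCons a v)

/-- A `Π₁` predicate: a formula `∀ y₁ … yₘ δ(x₁, …, xₖ, y₁, …, yₘ)` of the language of set theory
with a `Δ₀` matrix `δ`. -/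
structure Pi1Predicate : Type where
  arity : ℕ
  numQuant : ℕ
  matrix : Delta0 Empty Empty.elim (arity + numQuant)

/-- Satisfaction of a `Π₁` predicate in `(A, E)`. -/
def Pi1Predicate.Realize (R : Pi1Predicate) {A : Type w} (E : A → A → Prop)
    (x : Fin R.arity → A) : Prop :=
  ∀ y : Fin R.numQuant → A, R.matrix.Realize E (fun p => p.elim) (Fin.append x y)

/-- `R(x₁, …, xₖ)` holds in the universe of sets. -/
def Pi1Predicate.Holds (R : Pi1Predicate) (x : Fin R.arity → ZFSet.{u}) : Prop :=
  R.Realize (fun a b : ZFSet.{u} => a ∈ b) x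

/-- The model `(M, ∈)` is `R`-correct: `M ⊨ R(m)` if and only if `R(m)`, for all `m` in `M`. -/
def Pi1Predicate.Correct (R : Pi1Predicate) (M : ZFSet.{u}) : Prop :=
  ∀ m : Fin R.arity → {x : ZFSet.{u} // x ∈ M},
    R.Realize (fun a b : {x : ZFSet.{u} // x ∈ M} => a.1 ∈ b.1) m ↔ R.Holds (fun i => (m i).1)

/-- `Δ₀(R)` formulas with `n` free variables: `R` is allowed as a predicate symbol. -/
abbrev Delta0Rel (R : Pi1Predicate) (n : ℕ) : Type :=
  Delta0 Unit (fun _ => R.arity) n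

/-- Truth of a `Δ₀(R)` formula in the universe of sets. -/
def Delta0Rel.Holds {R : Pi1Predicate} {n : ℕ} (ψ : Delta0Rel R n) (v : Fin n → ZFSet.{u}) :
    Prop :=
  Delta0.Realize (fun a b : ZFSet.{u} => a ∈ b) (fun _ => R.Holds) ψ v

/-- The transitive closure of a set. -/
noncomputable def trcl (x : ZFSet.{u}) : ZFSet.{u} :=
  ZFSet.sep (fun y => Relation.TransGen (fun a b : ZFSet.{u} => a ∈ b) y x)
    (ZFSet.vonNeumann x.rank)

/-- The members of `trcl x` are exactly the members of members of … of `x`. -/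
theorem mem_trcl {x y : ZFSet.{u}} :
    y ∈ trcl x ↔ Relation.TransGen (fun a b : ZFSet.{u} => a ∈ b) y x := by
  unfold trcl
  rw [ZFSet.mem_sep, ZFSet.mem_vonNeumann]
  refine ⟨fun h => h.2, fun h => ⟨?_, h⟩⟩
  induction h with
  | single h => exact ZFSet.rank_lt_of_mem h
  | tail _ h ih => exact ih.trans (ZFSet.rank_lt_of_mem h)

/-- The class `H_κ` of the sets of hereditary cardinality less than `κ`. -/
def H (κ : Cardinal.{u}) : Set ZFSet.{u} :=
  {x | (trcl x).card < κ}

/-- The `H`-rank of `x`: the least infinite `κ` with `x ∈ H_{κ⁺}`. -/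
noncomputable def hRank (x : ZFSet.{u}) : Cardinal.{u} :=
  sInf {κ : Cardinal.{u} | ℵ₀ ≤ κ ∧ x ∈ H (Order.succ κ)}

/-- A class of sets is `Σ₁^F(R)`, without parameters: it is defined by `∃ y ψ(x, y)` with a `Δ₀(R)`
formula `ψ`, and each of its members `x` has a witness `y` of `H`-rank at most `F` of the `H`-rank
of `x`. -/
def Sigma1 (F : Cardinal.{u} → Cardinal.{u}) (R : Pi1Predicate) (C : Set ZFSet.{u}) : Prop :=
  ∃ ψ : Delta0Rel R 2,
    (∀ x, x ∈ C ↔ ∃ y, ψ.Holds ![x, y]) ∧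
    ∀ x ∈ C, ∃ y, hRank y ≤ F (hRank x) ∧ ψ.Holds ![x, y]

/-- A class of sets is `Δ₁^F(R)`: it and its complement are `Σ₁^F(R)`. -/
def Delta1 (F : Cardinal.{u} → Cardinal.{u}) (R : Pi1Predicate) (C : Set ZFSet.{u}) : Prop :=
  Sigma1 F R C ∧ Sigma1 F R Cᶜ

/-! ### Structures as sets -/

/-- A finite vocabulary, written as finite lists of its sorts, relation symbols and function
symbols. -/
structure Vocabulary.Listing (τ : Vocabulary.{u}) : Type u where
  numSorts : ℕ
  sorts : Fin numSorts ≃ τ.Sorts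
  numRels : ℕ
  rels : Fin numRels ≃ Σ (n : ℕ) (s : Fin n → τ.Sorts), τ.Rel s
  numFuns : ℕ
  funs : Fin numFuns ≃ Σ (n : ℕ) (s : Fin n → τ.Sorts) (t : τ.Sorts), τ.Fun s t

/-- The set `(a₀, (a₁, (…, (aₙ₋₁, ∅))))`, with Kuratowski pairs. -/
noncomputable def tuple : {n : ℕ} → (Fin n → ZFSet.{u}) → ZFSet.{u}
  | 0, _ => ∅
  | _ + 1, a => ZFSet.pair (a 0) (tuple (fun i => a i.succ))

/-- A structure whose elements are sets (here `A`, with the set `e s a` as its element `a` of sort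
`s`), as a set: the tuple of the tuple of its domains, the tuple of its relations (as sets of
tuples), and the tuple of its functions (as graphs). -/
noncomputable def code {τ : Vocabulary.{u}} (l : τ.Listing) (A : Struc τ)
    (e : ∀ s, A.dom s → ZFSet.{u}) : ZFSet.{u} :=
  tuple ![
    tuple fun k => ZFSet.range (e (l.sorts k)),
    tuple fun k => ZFSet.range
      fun v : {v : ∀ i, A.dom ((l.rels k).2.1 i) // A.rel (l.rels k).2.2 v} =>
        tuple fun i => e _ (v.1 i),
    tuple fun k => ZFSet.range
      fun v : (∀ i, A.dom ((l.funs k).2.1 i)) =>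
        ZFSet.pair (tuple fun i => e _ (v i)) (e _ (A.fn (l.funs k).2.2.2 v))]

/-- The class of all sets that are structures (with sets as elements) belonging, up to the identity
of the elements, to `K`. For a class `K` closed under isomorphisms this is `K` as a class of
sets. -/
def setClass {τ : Vocabulary.{u}} (l : τ.Listing) (K : Set (Struc τ)) : Set ZFSet.{u} :=
  {x | ∃ A ∈ K, ∃ e : ∀ s, A.dom s → ZFSet.{u},
    (∀ s, Function.Injective (e s)) ∧ x = code l A e}

/-! ### The class `Q_R` -/

/-- The only symbol of the vocabulary of `∈`-models. -/
inductive EdgeRel : {n : ℕ} → (Fin n → PUnit.{u + 1}) → Type u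
  | edge : EdgeRel (n := 2) (fun _ => PUnit.unit)

/-- The vocabulary with one sort and one binary relation symbol. -/
def edgeVocabulary : Vocabulary.{u} where
  Sorts := PUnit
  Rel s := EdgeRel s
  Fun _ _ := PEmpty

/-- The binary relation of a structure `(A, E)`. -/
def Struc.E (A : Struc edgeVocabulary.{u}) (a b : A.dom PUnit.unit) : Prop :=
  A.rel (s := fun _ : Fin 2 => PUnit.unit) EdgeRel.edge
    (![a, b] : Fin 2 → A.dom PUnit.unit)

/-- The class of the structures `(A, E)` that are isomorphic to `(M, ∈)` for some transitive
`R`-correct set `M`. -/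
def Q (R : Pi1Predicate) : Set (Struc edgeVocabulary.{u}) :=
  {A | ∃ M : ZFSet.{u}, M.IsTransitive ∧ R.Correct M ∧
    ∃ f : A.dom PUnit.unit ≃ {x : ZFSet.{u} // x ∈ M},
      ∀ a b, A.E a b ↔ (f a).1 ∈ (f b).1}

end BoundedSymbiosis

open BoundedSymbiosis

-- The identity is definably bounding, because `|B| ≤ |A|` is witnessed by an injection. This yields
-- the step from the first condition to the second.
--
-- For the step from the second to the third, the class `Q R` is itself `Δ₁` with bound the
-- identity. A structure belongs to it if some pair `(M, f)` consists of a transitive correct set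
-- `M` and an isomorphism `f` onto it. Such an `M` is no larger than the structure, even
-- hereditarily. Correctness of a transitive `M` is a `Δ₀(R)` property: a `Π₁` statement relativised
-- to `M` has all its quantifiers bounded by `M`, and truth of `R` is atomic. By Mostowski's lemma a
-- structure fails to be in the class exactly if it is not extensional, or has a nonempty set of
-- elements without a minimal one, or collapses to a transitive set that is not correct; each case
-- again has a small witness (`sigma1_Q`, `sigma1_Q_compl`).
--
-- For the step from the third to the first, let `ψ(x, y)` be the `Δ₀(R)` formula that defines a
-- class of structures. A structure `A` is expanded by a model from `Q R` that contains the code of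
-- `A` and a witness `y`, with links that make the model recognise the code. The collapse of the
-- model is transitive and correct, so the model evaluates `ψ` correctly and the expansion can exist
-- only if `A` is in the class (`FODef.of_d0`, `CodeLinked.code_eq`).
--
-- Two points remain. Such a model must exist in a controlled size. A Löwenheim–Skolem argument
-- gives a transitive correct set of size at most `max κ (F κ)` around the code and the witness;
-- counterexamples to `R` can be chosen hereditarily small, by reflection through a Skolem hull and
-- its collapse (`exists_delta0_reflection`, `exists_correct_hull`). Conversely, all such expansions
-- of `A` must be bounded in size. Two further sorts `a` and `b` satisfy `|b| ≤ F(|a|)`, which is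
-- expressible since `F` is definably bounding. The sort `a` is embedded in `ω` together with the
-- domains of `A`, and the model is embedded in `a × b`. As the given bounds depend on the reduct up
-- to isomorphism, they can be made uniform over all reducts of limited size
-- (`exists_uniform_bound`). All this is assembled in `sigmaB_of_sigma1`, which is applied to the
-- class and to its complement.

universe v

namespace BoundedSymbiosis

open Cardinal

/-! ### Hereditary cardinality -/

theorem card_le_of_surjOn {α : Type u} (f : α → ZFSet.{u}) {x : ZFSet.{u}}
    (h : ∀ y ∈ x, ∃ a, f a = y) : x.card ≤ #α := by
  have h1 : x ⊆ ZFSet.range f := fun y hy => ZFSet.mem_range.2 (h y hy)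
  have h2 := ZFSet.lift_card_range_le (f := f)
  rw [Cardinal.lift_id, Cardinal.lift_id] at h2
  exact (ZFSet.card_mono h1).trans h2

/-- The elements of a set form a type one universe too high. An index type in `Type u` lets cardinal
arithmetic stay in `Cardinal.{u}`. -/
theorem exists_enum (x : ZFSet.{u}) :
    ∃ (α : Type u) (f : α → ZFSet.{u}), #α = x.card ∧ Function.Injective f ∧
      ∀ y, y ∈ x ↔ ∃ a, f a = y := by
  refine ⟨Shrink x, fun a => ((equivShrink x).symm a : x), rfl, ?_, ?_⟩
  · exact Subtype.val_injective.comp (Equiv.injective _)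
  · intro y
    constructor
    · intro h
      exact ⟨equivShrink x ⟨y, h⟩, by simp⟩
    · rintro ⟨a, rfl⟩
      exact Subtype.prop _

theorem card_range_of_injective {α : Type u} {f : α → ZFSet.{u}} (hf : Function.Injective f) :
    (ZFSet.range f).card = #α := by
  refine le_antisymm (card_le_of_surjOn f fun y hy => ZFSet.mem_range.1 hy) ?_
  obtain ⟨β, g, hβ, hg, hm⟩ := exists_enum (ZFSet.range f)
  rw [← hβ]
  choose k hk using fun a => (hm (f a)).1 (ZFSet.mem_range_self a)
  refine Cardinal.mk_le_of_injective (f := k) fun a b h => hf ?_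
  rw [← hk a, ← hk b, h]

theorem mem_trcl_iff {x y : ZFSet.{u}} : y ∈ trcl x ↔ y ∈ x ∨ ∃ z ∈ x, y ∈ trcl z := by
  simp only [mem_trcl]
  rw [Relation.TransGen.tail'_iff]
  constructor
  · rintro ⟨b, hb, hbx⟩
    rcases Relation.reflTransGen_iff_eq_or_transGen.1 hb with rfl | h
    · exact Or.inl hbx
    · exact Or.inr ⟨b, hbx, h⟩
  · rintro (h | ⟨z, hz, h⟩)
    · exact ⟨y, Relation.ReflTransGen.refl, h⟩
    · exact ⟨z, h.to_reflTransGen, hz⟩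

theorem isTransitive_trcl (x : ZFSet.{u}) : (trcl x).IsTransitive := by
  intro y hy z hz
  rw [mem_trcl] at *
  exact Relation.TransGen.head hz hy

theorem trcl_subset_of_isTransitive {x T : ZFSet.{u}} (hT : T.IsTransitive) (h : x ⊆ T) :
    trcl x ⊆ T := by
  intro y hy
  rw [mem_trcl] at hy
  induction hy using Relation.TransGen.head_induction_on with
  | single h' => exact h h'
  | head h' _ ih => exact hT _ ih h'

/-- `x` has hereditary cardinality at most `κ`. -/
def HC (κ : Cardinal.{u}) (x : ZFSet.{u}) : Prop := (trcl x).card ≤ κ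

theorem HC.mono {κ μ : Cardinal.{u}} (h : κ ≤ μ) {x : ZFSet.{u}} (hx : HC κ x) : HC μ x :=
  hx.trans h

theorem hc_of_subset {κ : Cardinal.{u}} {x T : ZFSet.{u}} (hT : T.IsTransitive)
    (hc : T.card ≤ κ) (h : x ⊆ T) : HC κ x :=
  (ZFSet.card_mono (trcl_subset_of_isTransitive hT h)).trans hc

theorem hc_of_mem {κ : Cardinal.{u}} {x T : ZFSet.{u}} (hT : T.IsTransitive)
    (hc : T.card ≤ κ) (h : x ∈ T) : HC κ x :=
  hc_of_subset hT hc (hT _ h)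

theorem HC.card_le {κ : Cardinal.{u}} {x : ZFSet.{u}} (h : HC κ x) : x.card ≤ κ :=
  (ZFSet.card_mono fun _ hy => mem_trcl_iff.2 (Or.inl hy)).trans h

theorem HC.of_mem {κ : Cardinal.{u}} {x y : ZFSet.{u}} (h : HC κ x) (hy : y ∈ x) : HC κ y :=
  hc_of_mem (isTransitive_trcl x) h (mem_trcl_iff.2 (Or.inl hy))

/-- The transitive closure of `x` is `x` together with the transitive closures of its elements, so
its size is at most `κ + κ · κ`. -/
theorem hc_of_forall_mem {κ : Cardinal.{u}} (hκ : ℵ₀ ≤ κ) {x : ZFSet.{u}} (hc : x.card ≤ κ)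
    (h : ∀ y ∈ x, HC κ y) : HC κ x := by
  obtain ⟨α, f, hα, -, hm⟩ := exists_enum x
  choose β g hβ _ hg using fun a : α => exists_enum (trcl (f a))
  have : (trcl x).card ≤ #(α ⊕ Σ a, β a) := by
    refine card_le_of_surjOn (fun s => Sum.elim f (fun p => g p.1 p.2) s) fun y hy => ?_
    rcases mem_trcl_iff.1 hy with hy | ⟨z, hz, hy⟩
    · obtain ⟨a, ha⟩ := (hm y).1 hy
      exact ⟨Sum.inl a, ha⟩
    · obtain ⟨a, rfl⟩ := (hm z).1 hz
      obtain ⟨b, hb⟩ := (hg a y).1 hy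
      exact ⟨Sum.inr ⟨a, b⟩, hb⟩
  refine this.trans ?_
  rw [Cardinal.mk_sum, Cardinal.lift_id, Cardinal.lift_id, Cardinal.mk_sigma]
  refine Cardinal.add_le_of_le hκ (hα ▸ hc) ?_
  calc Cardinal.sum (fun a => #(β a)) ≤ Cardinal.sum (fun _ : α => κ) :=
        Cardinal.sum_le_sum _ _ fun a => by
          rw [hβ]; exact h _ ((hm _).2 ⟨a, rfl⟩)
    _ = #α * κ := by simp
    _ ≤ κ * κ := by gcongr; exact hα ▸ hc
    _ = κ := Cardinal.mul_eq_self hκ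

/-- The infimum is attained and `< κ⁺` means `≤ κ`. From here on, bounds on `H`-ranks are handled as
statements `HC κ x`. -/
theorem hRank_le_iff {κ : Cardinal.{u}} (hκ : ℵ₀ ≤ κ) {x : ZFSet.{u}} : hRank x ≤ κ ↔ HC κ x := by
  constructor
  · intro h
    have hne : {κ : Cardinal.{u} | ℵ₀ ≤ κ ∧ x ∈ H (Order.succ κ)}.Nonempty :=
      ⟨max ℵ₀ (trcl x).card, le_max_left _ _,
        Order.lt_succ_iff.2 (le_max_right ℵ₀ (trcl x).card)⟩
    have h1 := csInf_mem hne
    exact (Order.lt_succ_iff.1 h1.2).trans h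
  · intro h
    exact csInf_le' ⟨hκ, Order.lt_succ_iff.2 h⟩

theorem aleph0_le_hRank (x : ZFSet.{u}) : ℵ₀ ≤ hRank x := by
  have hne : {κ : Cardinal.{u} | ℵ₀ ≤ κ ∧ x ∈ H (Order.succ κ)}.Nonempty :=
    ⟨max ℵ₀ (trcl x).card, le_max_left _ _,
        Order.lt_succ_iff.2 (le_max_right ℵ₀ (trcl x).card)⟩
  exact (csInf_mem hne).1

theorem hc_hRank (x : ZFSet.{u}) : HC (hRank x) x :=
  (hRank_le_iff (aleph0_le_hRank x)).1 le_rfl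

theorem hc_empty {κ : Cardinal.{u}} (hκ : ℵ₀ ≤ κ) : HC κ (∅ : ZFSet.{u}) :=
  hc_of_forall_mem hκ (by simp) (by simp)

theorem hc_insert {κ : Cardinal.{u}} (hκ : ℵ₀ ≤ κ) {x y : ZFSet.{u}} (hx : HC κ x) (hy : HC κ y) :
    HC κ (insert x y) := by
  refine hc_of_forall_mem hκ ?_ ?_
  · refine (ZFSet.card_insert_le).trans (Cardinal.add_le_of_le hκ hy.card_le ?_)
    exact Cardinal.one_le_aleph0.trans hκ
  · intro z hz
    rcases ZFSet.mem_insert_iff.1 hz with rfl | h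
    · exact hx
    · exact hy.of_mem h

theorem hc_singleton {κ : Cardinal.{u}} (hκ : ℵ₀ ≤ κ) {x : ZFSet.{u}} (hx : HC κ x) : HC κ ({x} : ZFSet.{u}) := by
  have := hc_insert hκ hx (hc_empty hκ)
  simpa using this

theorem hc_pair {κ : Cardinal.{u}} (hκ : ℵ₀ ≤ κ) {x y : ZFSet.{u}} (hx : HC κ x) (hy : HC κ y) : HC κ (ZFSet.pair x y) :=
  hc_insert hκ (hc_singleton hκ hx) (hc_singleton hκ (hc_insert hκ hx (hc_singleton hκ hy)))

theorem hc_tuple {κ : Cardinal.{u}} (hκ : ℵ₀ ≤ κ) : ∀ {n : ℕ} {a : Fin n → ZFSet.{u}}, (∀ i, HC κ (a i)) → HC κ (tuple a)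
  | 0, _, _ => hc_empty hκ
  | _ + 1, _, h => hc_pair hκ (h 0) (hc_tuple hκ fun i => h i.succ)

theorem hc_range {κ : Cardinal.{u}} (hκ : ℵ₀ ≤ κ) {α : Type u} {f : α → ZFSet.{u}} (hα : #α ≤ κ) (h : ∀ a, HC κ (f a)) :
    HC κ (ZFSet.range f) := by
  refine hc_of_forall_mem hκ ((card_le_of_surjOn f fun y hy => ZFSet.mem_range.1 hy).trans hα) ?_
  intro y hy
  obtain ⟨a, rfl⟩ := ZFSet.mem_range.1 hy
  exact h a

/-- The set of the elements of a small family of sets. -/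
theorem exists_zfset_of_card_le (S : Set ZFSet.{u}) {κ : Cardinal.{u}}
    (h : #S ≤ lift.{u + 1} κ) : ∃ N : ZFSet.{u}, (∀ x, x ∈ N ↔ x ∈ S) ∧ N.card ≤ κ := by
  have hs : Small.{u} S := by
    rw [Cardinal.small_iff_lift_mk_lt_univ]
    rw [Cardinal.lift_id'.{u+1,u+1}]
    exact h.trans_lt (Cardinal.lift_lt_univ κ)
  have hm : ∀ x, x ∈ ZFSet.range (fun s : S => (s : ZFSet.{u})) ↔ x ∈ S := by
    intro x; simp [ZFSet.mem_range]
  refine ⟨_, hm, ?_⟩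
  rw [← Cardinal.lift_le.{u + 1}, ← ZFSet.cardinalMk_coe_sort]
  refine le_trans ?_ h
  refine Cardinal.mk_le_of_injective (f := fun x => (⟨x.1, (hm _).1 x.2⟩ : S)) ?_
  intro a b hab
  exact Subtype.ext (congrArg (fun s : S => (s : ZFSet.{u})) hab)

/-! ### Transitive collapse -/

/-- Mostowski's collapsing lemma. -/
theorem exists_collapse {A : Type v} [Small.{u} A] {E : A → A → Prop} (wf : WellFounded E)
    (ext : ∀ a b, (∀ c, E c a ↔ E c b) → a = b) :
    ∃ π : A → ZFSet.{u}, Function.Injective π ∧ ∀ a x, x ∈ π a ↔ ∃ b, E b a ∧ π b = x := by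
  let π : A → ZFSet.{u} := wf.fix fun a ih => ZFSet.range fun b : {b // E b a} => ih b.1 b.2
  have hπ : ∀ a x, x ∈ π a ↔ ∃ b, E b a ∧ π b = x := by
    intro a x
    have : π a = ZFSet.range fun b : {b // E b a} => π b.1 := wf.fix_eq _ _
    rw [this, ZFSet.mem_range]
    constructor
    · rintro ⟨b, hb⟩; exact ⟨b.1, b.2, hb⟩
    · rintro ⟨b, hb, h⟩; exact ⟨⟨b, hb⟩, h⟩
  refine ⟨π, ?_, hπ⟩
  intro a
  induction a using wf.induction with
  | _ a ih =>
    intro b hab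
    refine ext a b fun c => ⟨fun h => ?_, fun h => ?_⟩
    · obtain ⟨d, hd, h'⟩ := (hπ b (π c)).1 (hab ▸ (hπ a _).2 ⟨c, h, rfl⟩)
      rwa [ih c h h'.symm]
    · obtain ⟨d, hd, h'⟩ := (hπ a (π c)).1 (hab ▸ (hπ b _).2 ⟨c, h, rfl⟩)
      rwa [← ih d hd h']

theorem collapse_rel_iff {A : Type v} {E : A → A → Prop} {π : A → ZFSet.{u}}
    (hi : Function.Injective π) (hπ : ∀ a x, x ∈ π a ↔ ∃ b, E b a ∧ π b = x) (a b : A) :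
    E a b ↔ π a ∈ π b := by
  rw [hπ]
  exact ⟨fun h => ⟨a, h, rfl⟩, fun ⟨c, hc, h⟩ => hi h ▸ hc⟩

theorem collapse_isTransitive {A : Type v} [Small.{u} A] {E : A → A → Prop} {π : A → ZFSet.{u}}
    (hπ : ∀ a x, x ∈ π a ↔ ∃ b, E b a ∧ π b = x) : (ZFSet.range π).IsTransitive := by
  intro y hy z hz
  obtain ⟨a, rfl⟩ := ZFSet.mem_range.1 hy
  obtain ⟨b, -, rfl⟩ := (hπ a z).1 hz
  exact ZFSet.mem_range_self b

/-- Isomorphic transitive sets are equal. -/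
theorem eq_of_transitive_iso {A : Type v} {f g : A → ZFSet.{u}} {M N : ZFSet.{u}}
    (hM : M.IsTransitive) (hN : N.IsTransitive) (hf : ∀ x, x ∈ M ↔ ∃ a, f a = x)
    (hg : ∀ x, x ∈ N ↔ ∃ a, g a = x) (h : ∀ a b, f a ∈ f b ↔ g a ∈ g b) : f = g := by
  have key : ∀ x a, f a = x → g a = x := by
    intro x
    induction x using ZFSet.inductionOn with
    | _ x ih =>
      rintro a rfl
      ext z
      constructor
      · intro hz
        obtain ⟨b, rfl⟩ := (hg z).1 (hN _ ((hg _).2 ⟨a, rfl⟩) hz)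
        have hb := (h b a).2 hz
        rwa [ih _ hb b rfl]
      · intro hz
        obtain ⟨b, rfl⟩ := (hf z).1 (hM _ ((hf _).2 ⟨a, rfl⟩) hz)
        have := (h b a).1 hz
        rwa [ih _ hz b rfl] at this
  funext a
  exact (key _ a rfl).symm

/-- Every set-sized type is equinumerous with a transitive set. -/
theorem exists_transitive_enum (A : Type u) :
    ∃ f : A → ZFSet.{u}, Function.Injective f ∧ (ZFSet.range f).IsTransitive := by
  -- A well-order is well-founded and extensional, so it has a transitive collapse (an ordinal).
  obtain ⟨_, _⟩ := exists_wellFoundedLT A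
  obtain ⟨π, hi, hπ⟩ := exists_collapse.{u} (E := fun a b : A => a < b) wellFounded_lt
    fun a b h => by
      rcases lt_trichotomy a b with hab | hab | hab
      · exact absurd ((h a).2 hab) (lt_irrefl a)
      · exact hab
      · exact absurd ((h b).1 hab) (lt_irrefl b)
  exact ⟨π, hi, collapse_isTransitive hπ⟩

/-! ### Closing off under functions -/

/-- The language of a family of functions. -/
def closureLanguage {ι : Type u} (ar : ι → ℕ) : FirstOrder.Language.{u, 0} where
  Functions n := {i : ι // ar i = n}
  Relations _ := Empty

/-- The closure is the substructure generated by `X` when the functions are read as symbols of a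
language; its size is at most `ℵ₀ + |X| + |ι|`. -/
theorem exists_closed_superset {Z : Type (u + 1)} {ι : Type u} (ar : ι → ℕ)
    (f : ∀ i, (Fin (ar i) → Z) → Z) (X : Set Z) {κ : Cardinal.{u}} (hκ : ℵ₀ ≤ κ)
    (hX : #X ≤ lift.{u + 1} κ) (hι : #ι ≤ κ) :
    ∃ S : Set Z, X ⊆ S ∧ (∀ i v, (∀ j, v j ∈ S) → f i v ∈ S) ∧ #S ≤ lift.{u + 1} κ := by
  let st : (closureLanguage ar).Structure Z :=
    { funMap := fun {n} i v => f i.1 fun j => v (Fin.cast i.2 j)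
      RelMap := fun r => r.elim }
  let S := FirstOrder.Language.Substructure.closure (closureLanguage ar) X
  refine ⟨S, FirstOrder.Language.Substructure.subset_closure, ?_, ?_⟩
  · intro i v hv
    exact S.fun_mem (n := ar i) (⟨i, rfl⟩ : {j // ar j = ar i}) v hv
  · have h := FirstOrder.Language.Substructure.lift_card_closure_le
      (L := closureLanguage ar) (s := X)
    have h2 : #(Σ i, (closureLanguage ar).Functions i) ≤ #ι := by
      refine Cardinal.mk_le_of_injective (f := fun p => p.2.1) ?_
      rintro ⟨n, i, hi⟩ ⟨m, j, hj⟩ (h : i = j)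
      subst h; subst hi; subst hj; rfl
    rw [Cardinal.lift_id'.{u, u + 1}, Cardinal.lift_id'.{u, u + 1}] at h
    refine h.trans (max_le (Cardinal.aleph0_le_lift.2 hκ) (Cardinal.add_le_of_le ?_ hX ?_))
    · exact Cardinal.aleph0_le_lift.2 hκ
    · exact Cardinal.lift_le.2 (h2.trans hι)

/-! ### `Δ₀` formulas -/

/-- Absoluteness of `Δ₀` formulas for end extensions: a bounded quantifier only meets
`E'`-predecessors of points of the image, and these lie in the image. It serves for transitive sets,
for collapses and for structures isomorphic to transitive sets. -/
theorem Delta0.realize_endEmbedding {P : Type} {ar : P → ℕ} {A : Type v} {B : Type w}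
    {E : A → A → Prop} {E' : B → B → Prop} {I : ∀ p, (Fin (ar p) → A) → Prop}
    {I' : ∀ p, (Fin (ar p) → B) → Prop} {f : A → B} (hf : Function.Injective f)
    (hE : ∀ a b, E a b ↔ E' (f a) (f b)) (hend : ∀ a b, E' b (f a) → ∃ c, f c = b)
    (hI : ∀ p v, I p v ↔ I' p (fun i => f (v i))) {n : ℕ} (φ : Delta0 P ar n) (v : Fin n → A) :
    φ.Realize E I v ↔ φ.Realize E' I' (fun i => f (v i)) := by
  induction φ with
  | falsum => exact Iff.rfl
  | eq i j => exact hf.eq_iff.symm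
  | mem i j => exact hE _ _
  | pred p a => exact hI _ _
  | imp φ ψ ih₁ ih₂ => exact imp_congr (ih₁ v) (ih₂ v)
  | ball i φ ih =>
    have hcons : ∀ a, (fun k => f (Matrix.vecCons a v k)) =
        Matrix.vecCons (f a) (fun k => f (v k)) := by
      intro a; funext k
      refine Fin.cases ?_ (fun k => ?_) k <;> rfl
    constructor
    · intro h b hb
      obtain ⟨a, rfl⟩ := hend _ _ hb
      rw [← hcons]
      exact (ih _).1 (h a ((hE _ _).2 hb))
    · intro h a ha
      rw [ih, hcons]
      exact h _ ((hE _ _).1 ha)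

/-- An upper bound of the height of a formula. -/
def Delta0.depth {P : Type} {ar : P → ℕ} : {n : ℕ} → Delta0 P ar n → ℕ
  | _, .falsum => 0
  | _, .eq _ _ => 0
  | _, .mem _ _ => 0
  | _, .pred _ _ => 0
  | _, .imp φ ψ => max φ.depth ψ.depth + 1
  | _, .ball _ φ => φ.depth + 1

/-- Countably many formulas require only countably many Skolem functions, so Skolem hulls stay
within any infinite cardinal that bounds the parameters. -/
theorem Delta0.countable_depth {P : Type} [Countable P] {ar : P → ℕ} (d : ℕ) :
    ∀ n, {φ : Delta0 P ar n | φ.depth < d}.Countable := by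
  induction d with
  | zero => intro n; simp
  | succ d ih =>
    intro n
    have h : ({Delta0.falsum} ∪ Set.range (fun p : Fin n × Fin n => Delta0.eq p.1 p.2) ∪
        Set.range (fun p : Fin n × Fin n => Delta0.mem p.1 p.2) ∪
        Set.range (fun p : Σ p, (Fin (ar p) → Fin n) => Delta0.pred p.1 p.2) ∪
        Set.image2 Delta0.imp {φ : Delta0 P ar n | φ.depth < d} {φ : Delta0 P ar n | φ.depth < d} ∪
        ⋃ i, Delta0.ball i '' {φ : Delta0 P ar (n + 1) | φ.depth < d}).Countable := by
      refine Set.Countable.union (Set.Countable.union (Set.Countable.union (Set.Countable.union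
        (Set.Countable.union (Set.countable_singleton _) (Set.countable_range _))
        (Set.countable_range _)) (Set.countable_range _)) ((ih n).image2 (ih n) _)) ?_
      exact Set.countable_iUnion fun i => (ih (n + 1)).image _
    refine h.mono ?_
    intro φ hφ
    cases φ with
    | falsum => simp
    | eq i j => simp
    | mem i j => simp
    | pred p a =>
      refine Or.inl (Or.inl (Or.inr ⟨⟨p, a⟩, rfl⟩))
    | imp φ ψ =>
      have : max φ.depth ψ.depth + 1 < d + 1 := hφ
      refine Or.inl (Or.inr ⟨φ, ?_, ψ, ?_, rfl⟩) <;> simp only [Set.mem_ofPred_eq] <;> omega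
    | ball i φ =>
      have : φ.depth + 1 < d + 1 := hφ
      refine Or.inr (Set.mem_iUnion.2 ⟨i, φ, ?_, rfl⟩)
      simp only [Set.mem_ofPred_eq]; omega

instance Delta0.instCountable {P : Type} [Countable P] {ar : P → ℕ} (n : ℕ) :
    Countable (Delta0 P ar n) := by
  rw [← Set.countable_univ_iff]
  have : (Set.univ : Set (Delta0 P ar n)) = ⋃ d, {φ : Delta0 P ar n | φ.depth < d} := by
    ext φ
    simp only [Set.mem_univ, Set.mem_iUnion, Set.mem_ofPred_eq, true_iff]
    exact ⟨_, Nat.lt_succ_self _⟩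
  rw [this]
  exact Set.countable_iUnion fun d => Delta0.countable_depth d n

/-- `Δ₀` formulas without additional predicate symbols. -/
abbrev PureDelta0 (n : ℕ) : Type := Delta0 Empty Empty.elim n

/-- Truth of a formula in the universe of sets. -/
def PureDelta0.Holds {n : ℕ} (φ : PureDelta0 n) (v : Fin n → ZFSet.{u}) : Prop :=
  Delta0.Realize (fun a b : ZFSet.{u} => a ∈ b) (fun p => p.elim) φ v

/-- Sets closed under Skolem functions are `Δ₀`-elementary. -/
theorem PureDelta0.holds_skolem {S : Set ZFSet.{u}}
    (hS : ∀ (n : ℕ) (φ : PureDelta0 (n + 1)) (v : Fin n → ZFSet.{u}), (∀ i, v i ∈ S) →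
      (∃ a, φ.Holds (Matrix.vecCons a v)) → ∃ a ∈ S, φ.Holds (Matrix.vecCons a v))
    {n : ℕ} (φ : PureDelta0 n) (v : Fin n → S) :
    Delta0.Realize (fun a b : S => a.1 ∈ b.1) (fun p => p.elim) φ v ↔
      φ.Holds (fun i => (v i).1) := by
  have hcons : ∀ {n : ℕ} (a : S) (v : Fin n → S), (fun k => (Matrix.vecCons a v k).1) =
      Matrix.vecCons a.1 (fun k => (v k).1) := by
    intro n a v; funext k
    refine Fin.cases ?_ (fun k => ?_) k <;> rfl
  induction φ with
  | falsum => exact Iff.rfl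
  | eq i j => exact Subtype.ext_iff
  | mem i j => exact Iff.rfl
  | pred p a => exact p.elim
  | imp φ ψ ih₁ ih₂ => exact imp_congr (ih₁ v) (ih₂ v)
  | @ball n i φ ih =>
    constructor
    · intro h
      by_contra hc
      have hc' : ∃ a, a ∈ (v i).1 ∧ ¬ PureDelta0.Holds φ (Matrix.vecCons a fun k => (v k).1) := by
        by_contra hcc
        push Not at hcc
        exact hc hcc
      -- The formula `¬ (a ∈ v i → φ)` describes a counterexample to the bounded quantifier, and the
      -- closure of `S` supplies one inside `S`.
      obtain ⟨a, haS, ha⟩ := hS n (.imp (.imp (.mem 0 i.succ) φ) .falsum) (fun k => (v k).1)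
        (fun k => (v k).2) (by
          obtain ⟨a, ha, hφ⟩ := hc'
          exact ⟨a, fun h' => hφ (h' ha)⟩)
      have ha' : a ∈ (v i).1 ∧ ¬ PureDelta0.Holds φ (Matrix.vecCons a fun k => (v k).1) :=
        Classical.not_imp.1 ha
      have h1 := (ih _).1 (h ⟨a, haS⟩ ha'.1)
      rw [hcons] at h1
      exact ha'.2 h1
    · intro h a ha
      refine (ih _).2 ?_
      rw [hcons]
      exact h _ ha

/-- `Δ₀` facts about some sets and arbitrary other sets reflect to sets of small hereditary
cardinality. -/
theorem exists_delta0_reflection {κ : Cardinal.{u}} (hκ : ℵ₀ ≤ κ) {n : ℕ}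
    (v : Fin n → ZFSet.{u}) :
    ∃ v' : Fin n → ZFSet.{u}, (∀ i, HC κ (v' i)) ∧ (∀ i, HC κ (v i) → v' i = v i) ∧
      ∀ φ : PureDelta0 n, φ.Holds v' ↔ φ.Holds v := by
  classical
  choose β g hβ _ hg using fun i : Fin n => exists_enum (trcl (v i))
  -- Besides the parameters, the hull is to include the transitive closures of those that are
  -- already hereditarily small, so that the collapse leaves them fixed.
  let α : Type u := ULift.{u} (Fin n) ⊕ Σ i : ULift.{u} {i // HC κ (v i)}, β i.down.1
  let x : α → ZFSet.{u} := Sum.elim (fun i => v i.down) (fun p => g p.1.down.1 p.2)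
  have hα : #α ≤ κ := by
    rw [Cardinal.mk_sum, Cardinal.lift_id, Cardinal.lift_id]
    refine Cardinal.add_le_of_le hκ ((Cardinal.lt_aleph0_of_finite _).le.trans hκ) ?_
    rw [Cardinal.mk_sigma]
    refine (Cardinal.sum_le_sum _ (fun _ => κ) fun i => ?_).trans ?_
    · exact (hβ i.down.1).trans_le i.down.2
    · rw [Cardinal.sum_const']
      refine Cardinal.mul_le_of_le hκ ((Cardinal.lt_aleph0_of_finite _).le.trans hκ) le_rfl
  have hX : #(Set.range x) ≤ lift.{u + 1} κ := by
    have := Cardinal.mk_range_le_lift (f := x)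
    rw [Cardinal.lift_id'.{u, u + 1}] at this
    exact this.trans (Cardinal.lift_le.2 hα)
  -- A Skolem function picks a witness if there is one and otherwise has the irrelevant value `∅`.
  obtain ⟨S, hXS, hS, hcard⟩ := exists_closed_superset
    (ι := ULift.{u} (Σ n, PureDelta0 (n + 1))) (fun p => p.down.1)
    (fun p v => if h : ∃ a, p.down.2.Holds (Matrix.vecCons a v) then h.choose else ∅)
    (Set.range x) hκ hX (Cardinal.mk_le_aleph0.trans hκ)
  have hsk : ∀ (n : ℕ) (φ : PureDelta0 (n + 1)) (v : Fin n → ZFSet.{u}), (∀ i, v i ∈ S) →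
      (∃ a, φ.Holds (Matrix.vecCons a v)) → ∃ a ∈ S, φ.Holds (Matrix.vecCons a v) := by
    intro n φ v hv h
    refine ⟨_, hS ⟨⟨n, φ⟩⟩ v hv, ?_⟩
    simp only [dif_pos h]
    exact h.choose_spec
  have hsmall : Small.{u} S := by
    rw [Cardinal.small_iff_lift_mk_lt_univ, Cardinal.lift_id'.{u + 1, u + 1}]
    exact hcard.trans_lt (Cardinal.lift_lt_univ κ)
  have hext : ∀ a b : S, (∀ c : S, c.1 ∈ a.1 ↔ c.1 ∈ b.1) → a = b := by
    have key : ∀ a b : S, (∀ c : S, c.1 ∈ a.1 → c.1 ∈ b.1) → a.1 ⊆ b.1 := by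
      intro a b h z hz
      by_contra hzb
      -- The hull contains an element of `a \ b` whenever this difference is nonempty, and so it is
      -- extensional.
      obtain ⟨c, hcS, hc⟩ := hsk 2 (.imp (.imp (.mem 0 1) (.mem 0 2)) .falsum) ![a.1, b.1]
        (by intro i; fin_cases i; exacts [a.2, b.2]) ⟨z, fun h' => hzb (h' hz)⟩
      exact hc fun h' => h ⟨c, hcS⟩ h'
    intro a b h
    refine Subtype.ext (ZFSet.ext fun z => ⟨fun hz => ?_, fun hz => ?_⟩)
    · exact key a b (fun c => (h c).1) hz
    · exact key b a (fun c => (h c).2) hz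
  obtain ⟨π, hπi, hπ⟩ := exists_collapse.{u} (E := fun a b : S => a.1 ∈ b.1)
    (InvImage.wf _ ZFSet.mem_wf) hext
  have hT := collapse_isTransitive hπ
  have hTc : (ZFSet.range π).card ≤ κ := by
    have h1 := ZFSet.lift_card_range_le (f := π)
    rw [Cardinal.lift_id'.{u, u + 1}] at h1
    exact Cardinal.lift_le.{u + 1}.1 (h1.trans hcard)
  have hvS : ∀ i, v i ∈ S := fun i => hXS ⟨Sum.inl ⟨i⟩, rfl⟩
  refine ⟨fun i => π ⟨v i, hvS i⟩, fun i => hc_of_mem hT hTc (ZFSet.mem_range_self _), ?_, ?_⟩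
  · intro i hi
    have hsub : ∀ z ∈ trcl (v i), z ∈ S := by
      intro z hz
      obtain ⟨b, rfl⟩ := (hg i z).1 hz
      exact hXS ⟨Sum.inr ⟨⟨i, hi⟩, b⟩, rfl⟩
    -- The collapse is the identity on a transitive part of the hull, by `∈`-induction.
    have key : ∀ z (hz : z ∈ S), z ⊆ trcl (v i) → π ⟨z, hz⟩ = z := by
      intro z
      induction z using ZFSet.inductionOn with
      | _ z ih =>
        intro hz hzt
        ext y
        rw [hπ]
        constructor
        · rintro ⟨b, hb, rfl⟩
          rw [ih b.1 hb b.2 (isTransitive_trcl _ _ (hzt hb))]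
          exact hb
        · intro hy
          exact ⟨⟨y, hsub y (hzt hy)⟩, hy, ih y hy _ (isTransitive_trcl _ _ (hzt hy))⟩
    exact key _ _ fun y hy => mem_trcl_iff.2 (Or.inl hy)
  · intro φ
    -- Truth passes from the universe to the hull by the Skolem property, and from the hull back to
    -- the universe because its collapse has transitive range.
    rw [← PureDelta0.holds_skolem hsk φ fun i => ⟨v i, hvS i⟩]
    symm
    refine Delta0.realize_endEmbedding hπi (collapse_rel_iff hπi hπ) ?_ (fun p => p.elim) φ _
    intro a b hb
    obtain ⟨c, -, hc⟩ := (hπ a b).1 hb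
    exact ⟨c, hc⟩

/-! ### Correct sets -/

theorem PureDelta0.realize_transitive {M : ZFSet.{u}} (hM : M.IsTransitive) {n : ℕ}
    (φ : PureDelta0 n) (v : Fin n → {x // x ∈ M}) :
    Delta0.Realize (fun a b : {x // x ∈ M} => a.1 ∈ b.1) (fun p => p.elim) φ v ↔
      φ.Holds (fun i => (v i).1) := by
  refine Delta0.realize_endEmbedding (E' := fun a b : ZFSet.{u} => a ∈ b)
    (I' := fun p => p.elim) (f := fun x : {x // x ∈ M} => x.1)
    Subtype.val_injective (fun _ _ => Iff.rfl) ?_ (fun p => p.elim) φ v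
  exact fun a b hb => ⟨⟨b, hM _ a.2 hb⟩, rfl⟩

theorem coe_append {M : ZFSet.{u}} {k q : ℕ} (x : Fin k → {x // x ∈ M})
    (y : Fin q → {x // x ∈ M}) : (fun i => (Fin.append x y i).1) =
      Fin.append (fun i => (x i).1) (fun i => (y i).1) := by
  funext i
  refine Fin.addCases (fun i => ?_) (fun i => ?_) i <;> simp

/-- A true `Π₁` statement holds in every transitive set, so only the implication from `M` to the
universe carries information. In this form the quantifiers are bounded by `M`, which makes the
condition `Δ₀(R)`. -/
theorem Pi1Predicate.correct_iff (R : Pi1Predicate) {M : ZFSet.{u}} (hM : M.IsTransitive) :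
    R.Correct M ↔ ∀ m : Fin R.arity → ZFSet.{u}, (∀ i, m i ∈ M) →
      (∀ y : Fin R.numQuant → ZFSet.{u}, (∀ i, y i ∈ M) →
        PureDelta0.Holds R.matrix (Fin.append m y)) → R.Holds m := by
  have key : ∀ m : Fin R.arity → {x // x ∈ M},
      R.Realize (fun a b : {x : ZFSet.{u} // x ∈ M} => a.1 ∈ b.1) m ↔
        ∀ y : Fin R.numQuant → ZFSet.{u}, (∀ i, y i ∈ M) →
          PureDelta0.Holds R.matrix (Fin.append (fun i => (m i).1) y) := by
    intro m
    constructor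
    · intro h y hy
      have := (PureDelta0.realize_transitive hM _ _).1 (h fun i => ⟨y i, hy i⟩)
      rwa [coe_append] at this
    · intro h y
      refine (PureDelta0.realize_transitive hM _ _).2 ?_
      rw [coe_append]
      exact h _ fun i => (y i).2
  constructor
  · intro h m hm hy
    exact (h fun i => ⟨m i, hm i⟩).1 ((key _).2 hy)
  · intro h m
    rw [key]
    exact ⟨h _ fun i => (m i).2, fun h y _ => h y⟩

/-- Every set of sets of hereditary cardinality at most `κ` is included in a transitive `R`-correct
set of cardinality at most `κ`. -/
theorem exists_correct_hull (R : Pi1Predicate) {κ : Cardinal.{u}} (hκ : ℵ₀ ≤ κ)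
    {X : ZFSet.{u}} (hX : HC κ X) :
    ∃ M : ZFSet.{u}, X ⊆ M ∧ M.IsTransitive ∧ R.Correct M ∧ M.card ≤ κ := by
  classical
  let Z := {z : ZFSet.{u} // HC κ z}
  -- If `R` fails at hereditarily small `m`, then reflection turns a counterexample into a
  -- hereditarily small one while fixing `m`.
  have hw : ∀ m : Fin R.arity → Z, ∃ y : Fin R.numQuant → Z,
      R.Holds (fun i => (m i).1) ∨
        ¬ PureDelta0.Holds R.matrix (Fin.append (fun i => (m i).1) (fun i => (y i).1)) := by
    intro m
    by_cases hm : R.Holds fun i => (m i).1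
    · exact ⟨fun _ => ⟨∅, hc_empty hκ⟩, Or.inl hm⟩
    · obtain ⟨y, hy⟩ := not_forall.1 hm
      obtain ⟨v, hv, hfix, hφ⟩ := exists_delta0_reflection hκ (Fin.append (fun i => (m i).1) y)
      refine ⟨fun i => ⟨v (Fin.natAdd _ i), hv _⟩, Or.inr ?_⟩
      have : Fin.append (fun i => (m i).1) (fun i => v (Fin.natAdd _ i)) = v := by
        funext i
        refine Fin.addCases (fun i => ?_) (fun i => ?_) i
        · have h := hfix (Fin.castAdd _ i)
          simp only [Fin.append_left] at h ⊢
          exact (h (m i).2).symm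
        · simp
      simp only [this]
      rw [hφ]
      exact hy
  choose W hW using hw
  -- With `κ` functions that enumerate the elements of each set, closed families become transitive.
  -- Unused indices return `z` itself, which adds nothing.
  have hen : ∀ z : Z, ∃ f : κ.out → Z, ∀ y (hy : y ∈ z.1), ∃ a, (f a).1 = y := by
    intro z
    obtain ⟨α, f, hα, -, hf⟩ := exists_enum z.1
    have hle : #α ≤ #κ.out := by
      rw [Cardinal.mk_out, hα]; exact z.2.card_le
    obtain ⟨e⟩ := hle
    refine ⟨fun a => if h : ∃ b, e b = a then ⟨f h.choose, z.2.of_mem ((hf _).2 ⟨_, rfl⟩)⟩ else z,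
      fun y hy => ?_⟩
    obtain ⟨b, rfl⟩ := (hf y).1 hy
    refine ⟨e b, ?_⟩
    have h : ∃ b', e b' = e b := ⟨b, rfl⟩
    simp only [dif_pos h]
    rw [e.injective h.choose_spec]
  choose enum henum using hen
  have hXz : #{z : Z | z.1 ∈ X} ≤ lift.{u + 1} κ := by
    refine le_trans ?_ (Cardinal.lift_le.2 hX.card_le)
    rw [← ZFSet.cardinalMk_coe_sort]
    refine Cardinal.mk_le_of_injective (f := fun z => (⟨z.1.1, z.2⟩ : {x // x ∈ X})) ?_
    intro a b hab
    exact Subtype.ext (Subtype.ext (congrArg (fun s : {x // x ∈ X} => s.1) hab))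
  -- The unary functions secure transitivity, and the functions of `R.arity` arguments supply the
  -- counterexamples needed for correctness.
  obtain ⟨S, hXS, hS, hcard⟩ := exists_closed_superset (Z := Z)
    (ι := κ.out ⊕ ULift.{u} (Fin R.numQuant)) (Sum.elim (fun _ => 1) (fun _ => R.arity))
    (fun i => match i with
      | Sum.inl a => fun v => enum (v (0 : Fin 1)) a
      | Sum.inr j => fun v => W v j.down) {z : Z | z.1 ∈ X} hκ hXz (by
        rw [Cardinal.mk_sum, Cardinal.lift_id, Cardinal.lift_id, Cardinal.mk_out]
        exact Cardinal.add_le_of_le hκ le_rfl ((Cardinal.lt_aleph0_of_finite _).le.trans hκ))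
  obtain ⟨M, hM, hMc⟩ := exists_zfset_of_card_le (Subtype.val '' S)
    (Cardinal.mk_image_le.trans hcard)
  have hMS : ∀ x, x ∈ M → ∃ z ∈ S, z.1 = x := fun x hx => (hM x).1 hx
  have htr : M.IsTransitive := by
    intro y hy x hx
    obtain ⟨z, hz, rfl⟩ := hMS y hy
    obtain ⟨a, rfl⟩ := henum z x hx
    exact (hM _).2 ⟨_, hS (Sum.inl a) (fun _ => z) (fun _ => hz), rfl⟩
  refine ⟨M, ?_, htr, ?_, hMc⟩
  · intro x hx
    exact (hM x).2 ⟨⟨x, hX.of_mem hx⟩, hXS hx, rfl⟩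
  · rw [R.correct_iff htr]
    intro m hm h
    choose z hz hzm using fun i => hMS _ (hm i)
    obtain rfl : (fun i => (z i).1) = m := funext hzm
    refine (hW z).resolve_right fun hn => hn (h _ fun i => ?_)
    exact (hM _).2 ⟨_, hS (Sum.inr ⟨i⟩) z hz, rfl⟩

/-! ### Definability by `Δ₀(R)` formulas -/

/-- `Q` is defined by a `Δ₀(R)` formula. -/
def D0 (R : Pi1Predicate) {n : ℕ} (Q : (Fin n → ZFSet.{u}) → Prop) : Prop :=
  ∃ ψ : Delta0Rel R n, ∀ v, ψ.Holds v ↔ Q v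

variable {R : Pi1Predicate}

namespace D0

theorem congr {n : ℕ} {Q Q' : (Fin n → ZFSet.{u}) → Prop} (h : D0 R Q) (hQ : ∀ v, Q' v ↔ Q v) :
    D0 R Q' := by
  obtain ⟨ψ, hψ⟩ := h
  exact ⟨ψ, fun v => (hψ v).trans (hQ v).symm⟩

theorem falsum {n : ℕ} : D0 R (fun _ : Fin n → ZFSet.{u} => False) := ⟨.falsum, fun _ => Iff.rfl⟩

theorem eq {n : ℕ} (i j : Fin n) : D0 R (fun v : Fin n → ZFSet.{u} => v i = v j) :=
  ⟨.eq i j, fun _ => Iff.rfl⟩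

theorem mem {n : ℕ} (i j : Fin n) : D0 R (fun v : Fin n → ZFSet.{u} => v i ∈ v j) :=
  ⟨.mem i j, fun _ => Iff.rfl⟩

theorem pred {n : ℕ} (a : Fin R.arity → Fin n) :
    D0 R (fun v : Fin n → ZFSet.{u} => R.Holds fun k => v (a k)) :=
  ⟨.pred () a, fun _ => Iff.rfl⟩

theorem imp {n : ℕ} {Q Q' : (Fin n → ZFSet.{u}) → Prop} (h : D0 R Q) (h' : D0 R Q') :
    D0 R (fun v => Q v → Q' v) := by
  obtain ⟨ψ, hψ⟩ := h
  obtain ⟨ψ', hψ'⟩ := h'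
  exact ⟨.imp ψ ψ', fun v => imp_congr (hψ v) (hψ' v)⟩

theorem ball {n : ℕ} (i : Fin n) {Q : (Fin (n + 1) → ZFSet.{u}) → Prop} (h : D0 R Q) :
    D0 R (fun v => ∀ a ∈ v i, Q (Matrix.vecCons a v)) := by
  obtain ⟨ψ, hψ⟩ := h
  exact ⟨.ball i ψ, fun v => forall_congr' fun a => imp_congr_right fun _ => hψ _⟩

theorem not {n : ℕ} {Q : (Fin n → ZFSet.{u}) → Prop} (h : D0 R Q) : D0 R (fun v => ¬ Q v) :=
  h.imp falsum

theorem and {n : ℕ} {Q Q' : (Fin n → ZFSet.{u}) → Prop} (h : D0 R Q) (h' : D0 R Q') :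
    D0 R (fun v => Q v ∧ Q' v) :=
  (h.imp h'.not).not.congr fun v => by tauto

theorem or {n : ℕ} {Q Q' : (Fin n → ZFSet.{u}) → Prop} (h : D0 R Q) (h' : D0 R Q') :
    D0 R (fun v => Q v ∨ Q' v) :=
  (h.not.imp h').congr fun v => by tauto

theorem iff {n : ℕ} {Q Q' : (Fin n → ZFSet.{u}) → Prop} (h : D0 R Q) (h' : D0 R Q') :
    D0 R (fun v => Q v ↔ Q' v) :=
  ((h.imp h').and (h'.imp h)).congr fun v => by tauto

theorem bex {n : ℕ} (i : Fin n) {Q : (Fin (n + 1) → ZFSet.{u}) → Prop} (h : D0 R Q) :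
    D0 R (fun v => ∃ a ∈ v i, Q (Matrix.vecCons a v)) :=
  (h.not.ball i).not.congr fun v => by simp

theorem forall_fin {n : ℕ} : ∀ {N : ℕ} {Q : Fin N → (Fin n → ZFSet.{u}) → Prop},
    (∀ k, D0 R (Q k)) → D0 R (fun v => ∀ k, Q k v)
  | 0, _, _ => (falsum.not).congr fun v => by simp
  | N + 1, Q, h => ((h 0).and (forall_fin fun k : Fin N => h k.succ)).congr fun v =>
      Fin.forall_fin_succ

theorem exists_fin {n : ℕ} {N : ℕ} {Q : Fin N → (Fin n → ZFSet.{u}) → Prop}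
    (h : ∀ k, D0 R (Q k)) : D0 R (fun v => ∃ k, Q k v) :=
  (forall_fin fun k => (h k).not).not.congr fun v => by simp

end D0

/-- Renaming of the free variables of a formula. -/
def Delta0.rename {P : Type} {ar : P → ℕ} : {n m : ℕ} → (Fin n → Fin m) → Delta0 P ar n →
    Delta0 P ar m
  | _, _, _, .falsum => .falsum
  | _, _, f, .eq i j => .eq (f i) (f j)
  | _, _, f, .mem i j => .mem (f i) (f j)
  | _, _, f, .pred p a => .pred p fun k => f (a k)
  | _, _, f, .imp φ ψ => .imp (φ.rename f) (ψ.rename f)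
  | _, _, f, .ball i φ => .ball (f i) (φ.rename (Fin.cons 0 fun k => (f k).succ))

theorem Delta0.realize_rename {P : Type} {ar : P → ℕ} {A : Type w} (E : A → A → Prop)
    (I : ∀ p, (Fin (ar p) → A) → Prop) {n : ℕ} (φ : Delta0 P ar n) {m : ℕ} (f : Fin n → Fin m)
    (v : Fin m → A) : (φ.rename f).Realize E I v ↔ φ.Realize E I (fun i => v (f i)) := by
  induction φ generalizing m with
  | falsum => exact Iff.rfl
  | eq i j => exact Iff.rfl
  | mem i j => exact Iff.rfl
  | pred p a => exact Iff.rfl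
  | imp φ ψ ih₁ ih₂ => exact imp_congr (ih₁ f v) (ih₂ f v)
  | ball i φ ih =>
    refine forall_congr' fun a => imp_congr_right fun _ => ?_
    rw [ih]
    refine iff_of_eq (congrArg _ ?_)
    funext k
    refine Fin.cases ?_ (fun k => ?_) k <;> rfl

/-- The inclusion of the formulas of `{∈}` in those of `{∈, R}`. -/
def PureDelta0.toRel (R : Pi1Predicate) : {n : ℕ} → PureDelta0 n → Delta0Rel R n
  | _, .falsum => .falsum
  | _, .eq i j => .eq i j
  | _, .mem i j => .mem i j
  | _, .pred p _ => p.elim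
  | _, .imp φ ψ => .imp (toRel R φ) (toRel R ψ)
  | _, .ball i φ => .ball i (toRel R φ)

theorem PureDelta0.holds_toRel {n : ℕ} (φ : PureDelta0 n) (v : Fin n → ZFSet.{u}) :
    (toRel R φ).Holds v ↔ φ.Holds v := by
  induction φ with
  | falsum => exact Iff.rfl
  | eq i j => exact Iff.rfl
  | mem i j => exact Iff.rfl
  | pred p a => exact p.elim
  | imp φ ψ ih₁ ih₂ => exact imp_congr (ih₁ v) (ih₂ v)
  | ball i φ ih => exact forall_congr' fun a => imp_congr_right fun _ => ih _

namespace D0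

theorem pure {n : ℕ} (φ : PureDelta0 n) : D0 R (fun v : Fin n → ZFSet.{u} => φ.Holds v) :=
  ⟨_, PureDelta0.holds_toRel φ⟩

theorem comp {n m : ℕ} {Q : (Fin n → ZFSet.{u}) → Prop} (h : D0 R Q) (f : Fin n → Fin m) :
    D0 R (fun v => Q fun i => v (f i)) := by
  obtain ⟨ψ, hψ⟩ := h
  exact ⟨ψ.rename f, fun v => (Delta0.realize_rename _ _ ψ f v).trans (hψ _)⟩

/-- A bounded quantifier puts its variable in front, whereas `Fin.append` in the definition of a
`Π₁` predicate needs it at the end. -/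
theorem ball_snoc {n : ℕ} (i : Fin n) {Q : (Fin (n + 1) → ZFSet.{u}) → Prop} (h : D0 R Q) :
    D0 R (fun v => ∀ a ∈ v i, Q (Fin.snoc (α := fun _ => ZFSet.{u}) v a)) := by
  refine ((h.comp (Fin.snoc (α := fun _ => Fin (n + 1)) Fin.succ 0)).ball i).congr fun v => ?_
  refine forall_congr' fun a => imp_congr_right fun _ => iff_of_eq (congrArg Q ?_)
  funext k
  refine Fin.lastCases ?_ (fun k => ?_) k <;> simp

theorem ball_block {n : ℕ} (j : Fin n) : ∀ {k : ℕ} {Q : (Fin (n + k) → ZFSet.{u}) → Prop},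
    D0 R Q → D0 R (fun v => ∀ y : Fin k → ZFSet.{u}, (∀ i, y i ∈ v j) → Q (Fin.append v y))
  | 0, Q, h => h.congr fun v => by
      have : ∀ y : Fin 0 → ZFSet.{u}, Fin.append v y = v := fun y => by
        funext i; exact Fin.append_left v y i
      simp [this]
  | k + 1, Q, h => by
      refine (ball_block j (ball_snoc (Fin.castAdd k j) (Q := Q) h)).congr fun v => ?_
      constructor
      · intro H y hy a ha
        rw [Fin.append_left] at ha
        rw [← Fin.append_snoc]
        refine H _ fun i => ?_
        refine Fin.lastCases ?_ (fun i => ?_) i <;> simp [*]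
      · intro H y hy
        have := H (Fin.init (α := fun _ => ZFSet.{u}) y) (fun i => hy _) (y (Fin.last k)) (by
          rw [Fin.append_left]; exact hy _)
        rwa [← Fin.append_snoc, Fin.snoc_init_self] at this

theorem empty {n : ℕ} (i : Fin n) : D0 R (fun v : Fin n → ZFSet.{u} => v i = ∅) :=
  (falsum.ball i).congr fun v => by simp [ZFSet.eq_empty]

theorem unordered {n : ℕ} (i j k : Fin n) :
    D0 R (fun v : Fin n → ZFSet.{u} => v i = {v j, v k}) := by
  refine ((mem j i).and ((mem k i).and
    (((eq 0 j.succ).or (eq 0 k.succ)).ball i))).congr fun v => ?_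
  change _ ↔ v j ∈ v i ∧ v k ∈ v i ∧ ∀ a ∈ v i, a = v j ∨ a = v k
  constructor
  · intro h; rw [h]; simp
  · rintro ⟨h1, h2, h3⟩
    ext z
    rw [ZFSet.mem_pair]
    exact ⟨h3 z, by rintro (rfl | rfl) <;> assumption⟩

theorem pair {n : ℕ} (i j k : Fin n) :
    D0 R (fun v : Fin n → ZFSet.{u} => v i = ZFSet.pair (v j) (v k)) := by
  refine ((((unordered 1 j.succ.succ j.succ.succ).and ((unordered 0 j.succ.succ k.succ.succ).and
    (unordered i.succ.succ 1 0))).bex i.succ).bex i).congr fun v => ?_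
  change _ ↔ ∃ a ∈ v i, ∃ b ∈ v i, a = {v j, v j} ∧ b = {v j, v k} ∧ v i = {a, b}
  constructor
  · intro h
    refine ⟨{v j}, ?_, {v j, v k}, ?_, ?_, rfl, ?_⟩
    · rw [h, ZFSet.pair]; simp
    · rw [h, ZFSet.pair]; simp
    · simp
    · rw [h, ZFSet.pair]
  · rintro ⟨a, -, b, -, rfl, rfl, h⟩
    rw [h, ZFSet.pair]
    simp

/-- The components of a Kuratowski pair are elements of its elements, so these quantifiers can be
bounded. Iterating this handles tuples, graphs and codes. -/
theorem ex_pair {n : ℕ} (i : Fin n) {Q : (Fin (n + 2) → ZFSet.{u}) → Prop} (h : D0 R Q) :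
    D0 R (fun v => ∃ s t, v i = ZFSet.pair s t ∧ Q (Matrix.vecCons t (Matrix.vecCons s v))) := by
  have h' := h.comp (m := n + 4) (Fin.cons 0 (Fin.cons 2 fun k => k.succ.succ.succ.succ))
  refine ((((((pair i.succ.succ.succ.succ 2 0).and h').bex 0).bex i.succ.succ).bex 0).bex
    i).congr fun v => ?_
  have hc : ∀ p s p' t : ZFSet.{u}, (fun k => Matrix.vecCons t (Matrix.vecCons p'
      (Matrix.vecCons s (Matrix.vecCons p v))) ((Fin.cons 0 (Fin.cons 2 fun k =>
        k.succ.succ.succ.succ) : Fin (n + 2) → Fin (n + 4)) k)) =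
      Matrix.vecCons t (Matrix.vecCons s v) := by
    intro p s p' t
    funext k
    refine Fin.cases rfl (fun k => ?_) k
    refine Fin.cases rfl (fun k => rfl) k
  simp only [hc]
  change _ ↔ ∃ p ∈ v i, ∃ s ∈ p, ∃ p' ∈ v i, ∃ t ∈ p', v i = ZFSet.pair s t ∧
    Q (Matrix.vecCons t (Matrix.vecCons s v))
  constructor
  · rintro ⟨s, t, hst, hQ⟩
    refine ⟨{s}, ?_, s, ?_, {s, t}, ?_, t, ?_, hst, hQ⟩
    · rw [hst, ZFSet.pair]; simp
    · simp
    · rw [hst, ZFSet.pair]; simp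
    · simp
  · rintro ⟨-, -, s, -, -, -, t, -, h, hQ⟩
    exact ⟨s, t, h, hQ⟩

theorem tuple : ∀ {N n : ℕ} (i : Fin n) (f : Fin N → Fin n),
    D0 R (fun v : Fin n → ZFSet.{u} => v i = BoundedSymbiosis.tuple fun k => v (f k))
  | 0, _, i, _ => empty i
  | N + 1, n, i, f => by
      refine (ex_pair i ((eq 1 (f 0).succ.succ).and
        (tuple 0 fun k : Fin N => (f k.succ).succ.succ))).congr fun v => ?_
      change v i = ZFSet.pair _ _ ↔ ∃ s t, v i = ZFSet.pair s t ∧ s = v (f 0) ∧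
        t = BoundedSymbiosis.tuple fun k => v (f k.succ)
      exact ⟨fun h => ⟨_, _, h, rfl, rfl⟩, by rintro ⟨s, t, h, rfl, rfl⟩; exact h⟩

theorem tuple_mem {N n : ℕ} (i : Fin n) (f : Fin N → Fin n) :
    D0 R (fun v : Fin n → ZFSet.{u} => (BoundedSymbiosis.tuple fun k => v (f k)) ∈ v i) := by
  refine ((tuple 0 fun k => (f k).succ).bex i).congr fun v => ?_
  change _ ↔ ∃ a ∈ v i, a = BoundedSymbiosis.tuple fun k => v (f k)
  simp

theorem ex_tuple : ∀ {N n : ℕ} (i : Fin n) (f : Fin N → Fin n),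
    D0 R (fun v : Fin n → ZFSet.{u} => ∃ a : Fin N → ZFSet.{u}, (∀ k, a k ∈ v (f k)) ∧
      v i = BoundedSymbiosis.tuple a)
  | 0, _, i, _ => (empty i).congr fun v => by simp [BoundedSymbiosis.tuple]
  | N + 1, n, i, f => by
      refine (ex_pair i ((mem 1 (f 0).succ.succ).and
        (ex_tuple 0 fun k : Fin N => (f k.succ).succ.succ))).congr fun v => ?_
      change _ ↔ ∃ s t, v i = ZFSet.pair s t ∧ s ∈ v (f 0) ∧
        ∃ a : Fin N → ZFSet.{u}, (∀ k, a k ∈ v (f k.succ)) ∧ t = BoundedSymbiosis.tuple a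
      constructor
      · rintro ⟨a, ha, h⟩
        exact ⟨_, _, h, ha 0, _, fun k => ha k.succ, rfl⟩
      · rintro ⟨s, t, h, hs, a, ha, rfl⟩
        refine ⟨Fin.cons s a, fun k => ?_, h⟩
        refine Fin.cases hs (fun k => ha k) k

theorem ex_graph {N n : ℕ} (i j : Fin n) (f : Fin N → Fin n) :
    D0 R (fun v : Fin n → ZFSet.{u} => ∃ (a : Fin N → ZFSet.{u}) (b : ZFSet.{u}),
      (∀ k, a k ∈ v (f k)) ∧ b ∈ v j ∧ v i = ZFSet.pair (BoundedSymbiosis.tuple a) b) := by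
  refine (ex_pair i ((ex_tuple 1 fun k => (f k).succ.succ).and (mem 0 j.succ.succ))).congr
    fun v => ?_
  change _ ↔ ∃ s t, v i = ZFSet.pair s t ∧ (∃ a : Fin N → ZFSet.{u}, (∀ k, a k ∈ v (f k)) ∧
    s = BoundedSymbiosis.tuple a) ∧ t ∈ v j
  constructor
  · rintro ⟨a, b, ha, hb, h⟩; exact ⟨_, _, h, ⟨a, ha, rfl⟩, hb⟩
  · rintro ⟨s, t, h, ⟨a, ha, rfl⟩, ht⟩; exact ⟨a, t, ha, ht, h⟩

theorem graph_mem {N n : ℕ} (i j : Fin n) (f : Fin N → Fin n) :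
    D0 R (fun v : Fin n → ZFSet.{u} =>
      ZFSet.pair (BoundedSymbiosis.tuple fun k => v (f k)) (v j) ∈ v i) := by
  refine ((ex_pair 0 ((tuple 1 fun k => (f k).succ.succ.succ).and
    (eq 0 j.succ.succ.succ))).bex i).congr fun v => ?_
  change _ ↔ ∃ a ∈ v i, ∃ s t, a = ZFSet.pair s t ∧
    (s = BoundedSymbiosis.tuple fun k => v (f k)) ∧ t = v j
  constructor
  · intro h; exact ⟨_, h, _, _, rfl, rfl, rfl⟩
  · rintro ⟨a, ha, s, t, rfl, rfl, rfl⟩; exact ha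

theorem isTransitive {n : ℕ} (i : Fin n) :
    D0 R (fun v : Fin n → ZFSet.{u} => (v i).IsTransitive) :=
  ((mem 0 i.succ.succ).ball 0 |>.ball i).congr fun _ => Iff.rfl

/-- By `Pi1Predicate.correct_iff` all quantifiers are bounded by the set itself. Transitivity is
part of the statement since that criterion presupposes it. -/
theorem correct {n : ℕ} (i : Fin n) :
    D0 R (fun v : Fin n → ZFSet.{u} => (v i).IsTransitive ∧ R.Correct (v i)) := by
  have h1 : D0 R (fun w : Fin (n + R.arity) → ZFSet.{u} =>
      ∀ y : Fin R.numQuant → ZFSet.{u}, (∀ j, y j ∈ w (Fin.castAdd _ i)) →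
        PureDelta0.Holds R.matrix (Fin.append (fun j => w (Fin.natAdd n j)) y)) := by
    refine (ball_block (Fin.castAdd _ i) ((pure R.matrix).comp (Fin.append
      (fun j => Fin.castAdd R.numQuant (Fin.natAdd n j)) (Fin.natAdd (n + R.arity))))).congr ?_
    intro w
    refine forall_congr' fun y => imp_congr_right fun _ => iff_of_eq (congrArg _ ?_)
    funext k
    refine Fin.addCases (fun k => ?_) (fun k => ?_) k <;> simp
  have h2 := ball_block i (h1.imp (pred (Fin.natAdd n)))
  refine ((isTransitive i).and h2).congr fun v => ?_
  refine and_congr_right fun ht => ?_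
  rw [R.correct_iff ht]
  simp only [Fin.append_left, Fin.append_right]

end D0

theorem tuple_injective : ∀ {n : ℕ} {a b : Fin n → ZFSet.{u}}, tuple a = tuple b → a = b
  | 0, _, _, _ => Subsingleton.elim _ _
  | n + 1, a, b, h => by
      obtain ⟨h0, h1⟩ := ZFSet.pair_inj.1 (show ZFSet.pair _ _ = ZFSet.pair _ _ from h)
      have h2 := tuple_injective h1
      funext i
      exact Fin.cases h0 (fun i => congrFun h2 i) i

theorem sigma1_of_d0 {R : Pi1Predicate} {C : Set ZFSet.{u}} {Q : (Fin 2 → ZFSet.{u}) → Prop}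
    (hQ : D0 R Q) (sound : ∀ x y, Q ![x, y] → x ∈ C)
    (complete : ∀ x ∈ C, ∃ y, HC (hRank x) y ∧ Q ![x, y]) : Sigma1 id R C := by
  obtain ⟨ψ, hψ⟩ := hQ
  refine ⟨ψ, fun x => ⟨fun h => ?_, fun ⟨y, hy⟩ => sound x y ((hψ _).1 hy)⟩, fun x hx => ?_⟩
  · obtain ⟨y, -, hy⟩ := complete x h
    exact ⟨y, (hψ _).2 hy⟩
  · obtain ⟨y, hr, hy⟩ := complete x hx
    exact ⟨y, (hRank_le_iff (aleph0_le_hRank x)).2 hr, (hψ _).2 hy⟩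

/-! ### Structures with one binary relation as sets -/

/-- The listing of the only sort and the only symbol. -/
def edgeListing : edgeVocabulary.{u}.Listing where
  numSorts := 1
  sorts :=
    { toFun := fun _ => PUnit.unit
      invFun := fun _ => 0
      left_inv := fun _ => Subsingleton.elim _ _
      right_inv := fun _ => rfl }
  numRels := 1
  rels :=
    { toFun := fun _ => ⟨2, fun _ => PUnit.unit, EdgeRel.edge⟩
      invFun := fun _ => 0
      left_inv := fun _ => Subsingleton.elim _ _
      right_inv := by rintro ⟨n, s, r⟩; cases r; rfl }
  numFuns := 0
  funs :=
    { toFun := fun i => i.elim0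
      invFun := fun f => f.2.2.2.elim
      left_inv := fun i => i.elim0
      right_inv := fun f => f.2.2.2.elim }

/-- The code of a structure with domain `D` and relation `r`. -/
noncomputable def edgeCode (D r : ZFSet.{u}) : ZFSet.{u} :=
  ZFSet.pair (ZFSet.pair D ∅) (ZFSet.pair (ZFSet.pair r ∅) (ZFSet.pair ∅ ∅))

theorem edgeCode_inj {D r D' r' : ZFSet.{u}} (h : edgeCode D r = edgeCode D' r') :
    D = D' ∧ r = r' := by
  simp only [edgeCode, ZFSet.pair_inj] at h
  tauto

/-- The relation of a structure whose elements are sets, as a set. -/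
noncomputable def edgeSet (A : Struc edgeVocabulary.{u}) (e : A.dom PUnit.unit → ZFSet.{u}) :
    ZFSet.{u} :=
  ZFSet.range fun v : {v : Fin 2 → A.dom PUnit.unit //
    A.rel (s := fun _ : Fin 2 => PUnit.unit) EdgeRel.edge v} => tuple fun i => e (v.1 i)

theorem mem_edgeSet {A : Struc edgeVocabulary.{u}} {e : A.dom PUnit.unit → ZFSet.{u}}
    (he : Function.Injective e) (a b : A.dom PUnit.unit) :
    tuple ![e a, e b] ∈ edgeSet A e ↔ A.E a b := by
  rw [edgeSet, ZFSet.mem_range]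
  constructor
  · rintro ⟨⟨v, hv⟩, h⟩
    have h' := tuple_injective h
    have h0 : v 0 = a := he (congrFun h' 0)
    have h1 : v 1 = b := he (congrFun h' 1)
    have : v = ![a, b] := by
      funext i; fin_cases i
      exacts [h0, h1]
    rw [this] at hv
    exact hv
  · intro h
    refine ⟨⟨![a, b], h⟩, congrArg tuple ?_⟩
    funext i; fin_cases i <;> rfl

/-- `D` is the domain and `r` is the relation of a structure. -/
def GoodEdge (D r : ZFSet.{u}) : Prop :=
  D ≠ ∅ ∧ ∀ z ∈ r, ∃ a : Fin 2 → ZFSet.{u}, (∀ k, a k ∈ D) ∧ z = tuple a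

theorem goodEdge_code (A : Struc edgeVocabulary.{u}) (e : A.dom PUnit.unit → ZFSet.{u}) :
    GoodEdge (ZFSet.range e) (edgeSet A e) := by
  constructor
  · obtain ⟨a⟩ := A.nonempty PUnit.unit
    intro h
    have := ZFSet.mem_range_self (f := e) a
    rw [h] at this
    exact ZFSet.notMem_empty _ this
  · intro z hz
    obtain ⟨v, rfl⟩ := ZFSet.mem_range.1 hz
    exact ⟨_, fun k => ZFSet.mem_range_self _, rfl⟩

theorem exists_struc_of_goodEdge {D r : ZFSet.{u}} (h : GoodEdge D r) :
    ∃ (A : Struc edgeVocabulary.{u}) (e : A.dom PUnit.unit → ZFSet.{u}), Function.Injective e ∧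
      ZFSet.range e = D ∧ edgeSet A e = r := by
  obtain ⟨α, f, -, hf, hm⟩ := exists_enum D
  obtain ⟨d, hd⟩ := (ZFSet.eq_empty_or_nonempty D).resolve_left h.1
  obtain ⟨a, -⟩ := (hm d).1 hd
  -- The relation is given for all arities at once; only arity two occurs.
  refine ⟨⟨fun _ => α, fun _ => ⟨a⟩, fun {n s} _ v => tuple (fun i : Fin n => f (v i)) ∈ r,
    fun f => f.elim⟩, f, hf, ?_, ?_⟩
  · ext z
    rw [ZFSet.mem_range, hm]
  · ext z
    rw [edgeSet, ZFSet.mem_range]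
    constructor
    · rintro ⟨⟨v, hv⟩, rfl⟩
      exact hv
    · intro hz
      obtain ⟨a, ha, rfl⟩ := h.2 z hz
      choose b hb using fun k => (hm _).1 (ha k)
      obtain rfl : (fun k => f (b k)) = a := funext hb
      exact ⟨⟨b, hz⟩, rfl⟩

/-- `f` is the graph of an isomorphism of `(D, r)` with `(M, ∈)`. -/
def IsEdgeIso (D r M f : ZFSet.{u}) : Prop :=
  (∀ a ∈ D, ∃ m ∈ M, ZFSet.pair a m ∈ f) ∧ (∀ m ∈ M, ∃ a ∈ D, ZFSet.pair a m ∈ f) ∧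
    ∀ a ∈ D, ∀ b ∈ D, ∀ m ∈ M, ∀ n ∈ M, ZFSet.pair a m ∈ f → ZFSet.pair b n ∈ f →
      ((a = b ↔ m = n) ∧ (tuple ![a, b] ∈ r ↔ m ∈ n))

/-- `F` is an isomorphism of `A` with `(M, ∈)`. -/
def IsMemIso (A : Struc edgeVocabulary.{u}) (M : ZFSet.{u}) (F : A.dom PUnit.unit → ZFSet.{u}) :
    Prop :=
  Function.Injective F ∧ (∀ x, x ∈ M ↔ ∃ a, F a = x) ∧ ∀ a b, A.E a b ↔ F a ∈ F b

theorem mem_Q_iff {R : Pi1Predicate} {A : Struc edgeVocabulary.{u}} :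
    A ∈ Q R ↔ ∃ M : ZFSet.{u}, (M.IsTransitive ∧ R.Correct M) ∧ ∃ F, IsMemIso A M F := by
  constructor
  · rintro ⟨M, hM, hR, f, hf⟩
    refine ⟨M, ⟨hM, hR⟩, fun a => (f a).1, Subtype.val_injective.comp f.injective, ?_, hf⟩
    intro x
    exact ⟨fun hx => ⟨f.symm ⟨x, hx⟩, by simp⟩, by rintro ⟨a, rfl⟩; exact (f a).2⟩
  · rintro ⟨M, ⟨hM, hR⟩, F, hi, hm, hE⟩
    refine ⟨M, hM, hR, Equiv.ofBijective (fun a => ⟨F a, (hm _).2 ⟨a, rfl⟩⟩) ⟨?_, ?_⟩, hE⟩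
    · intro a b h
      exact hi (congrArg Subtype.val h)
    · rintro ⟨x, hx⟩
      obtain ⟨a, rfl⟩ := (hm x).1 hx
      exact ⟨a, rfl⟩

theorem IsEdgeIso.exists_isMemIso {A : Struc edgeVocabulary.{u}}
    {e : A.dom PUnit.unit → ZFSet.{u}} (he : Function.Injective e) {M f : ZFSet.{u}}
    (h : IsEdgeIso (ZFSet.range e) (edgeSet A e) M f) : ∃ F, IsMemIso A M F := by
  obtain ⟨h1, h2, h3⟩ := h
  choose F hFM hF using fun a => h1 (e a) (ZFSet.mem_range_self a)
  have h4 := fun a b => h3 (e a) (ZFSet.mem_range_self a) (e b) (ZFSet.mem_range_self b)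
  refine ⟨F, fun a b hab => ?_, fun x => ⟨fun hx => ?_, ?_⟩, fun a b => ?_⟩
  · exact he ((h4 a b _ (hFM a) _ (hFM b) (hF a) (hF b)).1.2 hab)
  · obtain ⟨d, hd, hdf⟩ := h2 x hx
    obtain ⟨a, rfl⟩ := ZFSet.mem_range.1 hd
    exact ⟨a, (h4 a a _ (hFM a) _ hx (hF a) hdf).1.1 rfl⟩
  · rintro ⟨a, rfl⟩
    exact hFM a
  · rw [← (h4 a b _ (hFM a) _ (hFM b) (hF a) (hF b)).2, mem_edgeSet he]

/-- A transitive `M` in bijection with the domain has hereditary cardinality at most that of the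
domain. This is why the bound can be the identity. -/
theorem IsMemIso.exists_isEdgeIso {A : Struc edgeVocabulary.{u}}
    {e : A.dom PUnit.unit → ZFSet.{u}} (he : Function.Injective e) {M : ZFSet.{u}}
    {F : A.dom PUnit.unit → ZFSet.{u}} (h : IsMemIso A M F) (hM : M.IsTransitive)
    {κ : Cardinal.{u}} (hκ : ℵ₀ ≤ κ) (hD : HC κ (ZFSet.range e)) :
    ∃ f, IsEdgeIso (ZFSet.range e) (edgeSet A e) M f ∧ HC κ (ZFSet.pair M f) := by
  obtain ⟨hi, hm, hE⟩ := h
  have hA : #(A.dom PUnit.unit) ≤ κ := (card_range_of_injective he) ▸ hD.card_le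
  have hMc : M.card ≤ κ := (card_le_of_surjOn F fun x hx => (hm x).1 hx).trans hA
  have hMκ : HC κ M := hc_of_subset hM hMc fun _ h => h
  refine ⟨ZFSet.range fun a => ZFSet.pair (e a) (F a), ⟨?_, ?_, ?_⟩, hc_pair hκ hMκ
    (hc_range hκ hA fun a => hc_pair hκ (hD.of_mem (ZFSet.mem_range_self a))
      (hMκ.of_mem ((hm _).2 ⟨a, rfl⟩)))⟩
  · intro a ha
    obtain ⟨a, rfl⟩ := ZFSet.mem_range.1 ha
    exact ⟨F a, (hm _).2 ⟨a, rfl⟩, ZFSet.mem_range_self a⟩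
  · intro m hm'
    obtain ⟨a, rfl⟩ := (hm m).1 hm'
    exact ⟨e a, ZFSet.mem_range_self a, ZFSet.mem_range_self a⟩
  · intro a _ b _ m _ n _ h1 h2
    obtain ⟨c, hc⟩ := ZFSet.mem_range.1 h1
    obtain ⟨d, hd⟩ := ZFSet.mem_range.1 h2
    obtain ⟨rfl, rfl⟩ := ZFSet.pair_inj.1 hc
    obtain ⟨rfl, rfl⟩ := ZFSet.pair_inj.1 hd
    rw [he.eq_iff, hi.eq_iff, mem_edgeSet he, hE]
    exact ⟨Iff.rfl, Iff.rfl⟩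

/-- The relation `r` is extensional on `D`. -/
def ExtEdge (D r : ZFSet.{u}) : Prop :=
  ∀ a ∈ D, ∀ b ∈ D, (∀ c ∈ D, tuple ![c, a] ∈ r ↔ tuple ![c, b] ∈ r) → a = b

/-- `y` is a nonempty set without an `r`-minimal element. -/
def NoMinEdge (D r y : ZFSet.{u}) : Prop :=
  (∃ a ∈ y, True) ∧ ∀ a ∈ y, a ∈ D ∧ ∃ b ∈ y, tuple ![b, a] ∈ r

namespace D0

variable {R : Pi1Predicate}

theorem tuple₂_mem {n : ℕ} (i j k : Fin n) :
    D0 R (fun v : Fin n → ZFSet.{u} => BoundedSymbiosis.tuple ![v j, v k] ∈ v i) := by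
  refine (tuple_mem i ![j, k]).congr fun v => ?_
  have : (fun l => v ((![j, k] : Fin 2 → Fin n) l)) = ![v j, v k] := by
    funext l; fin_cases l <;> rfl
  rw [this]

theorem pair_mem {n : ℕ} (i j k : Fin n) :
    D0 R (fun v : Fin n → ZFSet.{u} => ZFSet.pair (v j) (v k) ∈ v i) := by
  refine ((pair 0 j.succ k.succ).bex i).congr fun v => ?_
  change _ ↔ ∃ a ∈ v i, a = ZFSet.pair (v j) (v k)
  simp

theorem ex_edgeCode {Q : (Fin 3 → ZFSet.{u}) → Prop} (h : D0 R Q) :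
    D0 R (fun v : Fin 2 → ZFSet.{u} => ∃ D r, v 0 = edgeCode D r ∧ Q ![D, r, v 1]) := by
  -- Taking five pairs apart binds ten variables; `D`, `r` and `v 1` then have the positions 7, 3
  -- and 11.
  have h1 := h.comp (m := 12) ![7, 3, 11]
  refine (ex_pair 0 (ex_pair 1 ((empty 0).and (ex_pair 2 (ex_pair 1 ((empty 0).and
    (ex_pair 2 ((empty 0).and ((empty 1).and h1))))))))).congr fun v => ?_
  have hv : ∀ t₁ t₂ t₃ t₄ t₅ r D t₆ t₇ t₈ : ZFSet.{u}, (fun i => (Matrix.vecCons t₁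
      (Matrix.vecCons t₂ (Matrix.vecCons t₃ (Matrix.vecCons r (Matrix.vecCons t₄ (Matrix.vecCons t₅
      (Matrix.vecCons t₆ (Matrix.vecCons D (Matrix.vecCons t₇ (Matrix.vecCons t₈ v))))))))) :
        Fin 12 → ZFSet.{u}) ((![7, 3, 11] : Fin 3 → Fin 12) i)) = ![D, r, v 1] := by
    intros; funext i; fin_cases i <;> rfl
  simp only [hv]
  change _ ↔ ∃ s t, v 0 = ZFSet.pair s t ∧ ∃ D p, s = ZFSet.pair D p ∧ p = ∅ ∧
    ∃ s' t', t = ZFSet.pair s' t' ∧ ∃ r p', s' = ZFSet.pair r p' ∧ p' = ∅ ∧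
      ∃ q q', t' = ZFSet.pair q q' ∧ q' = ∅ ∧ q = ∅ ∧ Q ![D, r, v 1]
  constructor
  · rintro ⟨D, r, h, hQ⟩
    exact ⟨_, _, h, _, _, rfl, rfl, _, _, rfl, _, _, rfl, rfl, _, _, rfl, rfl, rfl, hQ⟩
  · rintro ⟨_, _, h, D, _, rfl, rfl, _, _, rfl, r, _, rfl, rfl, _, _, rfl, rfl, rfl, hQ⟩
    exact ⟨D, r, h, hQ⟩

theorem goodEdge {n : ℕ} (i j : Fin n) :
    D0 R (fun v : Fin n → ZFSet.{u} => GoodEdge (v i) (v j)) :=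
  (empty i).not.and ((ex_tuple (N := 2) 0 fun _ => i.succ).ball j)

theorem isEdgeIso {n : ℕ} (i j k l : Fin n) :
    D0 R (fun v : Fin n → ZFSet.{u} => IsEdgeIso (v i) (v j) (v k) (v l)) := by
  refine (((pair_mem l.succ.succ 1 0).bex k.succ).ball i).and
    ((((pair_mem l.succ.succ 0 1).bex i.succ).ball k).and ?_)
  exact (((((pair_mem l.succ.succ.succ.succ 3 1).imp ((pair_mem l.succ.succ.succ.succ 2 0).imp
    (((eq 3 2).iff (eq 1 0)).and ((tuple₂_mem j.succ.succ.succ.succ 3 2).iff (mem 1 0))))).ball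
      k.succ.succ.succ).ball k.succ.succ).ball i.succ).ball i

theorem extEdge {n : ℕ} (i j : Fin n) :
    D0 R (fun v : Fin n → ZFSet.{u} => ExtEdge (v i) (v j)) :=
  (((((tuple₂_mem j.succ.succ.succ 0 2).iff (tuple₂_mem j.succ.succ.succ 0 1)).ball
    i.succ.succ).imp (eq 1 0)).ball i.succ).ball i

theorem noMinEdge {n : ℕ} (i j k : Fin n) :
    D0 R (fun v : Fin n → ZFSet.{u} => NoMinEdge (v i) (v j) (v k)) :=
  (((eq 0 0).congr (Q' := fun _ => True) fun _ => by simp).bex k).and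
    (((mem 0 i.succ).and ((tuple₂_mem j.succ.succ 0 1).bex k.succ)).ball k)

end D0

/-! ### The class `Q R` is `Δ₁` with bound the identity -/

theorem isoClosed_Q (R : Pi1Predicate) : IsoClosed (Q.{u} R) := by
  rintro A B ⟨f⟩ ⟨M, hM, hR, g, hg⟩
  refine ⟨M, hM, hR, (f.equiv PUnit.unit).symm.trans g, fun a b => ?_⟩
  obtain ⟨a, rfl⟩ := (f.equiv PUnit.unit).surjective a
  obtain ⟨b, rfl⟩ := (f.equiv PUnit.unit).surjective b
  simp only [Equiv.trans_apply, Equiv.symm_apply_apply, ← hg]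
  refine Iff.symm ((f.map_rel EdgeRel.edge ![a, b]).trans (iff_of_eq (congrArg _ ?_)))
  funext i; fin_cases i <;> rfl

theorem hc_of_edgeCode {κ : Cardinal.{u}} {D r : ZFSet.{u}} (h : HC κ (edgeCode D r)) :
    HC κ D := by
  refine HC.of_mem (HC.of_mem (HC.of_mem (HC.of_mem h (y := {ZFSet.pair D ∅}) ?_)
    (y := ZFSet.pair D ∅) ?_) (y := {D}) ?_) (y := D) ?_ <;> simp [edgeCode, ZFSet.pair]

theorem mem_setClass_edge {K : Set (Struc edgeVocabulary.{u})} {x : ZFSet.{u}} :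
    x ∈ setClass edgeListing K ↔ ∃ A ∈ K, ∃ e : A.dom PUnit.unit → ZFSet.{u},
      Function.Injective e ∧ x = edgeCode (ZFSet.range e) (edgeSet A e) := by
  constructor
  · rintro ⟨A, hA, e, he, rfl⟩
    exact ⟨A, hA, e PUnit.unit, he _, rfl⟩
  · rintro ⟨A, hA, e, he, rfl⟩
    exact ⟨A, hA, fun _ => e, fun _ => he, rfl⟩

/-- The witness is the pair of the collapse `M` and the graph `f` of the isomorphism. -/
theorem sigma1_Q (R : Pi1Predicate) : Sigma1 id R (setClass edgeListing (Q.{u} R)) := by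
  have hQ : D0 R (fun v : Fin 2 → ZFSet.{u} => ∃ D r, v 0 = edgeCode D r ∧ GoodEdge D r ∧
      ∃ M f, v 1 = ZFSet.pair M f ∧ IsEdgeIso D r M f ∧ M.IsTransitive ∧ R.Correct M) :=
    ((D0.goodEdge 0 1).and (D0.ex_pair 2 ((D0.isEdgeIso 2 3 1 0).and (D0.correct 1)))).ex_edgeCode
  refine sigma1_of_d0 hQ ?_ ?_
  · rintro x y ⟨D, r, hx, hg, M, f, -, hiso, hM⟩
    obtain rfl : x = edgeCode D r := hx
    obtain ⟨A, e, he, rfl, rfl⟩ := exists_struc_of_goodEdge hg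
    exact mem_setClass_edge.2 ⟨A, mem_Q_iff.2 ⟨M, hM, hiso.exists_isMemIso he⟩, e, he, rfl⟩
  · intro x hx
    obtain ⟨A, hA, e, he, hx⟩ := mem_setClass_edge.1 hx
    obtain ⟨M, hM, F, hF⟩ := mem_Q_iff.1 hA
    have hD : HC (hRank x) (ZFSet.range e) := hc_of_edgeCode (r := edgeSet A e) (by rw [← hx]; exact hc_hRank x)
    obtain ⟨f, hf, hc⟩ := hF.exists_isEdgeIso he hM.1 (aleph0_le_hRank x) hD
    exact ⟨_, hc, _, _, hx, goodEdge_code A e, M, f, rfl, hf, hM⟩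

/-- By Mostowski's lemma an extensional well-founded structure has a transitive collapse, so failure
of membership shows in one of three ways: non-extensionality, a nonempty set without a minimal
element, or a collapse that is not correct. Sets that code no structure also lie in the complement.
-/
theorem sigma1_Q_compl (R : Pi1Predicate) :
    Sigma1 id R (setClass edgeListing (Q.{u} R))ᶜ := by
  -- `D0.correct` defines correctness only in conjunction with transitivity, hence the negated
  -- conjunction next to `M.IsTransitive`.
  have hQ : D0 R (fun v : Fin 2 → ZFSet.{u} => (¬ ∃ D r, v 0 = edgeCode D r ∧ GoodEdge D r) ∨
      ∃ D r, v 0 = edgeCode D r ∧ (¬ ExtEdge D r ∨ NoMinEdge D r (v 1) ∨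
        ∃ M f, v 1 = ZFSet.pair M f ∧ IsEdgeIso D r M f ∧ M.IsTransitive ∧
          ¬ (M.IsTransitive ∧ R.Correct M))) :=
    (D0.ex_edgeCode (D0.goodEdge 0 1)).not.or (D0.ex_edgeCode ((D0.extEdge 0 1).not.or
      ((D0.noMinEdge 0 1 2).or (D0.ex_pair 2 ((D0.isEdgeIso 2 3 1 0).and
        ((D0.isTransitive 1).and (D0.correct 1).not))))))
  refine sigma1_of_d0 hQ ?_ ?_
  · intro x y h hx
    obtain ⟨A, hA, e, he, rfl⟩ := mem_setClass_edge.1 hx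
    obtain ⟨M, hM, F, hF⟩ := mem_Q_iff.1 hA
    rcases h with h | ⟨D, r, hx, h⟩
    · exact h ⟨_, _, rfl, goodEdge_code A e⟩
    obtain ⟨rfl, rfl⟩ := edgeCode_inj hx
    rcases h with h | h | ⟨M', f, -, hiso, hM', hn⟩
    · refine h fun a ha b hb hab => ?_
      obtain ⟨a, rfl⟩ := ZFSet.mem_range.1 ha
      obtain ⟨b, rfl⟩ := ZFSet.mem_range.1 hb
      refine congrArg e (hF.1 (ZFSet.ext fun z => ?_))
      have key : ∀ c, F c ∈ F a ↔ F c ∈ F b := fun c => by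
        rw [← hF.2.2, ← hF.2.2, ← mem_edgeSet he, ← mem_edgeSet he]
        exact hab _ (ZFSet.mem_range_self c)
      constructor
      · intro hz
        obtain ⟨c, rfl⟩ := (hF.2.1 z).1 (hM.1 _ ((hF.2.1 _).2 ⟨a, rfl⟩) hz)
        exact (key c).1 hz
      · intro hz
        obtain ⟨c, rfl⟩ := (hF.2.1 z).1 (hM.1 _ ((hF.2.1 _).2 ⟨b, rfl⟩) hz)
        exact (key c).2 hz
    · obtain ⟨⟨a, ha, -⟩, h2⟩ := h
      -- Foundation for the values of `F` excludes a nonempty set of elements without a minimal one.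
      have key : ∀ c, e c ∉ y := by
        intro c
        induction c using (InvImage.wf F ZFSet.mem_wf).induction with
        | _ c ih =>
          intro hc
          obtain ⟨-, b, hb, hbc⟩ := h2 _ hc
          obtain ⟨d, rfl⟩ := ZFSet.mem_range.1 (h2 b hb).1
          exact ih d ((hF.2.2 d c).1 ((mem_edgeSet he _ _).1 hbc)) hb
      obtain ⟨c, rfl⟩ := ZFSet.mem_range.1 (h2 a ha).1
      exact key c ha
    · obtain ⟨F', hF'⟩ := hiso.exists_isMemIso he
      -- The collapse is unique, so the set that is not correct is the same as the correct one.
      have : F = F' := eq_of_transitive_iso hM.1 hM' hF.2.1 hF'.2.1 fun a b => by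
        rw [← hF.2.2, ← hF'.2.2]
      subst this
      obtain rfl : M = M' := ZFSet.ext fun z => (hF.2.1 z).trans (hF'.2.1 z).symm
      exact hn hM
  · intro x hx
    have hκ := aleph0_le_hRank x
    by_cases hg : ∃ D r, x = edgeCode D r ∧ GoodEdge D r
    swap
    · exact ⟨∅, hc_empty hκ, Or.inl hg⟩
    obtain ⟨D, r, hxe, hg⟩ := hg
    obtain ⟨A, e, he, rfl, rfl⟩ := exists_struc_of_goodEdge hg
    have hD : HC (hRank x) (ZFSet.range e) := hc_of_edgeCode (r := edgeSet A e) (by rw [← hxe]; exact hc_hRank x)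
    have hA : A ∉ Q R := fun hA => hx (mem_setClass_edge.2 ⟨A, hA, e, he, hxe⟩)
    by_cases hext : ExtEdge (ZFSet.range e) (edgeSet A e)
    swap
    · exact ⟨∅, hc_empty hκ, Or.inr ⟨_, _, hxe, Or.inl hext⟩⟩
    by_cases hwf : WellFounded A.E
    swap
    · rw [WellFounded.wellFounded_iff_has_min] at hwf
      push Not at hwf
      obtain ⟨s, ⟨a, ha⟩, hs⟩ := hwf
      -- The witness of ill-foundedness is a subset of the domain and therefore small.
      refine ⟨ZFSet.range fun c : s => e c, ?_, Or.inr ⟨_, _, hxe, Or.inr (Or.inl ⟨?_, ?_⟩)⟩⟩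
      · refine hc_range hκ ((Cardinal.mk_set_le s).trans ?_) fun c =>
          hD.of_mem (ZFSet.mem_range_self _)
        exact (card_range_of_injective he) ▸ hD.card_le
      · exact ⟨e a, ZFSet.mem_range.2 ⟨⟨a, ha⟩, rfl⟩, trivial⟩
      · intro z hz
        obtain ⟨⟨c, hc⟩, rfl⟩ := ZFSet.mem_range.1 hz
        obtain ⟨d, hd, hdc⟩ := hs c hc
        exact ⟨ZFSet.mem_range_self c, e d, ZFSet.mem_range.2 ⟨⟨d, hd⟩, rfl⟩,
          (mem_edgeSet he _ _).2 hdc⟩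
    obtain ⟨F, hFi, hF⟩ := exists_collapse.{u} hwf fun a b hab => he (hext _
      (ZFSet.mem_range_self a) _ (ZFSet.mem_range_self b) fun c hc => by
        obtain ⟨c, rfl⟩ := ZFSet.mem_range.1 hc
        rw [mem_edgeSet he, mem_edgeSet he, hab])
    have hM := collapse_isTransitive hF
    have hiso : IsMemIso A (ZFSet.range F) F :=
      ⟨hFi, fun x => ZFSet.mem_range, collapse_rel_iff hFi hF⟩
    obtain ⟨f, hf, hc⟩ := hiso.exists_isEdgeIso he hM hκ hD
    exact ⟨_, hc, Or.inr ⟨_, _, hxe, Or.inr (Or.inr ⟨_, f, rfl, hf, hM,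
      fun hM' => hA (mem_Q_iff.2 ⟨_, hM', F, hiso⟩)⟩)⟩⟩

/-! ### Isomorphisms of structures -/

/-- The identity. -/
def Struc.Iso.refl {τ : Vocabulary.{u}} (A : Struc τ) : A.Iso A where
  equiv _ := Equiv.refl _
  map_rel _ _ := Iff.rfl
  map_fn _ _ := rfl

/-- The inverse isomorphism. -/
def Struc.Iso.symm {τ : Vocabulary.{u}} {A B : Struc τ} (f : A.Iso B) : B.Iso A where
  equiv s := (f.equiv s).symm
  map_rel r v := by rw [f.map_rel]; simp
  map_fn g v := by
    rw [Equiv.symm_apply_eq, f.map_fn]; simp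

/-- Composition of isomorphisms. -/
def Struc.Iso.trans {τ : Vocabulary.{u}} {A B C : Struc τ} (f : A.Iso B) (g : B.Iso C) :
    A.Iso C where
  equiv s := (f.equiv s).trans (g.equiv s)
  map_rel r v := by rw [f.map_rel, g.map_rel]; rfl
  map_fn h v := by simp only [Equiv.trans_apply]; rw [f.map_fn, g.map_fn]

/-- The isomorphic copy of a structure along bijections of its domains. -/
def Struc.transport {τ : Vocabulary.{u}} (A : Struc τ) {D : τ.Sorts → Type u}
    (e : ∀ s, A.dom s ≃ D s) : Struc τ where
  dom := D
  nonempty s := (A.nonempty s).map (e s)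
  rel r v := A.rel r fun i => (e _).symm (v i)
  fn f v := e _ (A.fn f fun i => (e _).symm (v i))

/-- A structure is isomorphic to its copies. -/
def Struc.transportIso {τ : Vocabulary.{u}} (A : Struc τ) {D : τ.Sorts → Type u}
    (e : ∀ s, A.dom s ≃ D s) : A.Iso (A.transport e) where
  equiv := e
  map_rel r v := iff_of_eq (congrArg (A.rel r) (funext fun i =>
    ((e _).symm_apply_apply (v i)).symm))
  map_fn f v := congrArg (fun w => e _ (A.fn f w)) (funext fun i =>
    ((e _).symm_apply_apply (v i)).symm)

theorem Struc.Iso.card_eq {τ : Vocabulary.{u}} {A B : Struc τ} (f : A.Iso B) :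
    A.card = B.card := by
  unfold Struc.card
  exact congrArg _ (funext fun s => Cardinal.mk_congr (f.equiv s))

/-- The bounds on the cardinality of expansions may be chosen uniformly. -/
theorem exists_uniform_bound {τ : Vocabulary.{u}} (P : Struc τ → Cardinal.{u} → Prop)
    (hiso : ∀ A B κ, Nonempty (A.Iso B) → P B κ → P A κ) (hmono : ∀ A κ μ, κ ≤ μ → P A κ → P A μ)
    (h : ∀ A, ∃ κ, P A κ) (μ : Cardinal.{u}) :
    ∃ κ, ∀ A : Struc τ, (∀ s, #(A.dom s) ≤ μ) → P A κ := by
  -- Up to isomorphism every structure with domains of size at most `μ` lives on subsets of `μ.out`.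
  -- These structures form a type in `Type u`, so the supremum of their bounds exists.
  let I : Type u := Σ D : τ.Sorts → Set μ.out,
    (∀ (n : ℕ) (s : Fin n → τ.Sorts), τ.Rel s → (∀ i, D (s i)) → Prop) ×
    (∀ (n : ℕ) (s : Fin n → τ.Sorts) (t : τ.Sorts), τ.Fun s t → (∀ i, D (s i)) → D t) ×
    PLift (∀ s, Nonempty (D s))
  let S : I → Struc τ := fun p =>
    ⟨fun s => p.1 s, p.2.2.2.down, fun {n s} r v => p.2.1 n s r v,
      fun {n s t} f v => p.2.2.1 n s t f v⟩
  choose κ hκ using h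
  refine ⟨⨆ p : I, κ (S p), fun A hA => ?_⟩
  have hemb : ∀ s, Nonempty (A.dom s ↪ μ.out) := fun s => by
    rw [← Cardinal.le_def, Cardinal.mk_out]
    exact hA s
  let e : ∀ s, A.dom s ≃ Set.range (hemb s).some :=
    fun s => Equiv.ofInjective _ (hemb s).some.injective
  let p : I := ⟨fun s => Set.range (hemb s).some, fun _ _ r v => (A.transport e).rel r v,
    fun _ _ _ f v => (A.transport e).fn f v, ⟨fun s => (A.nonempty s).map (e s)⟩⟩
  refine hmono _ _ _ (le_ciSup Cardinal.bddAbove_of_small p) ?_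
  exact hiso A (S p) _ ⟨A.transportIso e⟩ (hκ _)

/-! ### Definability in first-order logic -/

section firstOrder

variable {τ : Vocabulary.{u}}

/-- `f` is the value of a term. -/
def TermDef {n : ℕ} (Γ : Fin n → τ.Sorts) {s : τ.Sorts}
    (f : ∀ A : Struc τ, (∀ i, A.dom (Γ i)) → A.dom s) : Prop :=
  ∃ t : Term τ Γ s, ∀ A v, t.eval A v = f A v

/-- `P` is defined by a first-order formula in the structures `st w`. -/
def FODef {W : Type v} (st : W → Struc τ) {n : ℕ} (Γ : Fin n → τ.Sorts)
    (P : ∀ w, (∀ i, (st w).dom (Γ i)) → Prop) : Prop :=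
  ∃ φ : Formula τ Γ, ∀ w v, φ.Realize (st w) v ↔ P w v

/-- `P` is defined by a first-order sentence in the structures `st w`. -/
def FOSent {W : Type v} (st : W → Struc τ) (P : W → Prop) : Prop :=
  ∃ φ : firstOrder.Sentence τ, ∀ w, firstOrder.Sat (st w) φ ↔ P w

variable {W : Type v} {st : W → Struc τ} {n : ℕ} {Γ : Fin n → τ.Sorts}

theorem TermDef.var (i : Fin n) : TermDef Γ (fun _ v => v i) := ⟨.var i, fun _ _ => rfl⟩

theorem TermDef.app {k : ℕ} {s : Fin k → τ.Sorts} {t : τ.Sorts} (f : τ.Fun s t)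
    {a : ∀ i, ∀ A : Struc τ, (∀ i, A.dom (Γ i)) → A.dom (s i)} (h : ∀ i, TermDef Γ (a i)) :
    TermDef Γ (fun A v => A.fn f fun i => a i A v) := by
  choose b hb using h
  exact ⟨.app f b, fun A v => congrArg (A.fn f) (funext fun i => hb i A v)⟩

theorem Term.exists_lift (s' : τ.Sorts) {s : τ.Sorts} (t : Term τ Γ s) :
    ∃ t' : Term τ (Fin.cons s' Γ : Fin (n + 1) → τ.Sorts) s,
      ∀ (A : Struc τ) (v : ∀ i, A.dom ((Fin.cons s' Γ : Fin (n + 1) → τ.Sorts) i)),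
        t'.eval A v = t.eval A (fun i => v i.succ) := by
  induction t with
  | var i => exact ⟨Term.var (Γ := (Fin.cons s' Γ : Fin (n + 1) → τ.Sorts)) i.succ, fun A v => rfl⟩
  | app f a ih =>
    choose b hb using ih
    exact ⟨.app f b, fun A v => congrArg (A.fn f) (funext fun i => hb i A v)⟩

theorem TermDef.lift (s' : τ.Sorts) {s : τ.Sorts}
    {f : ∀ A : Struc τ, (∀ i, A.dom (Γ i)) → A.dom s} (h : TermDef Γ f) :
    TermDef (Fin.cons s' Γ : Fin (n + 1) → τ.Sorts) (fun A v => f A fun i => v i.succ) := by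
  obtain ⟨t, ht⟩ := h
  obtain ⟨t', ht'⟩ := t.exists_lift s'
  exact ⟨t', fun A v => (ht' A v).trans (ht A _)⟩

namespace FODef

theorem congr {P P' : ∀ w, (∀ i, (st w).dom (Γ i)) → Prop} (h : FODef st Γ P)
    (h' : ∀ w v, P' w v ↔ P w v) : FODef st Γ P' := by
  obtain ⟨φ, hφ⟩ := h
  exact ⟨φ, fun w v => (hφ w v).trans (h' w v).symm⟩

theorem falsum : FODef st Γ (fun _ _ => False) := ⟨.falsum, fun _ _ => Iff.rfl⟩

theorem eq {s : τ.Sorts} {f g : ∀ w : Struc τ, (∀ i, w.dom (Γ i)) → w.dom s} (hf : TermDef Γ f)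
    (hg : TermDef Γ g) : FODef st Γ (fun w v => f (st w) v = g (st w) v) := by
  obtain ⟨t, ht⟩ := hf
  obtain ⟨t', ht'⟩ := hg
  exact ⟨.eq t t', fun w v => by rw [Formula.Realize, ht, ht']⟩

theorem rel {k : ℕ} {s : Fin k → τ.Sorts} (r : τ.Rel s)
    {a : ∀ i, ∀ w : Struc τ, (∀ i, w.dom (Γ i)) → w.dom (s i)} (h : ∀ i, TermDef Γ (a i)) :
    FODef st Γ (fun w v => (st w).rel r fun i => a i (st w) v) := by
  choose b hb using h
  exact ⟨.rel r b, fun w v => iff_of_eq (congrArg ((st w).rel r) (funext fun i => hb i (st w) v))⟩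

theorem imp {P P' : ∀ w, (∀ i, (st w).dom (Γ i)) → Prop} (h : FODef st Γ P) (h' : FODef st Γ P') :
    FODef st Γ (fun w v => P w v → P' w v) := by
  obtain ⟨φ, hφ⟩ := h
  obtain ⟨φ', hφ'⟩ := h'
  exact ⟨.imp φ φ', fun w v => imp_congr (hφ w v) (hφ' w v)⟩

theorem not {P : ∀ w, (∀ i, (st w).dom (Γ i)) → Prop} (h : FODef st Γ P) :
    FODef st Γ (fun w v => ¬ P w v) := h.imp falsum

theorem and {P P' : ∀ w, (∀ i, (st w).dom (Γ i)) → Prop} (h : FODef st Γ P) (h' : FODef st Γ P') :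
    FODef st Γ (fun w v => P w v ∧ P' w v) :=
  (h.imp h'.not).not.congr fun w v => by tauto

theorem iff {P P' : ∀ w, (∀ i, (st w).dom (Γ i)) → Prop} (h : FODef st Γ P) (h' : FODef st Γ P') :
    FODef st Γ (fun w v => P w v ↔ P' w v) :=
  ((h.imp h').and (h'.imp h)).congr fun w v => by tauto

theorem all (s : τ.Sorts) {P : ∀ w,
    (∀ i, (st w).dom ((Fin.cons s Γ : Fin (n + 1) → τ.Sorts) i)) → Prop}
    (h : FODef st (Fin.cons s Γ : Fin (n + 1) → τ.Sorts) P) :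
    FODef st Γ (fun w v => ∀ a : (st w).dom s, P w (extend (st w) a v)) := by
  obtain ⟨φ, hφ⟩ := h
  exact ⟨.all s φ, fun w v => forall_congr' fun a => hφ w _⟩

theorem ex (s : τ.Sorts) {P : ∀ w,
    (∀ i, (st w).dom ((Fin.cons s Γ : Fin (n + 1) → τ.Sorts) i)) → Prop}
    (h : FODef st (Fin.cons s Γ : Fin (n + 1) → τ.Sorts) P) :
    FODef st Γ (fun w v => ∃ a : (st w).dom s, P w (extend (st w) a v)) :=
  (h.not.all s).not.congr fun w v => by simp

/-- The universal closure of a formula. -/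
theorem closure : ∀ {n : ℕ} {Γ : Fin n → τ.Sorts} {P : ∀ w, (∀ i, (st w).dom (Γ i)) → Prop},
    FODef st Γ P → FOSent st (fun w => ∀ v, P w v)
  | 0, Γ, P, ⟨φ, hφ⟩ => by
      obtain rfl : Γ = Fin.elim0 := Subsingleton.elim _ _
      refine ⟨φ, fun w => (hφ w _).trans ⟨fun h v => ?_, fun h => h _⟩⟩
      rwa [Subsingleton.elim v fun i => i.elim0]
  | n + 1, Γ, P, h => by
      obtain ⟨s, Γ, rfl⟩ : ∃ s Γ', Γ = (Fin.cons s Γ' : Fin (n + 1) → τ.Sorts) :=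
        ⟨_, _, (Fin.cons_self_tail Γ).symm⟩
      obtain ⟨φ, hφ⟩ := closure (h.all s)
      refine ⟨φ, fun w => (hφ w).trans ⟨fun H v => ?_, fun H v a => H _⟩⟩
      have := H (fun i => v i.succ) (v 0)
      convert this using 1
      funext i
      refine Fin.cases ?_ (fun i => ?_) i <;> rfl

theorem comap {V : Type w} {P : ∀ w, (∀ i, (st w).dom (Γ i)) → Prop} (h : FODef st Γ P)
    (g : V → W) : FODef (fun x => st (g x)) Γ (fun x v => P (g x) v) := by
  obtain ⟨φ, hφ⟩ := h
  exact ⟨φ, fun x v => hφ (g x) v⟩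

end FODef

namespace FOSent

theorem congr {P P' : W → Prop} (h : FOSent st P) (h' : ∀ w, P' w ↔ P w) : FOSent st P' := by
  obtain ⟨φ, hφ⟩ := h
  exact ⟨φ, fun w => (hφ w).trans (h' w).symm⟩

theorem and {P P' : W → Prop} (h : FOSent st P) (h' : FOSent st P') :
    FOSent st (fun w => P w ∧ P' w) := by
  obtain ⟨φ, hφ⟩ := h
  obtain ⟨φ', hφ'⟩ := h'
  have h : FODef st (Fin.elim0 : Fin 0 → τ.Sorts) (fun w _ => P w) :=
    ⟨φ, fun w v => by
      obtain rfl : v = fun i => i.elim0 := Subsingleton.elim _ _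
      exact hφ w⟩
  have h' : FODef st (Fin.elim0 : Fin 0 → τ.Sorts) (fun w _ => P' w) :=
    ⟨φ', fun w v => by
      obtain rfl : v = fun i => i.elim0 := Subsingleton.elim _ _
      exact hφ' w⟩
  exact (h.and h').closure.congr fun w => (forall_const _).symm

theorem forall_fin : ∀ {N : ℕ} {P : Fin N → W → Prop}, (∀ k, FOSent st (P k)) →
    FOSent st (fun w => ∀ k, P k w)
  | 0, _, _ => (FODef.falsum (Γ := (Fin.elim0 : Fin 0 → τ.Sorts))).not.closure.congr
      fun w => by simp
  | N + 1, P, h => ((h 0).and (forall_fin fun k : Fin N => h k.succ)).congr fun w =>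
      Fin.forall_fin_succ

end FOSent

/-! ### Formulas of set theory as first-order formulas -/

/-- `Q` is defined by a first-order formula, also after the substitution of terms. -/
structure MDef {s : τ.Sorts} {k : ℕ} (Q : ∀ A : Struc τ, (Fin k → A.dom s) → Prop) : Prop where
  subst : ∀ {n : ℕ} (Γ : Fin n → τ.Sorts) (f : Fin k → ∀ A : Struc τ, (∀ i, A.dom (Γ i)) → A.dom s),
    (∀ i, TermDef Γ (f i)) → FODef (fun A : Struc τ => A) Γ (fun A v => Q A fun i => f i A v)

namespace MDef

variable {s : τ.Sorts} {k : ℕ}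

theorem imp {Q Q' : ∀ A : Struc τ, (Fin k → A.dom s) → Prop} (h : MDef Q) (h' : MDef Q') :
    MDef (fun A v => Q A v → Q' A v) :=
  ⟨fun Γ f hf => (h.subst Γ f hf).imp (h'.subst Γ f hf)⟩

theorem congr {Q Q' : ∀ A : Struc τ, (Fin k → A.dom s) → Prop} (h : MDef Q)
    (hQ : ∀ A v, Q' A v ↔ Q A v) : MDef Q' :=
  ⟨fun Γ f hf => (h.subst Γ f hf).congr fun A _ => hQ A _⟩

theorem comp {m : ℕ} {Q : ∀ A : Struc τ, (Fin k → A.dom s) → Prop} (h : MDef Q)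
    (g : Fin k → Fin m) : MDef (fun A (v : Fin m → A.dom s) => Q A fun i => v (g i)) :=
  ⟨fun Γ f hf => h.subst Γ (fun i => f (g i)) fun i => hf (g i)⟩

theorem all {Q : ∀ A : Struc τ, (Fin (k + 1) → A.dom s) → Prop} (h : MDef Q) :
    MDef (fun A v => ∀ a : A.dom s, Q A (Matrix.vecCons a v)) := by
  refine ⟨fun {n} Γ f hf => ?_⟩
  refine ((h.subst (Fin.cons s Γ : Fin (n + 1) → τ.Sorts)
    (Fin.cases (fun A v => v 0) fun i A v => f i A fun j => v j.succ) ?_).all s).congr ?_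
  · intro i
    refine Fin.cases ?_ (fun i => ?_) i
    · exact TermDef.var (Γ := (Fin.cons s Γ : Fin (n + 1) → τ.Sorts)) 0
    · exact (hf i).lift s
  · intro A v
    refine forall_congr' fun a => iff_of_eq (congrArg _ ?_)
    funext i
    refine Fin.cases ?_ (fun i => ?_) i <;> rfl

theorem all_snoc {Q : ∀ A : Struc τ, (Fin (k + 1) → A.dom s) → Prop} (h : MDef Q) :
    MDef (fun A v => ∀ a : A.dom s, Q A (Fin.snoc (α := fun _ => A.dom s) v a)) := by
  refine (h.comp (Fin.snoc (α := fun _ => Fin (k + 1)) Fin.succ 0)).all.congr fun A v => ?_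
  refine forall_congr' fun a => iff_of_eq (congrArg _ ?_)
  funext i
  refine Fin.lastCases ?_ (fun i => ?_) i <;> simp

theorem all_block : ∀ {m : ℕ} {Q : ∀ A : Struc τ, (Fin (k + m) → A.dom s) → Prop}, MDef Q →
    MDef (fun A (v : Fin k → A.dom s) => ∀ y : Fin m → A.dom s, Q A (Fin.append v y))
  | 0, Q, h => h.congr fun A v => by
      have : ∀ y : Fin 0 → A.dom s, Fin.append v y = v := fun y => by
        funext i; exact Fin.append_left v y i
      simp [this]
  | m + 1, Q, h => by
      refine (all_block (all_snoc (Q := Q) h)).congr fun A v => ?_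
      constructor
      · intro H y a
        rw [← Fin.append_snoc]
        exact H _
      · intro H y
        have := H (Fin.init (α := fun _ => A.dom s) y) (y (Fin.last m))
        rwa [← Fin.append_snoc, Fin.snoc_init_self] at this

variable (ι : edgeVocabulary.{u}.Embedding τ)

theorem mem (i j : Fin k) : MDef (s := ι.onSort PUnit.unit)
    (fun A v => (A.reduct ι).E (v i) (v j)) := by
  refine ⟨fun {n} Γ f hf => ?_⟩
  refine (FODef.rel (st := fun A : Struc τ => A) (ι.onRel EdgeRel.edge) (Γ := Γ)
    (a := (![f i, f j] : Fin 2 → ∀ A : Struc τ, (∀ i, A.dom (Γ i)) → A.dom (ι.onSort PUnit.unit)))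
    ?_).congr ?_
  · intro l; fin_cases l
    exacts [hf i, hf j]
  · intro A v
    refine iff_of_eq (congrArg (A.rel (ι.onRel EdgeRel.edge)) ?_)
    funext l; fin_cases l <;> rfl

theorem delta0 {P : Type} {ar : P → ℕ}
    (I : ∀ (A : Struc τ) (p : P), (Fin (ar p) → A.dom (ι.onSort PUnit.unit)) → Prop)
    (hI : ∀ p, MDef (fun A v => I A p v)) {k : ℕ} (φ : Delta0 P ar k) :
    MDef (s := ι.onSort PUnit.unit) (fun A v => φ.Realize (A.reduct ι).E (I A) v) := by
  induction φ with
  | falsum => exact ⟨fun Γ f hf => FODef.falsum⟩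
  | eq i j => exact ⟨fun Γ f hf => FODef.eq (hf i) (hf j)⟩
  | mem i j => exact mem ι i j
  | pred p a => exact (hI p).comp a
  | imp φ ψ ih₁ ih₂ => exact ih₁.imp ih₂
  | ball i φ ih => exact ((mem ι 0 i.succ).imp ih).all

theorem pi1 (R : Pi1Predicate) :
    MDef (s := ι.onSort PUnit.unit) (fun A v => R.Realize (A.reduct ι).E v) :=
  all_block (delta0 ι _ (fun p => p.elim) R.matrix)

/-- The symbol `R` is replaced by its `Π₁` definition evaluated inside the model. The result is
first-order, and it means the true `R` as soon as the model is correct. -/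
theorem delta0Rel {R : Pi1Predicate} {k : ℕ} (ψ : Delta0Rel R k) :
    MDef (s := ι.onSort PUnit.unit)
      (fun A v => Delta0.Realize (A.reduct ι).E (fun _ => R.Realize (A.reduct ι).E) ψ v) :=
  delta0 ι _ (fun _ => pi1 ι R) ψ

end MDef

end firstOrder

/-! ### The identity is definably bounding -/

/-- The only function symbol of `injVocabulary`. -/
inductive InjFun : {n : ℕ} → (Fin n → ULift.{u} Bool) → ULift.{u} Bool → Type u
  | inj : InjFun (n := 1) (fun _ => ⟨true⟩) ⟨false⟩

/-- Two sorts with a function from the second to the first one. -/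
def injVocabulary : Vocabulary.{u} where
  Sorts := ULift Bool
  Rel _ := PEmpty
  Fun s t := InjFun s t

/-- The inclusion of the vocabularies. -/
def injEmbedding : twoSorts.{u}.Embedding injVocabulary where
  onSort s := s
  onSort_injective := Function.injective_id
  onRel r := r
  onRel_injective := fun h => h
  onFun f := f.elim
  onFun_injective := fun {_ _ _ f} => f.elim

/-- The expansion consists of an injection from the second sort to the first. It adds no elements,
so the structure bounds its own expansions. -/
theorem definablyBounding_id : DefinablyBounding (id : Cardinal.{u} → Cardinal.{u}) := by
  refine ⟨monotone_id, injVocabulary, injEmbedding, ?_⟩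
  have hinj : FOSent (fun A : Struc injVocabulary => A) (fun A : Struc injVocabulary.{u} =>
      ∀ v : (∀ _ : Fin 2, A.dom (⟨true⟩ : ULift Bool)),
        A.fn (s := fun _ : Fin 1 => (⟨true⟩ : ULift Bool)) InjFun.inj (fun _ => v 0) =
          A.fn (s := fun _ : Fin 1 => (⟨true⟩ : ULift Bool)) InjFun.inj (fun _ => v 1) →
        v 0 = v 1) := by
    have hv : ∀ i : Fin 2, TermDef (τ := injVocabulary.{u}) (fun _ : Fin 2 => ⟨true⟩)
      (fun A v => v i) := TermDef.var
    exact ((FODef.eq (TermDef.app (τ := injVocabulary.{u}) InjFun.inj fun _ => hv 0)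
      (TermDef.app (τ := injVocabulary.{u}) InjFun.inj fun _ => hv 1)).imp
        (FODef.eq (hv 0) (hv 1))).closure
  obtain ⟨φ, hφ⟩ := hinj
  refine ⟨φ, fun A => ⟨fun h => ?_, ?_⟩, fun A => ⟨A.card, ?_⟩⟩
  · obtain ⟨g⟩ : #(A.dom ⟨true⟩) ≤ #(A.dom ⟨false⟩) := h
    refine ⟨⟨A.dom, A.nonempty, fun r => r.elim, fun {n s t} f => match f with
      | InjFun.inj => fun v => g (v (0 : Fin 1))⟩, (hφ _).2 fun v h => g.injective h, ⟨?_⟩⟩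
    exact ⟨fun _ => Equiv.refl _, fun r => r.elim, fun f => f.elim⟩
  · rintro ⟨B, hB, ⟨f⟩⟩
    have hB := (hφ B).1 hB
    have h1 := Cardinal.mk_congr (f.equiv ⟨true⟩)
    have h2 := Cardinal.mk_congr (f.equiv ⟨false⟩)
    change #(A.dom ⟨true⟩) ≤ #(A.dom ⟨false⟩)
    rw [h1, h2]
    exact Cardinal.mk_le_of_injective
      (f := fun b : B.dom (⟨true⟩ : ULift Bool) =>
        B.fn (s := fun _ : Fin 1 => (⟨true⟩ : ULift Bool)) InjFun.inj fun _ => b)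
      fun a b h => hB (![a, b] : Fin 2 → B.dom (⟨true⟩ : ULift Bool)) h
  · rintro B - ⟨f⟩
    exact f.card_eq.ge

/-! ### Joining three vocabularies -/

/-- The composition of inclusions of vocabularies. -/
def Vocabulary.Embedding.comp {ρ σ τ : Vocabulary.{u}} (ι : ρ.Embedding σ) (ι' : σ.Embedding τ) :
    ρ.Embedding τ where
  onSort s := ι'.onSort (ι.onSort s)
  onSort_injective := ι'.onSort_injective.comp ι.onSort_injective
  onRel r := ι'.onRel (ι.onRel r)
  onRel_injective := fun h => ι.onRel_injective (ι'.onRel_injective h)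
  onFun f := ι'.onFun (ι.onFun f)
  onFun_injective := fun h => ι.onFun_injective (ι'.onFun_injective h)

/-- The names of the sets that describe the code of a structure. -/
inductive LinkConst (S : Type u) (r f : ℕ) : Type u
  | code | wit | omega | doms | rels | funs
  | dom (s : S)
  | rel (k : Fin r)
  | fn (k : Fin f)

section join

variable (τ τ₁ τ₂ : Vocabulary.{u}) (C : Type u) (m : τ₁.Sorts) (a b : τ₂.Sorts)

/-- The sorts of three vocabularies. -/
abbrev JoinSort : Type u := τ.Sorts ⊕ τ₁.Sorts ⊕ τ₂.Sorts

variable {τ τ₁ τ₂} in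
/-- A sort of the first vocabulary. -/
abbrev JoinSort.left (s : τ.Sorts) : JoinSort τ τ₁ τ₂ := Sum.inl s

variable {τ τ₁ τ₂} in
/-- A sort of the second vocabulary. -/
abbrev JoinSort.mid (s : τ₁.Sorts) : JoinSort τ τ₁ τ₂ := Sum.inr (Sum.inl s)

variable {τ τ₁ τ₂} in
/-- A sort of the third vocabulary. -/
abbrev JoinSort.right (s : τ₂.Sorts) : JoinSort τ τ₁ τ₂ := Sum.inr (Sum.inr s)

/-- The relation symbols of three vocabularies. -/
inductive JoinRel : {n : ℕ} → (Fin n → JoinSort τ τ₁ τ₂) → Type u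
  | left {n : ℕ} {s : Fin n → τ.Sorts} (r : τ.Rel s) : JoinRel (fun i => .left (s i))
  | mid {n : ℕ} {s : Fin n → τ₁.Sorts} (r : τ₁.Rel s) : JoinRel (fun i => .mid (s i))
  | right {n : ℕ} {s : Fin n → τ₂.Sorts} (r : τ₂.Rel s) : JoinRel (fun i => .right (s i))

/-- The function symbols of three vocabularies, and function symbols that link their sorts: names of
elements of the sort `m`, functions from the sorts of `τ` and from `a` to `m`, and functions from
`m` to `a` and `b`. -/
inductive JoinFun : {n : ℕ} → (Fin n → JoinSort τ τ₁ τ₂) → JoinSort τ τ₁ τ₂ → Type u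
  | left {n : ℕ} {s : Fin n → τ.Sorts} {t : τ.Sorts} (f : τ.Fun s t) :
      JoinFun (fun i => .left (s i)) (.left t)
  | mid {n : ℕ} {s : Fin n → τ₁.Sorts} {t : τ₁.Sorts} (f : τ₁.Fun s t) :
      JoinFun (fun i => .mid (s i)) (.mid t)
  | right {n : ℕ} {s : Fin n → τ₂.Sorts} {t : τ₂.Sorts} (f : τ₂.Fun s t) :
      JoinFun (fun i => .right (s i)) (.right t)
  | const (c : C) : JoinFun (fun i : Fin 0 => i.elim0) (.mid m)
  | emb (s : τ.Sorts) : JoinFun (fun _ : Fin 1 => .left s) (.mid m)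
  | incl : JoinFun (fun _ : Fin 1 => .right a) (.mid m)
  | fst : JoinFun (fun _ : Fin 1 => .mid m) (.right a)
  | snd : JoinFun (fun _ : Fin 1 => .mid m) (.right b)

/-- The vocabulary of three structures with linking functions. -/
def joinVocabulary : Vocabulary.{u} where
  Sorts := JoinSort τ τ₁ τ₂
  Rel s := JoinRel τ τ₁ τ₂ s
  Fun s t := JoinFun τ τ₁ τ₂ C m a b s t

/-- The inclusion of the first vocabulary. -/
def joinLeft : τ.Embedding (joinVocabulary τ τ₁ τ₂ C m a b) where
  onSort s := .left s
  onSort_injective := Sum.inl_injective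
  onRel r := JoinRel.left r
  onRel_injective := fun h => by injection h
  onFun f := JoinFun.left f
  onFun_injective := fun h => by injection h

/-- The inclusion of the second vocabulary. -/
def joinMid : τ₁.Embedding (joinVocabulary τ τ₁ τ₂ C m a b) where
  onSort s := .mid s
  onSort_injective := Sum.inr_injective.comp Sum.inl_injective
  onRel r := JoinRel.mid r
  onRel_injective := fun h => by injection h
  onFun f := JoinFun.mid f
  onFun_injective := fun h => by injection h

/-- The inclusion of the third vocabulary. -/
def joinRight : τ₂.Embedding (joinVocabulary τ τ₁ τ₂ C m a b) where
  onSort s := .right s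
  onSort_injective := Sum.inr_injective.comp Sum.inr_injective
  onRel r := JoinRel.right r
  onRel_injective := fun h => by injection h
  onFun f := JoinFun.right f
  onFun_injective := fun h => by injection h

variable {τ τ₁ τ₂ C m a b}

/-- The domains of a joined structure. -/
def joinDom (A : Struc τ) (B₁ : Struc τ₁) (B₂ : Struc τ₂) : JoinSort τ τ₁ τ₂ → Type u
  | .inl s => A.dom s
  | .inr (.inl s) => B₁.dom s
  | .inr (.inr s) => B₂.dom s

/-- Three structures with linking functions, as one structure. -/
def joinStruc (A : Struc τ) (B₁ : Struc τ₁) (B₂ : Struc τ₂) (const : C → B₁.dom m)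
    (emb : ∀ s, A.dom s → B₁.dom m) (incl : B₂.dom a → B₁.dom m) (fst : B₁.dom m → B₂.dom a)
    (snd : B₁.dom m → B₂.dom b) : Struc (joinVocabulary τ τ₁ τ₂ C m a b) where
  dom := joinDom A B₁ B₂
  nonempty
    | .inl s => A.nonempty s
    | .inr (.inl s) => B₁.nonempty s
    | .inr (.inr s) => B₂.nonempty s
  rel
    | .left r => fun v => A.rel r v
    | .mid r => fun v => B₁.rel r v
    | .right r => fun v => B₂.rel r v
  fn
    | .left f => fun v => A.fn f v
    | .mid f => fun v => B₁.fn f v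
    | .right f => fun v => B₂.fn f v
    | .const c => fun _ => const c
    | .emb s => fun v => emb s (v (0 : Fin 1))
    | .incl => fun v => incl (v (0 : Fin 1))
    | .fst => fun v => fst (v (0 : Fin 1))
    | .snd => fun v => snd (v (0 : Fin 1))

end join

/-! ### Structures with a correct transitive model -/

/-- From left to right this is correctness of `M`; from right to left it is downward absoluteness of
`Π₁` statements. -/
theorem realize_pi1_iff {R : Pi1Predicate} {A : Struc edgeVocabulary.{u}} {M : ZFSet.{u}}
    {π : A.dom PUnit.unit → ZFSet.{u}} (h : IsMemIso A M π) (hM : M.IsTransitive)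
    (hR : R.Correct M) (v : Fin R.arity → A.dom PUnit.unit) :
    R.Realize A.E v ↔ R.Holds fun i => π (v i) := by
  have key : ∀ y : Fin R.numQuant → A.dom PUnit.unit,
      R.matrix.Realize A.E (fun p => p.elim) (Fin.append v y) ↔
        PureDelta0.Holds R.matrix (Fin.append (fun i => π (v i)) fun i => π (y i)) := by
    intro y
    have e : (fun i => π (Fin.append v y i)) =
        Fin.append (fun i => π (v i)) fun i => π (y i) := by
      funext i
      refine Fin.addCases (fun i => ?_) (fun i => ?_) i <;> simp
    rw [← e]
    refine Delta0.realize_endEmbedding h.1 h.2.2 ?_ (fun p => p.elim) R.matrix _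
    intro a b hb
    exact (h.2.1 b).1 (hM _ ((h.2.1 _).2 ⟨a, rfl⟩) hb)
  constructor
  · intro H
    refine (R.correct_iff hM).1 hR _ (fun i => (h.2.1 _).2 ⟨v i, rfl⟩) fun y hy => ?_
    choose z hz using fun i => (h.2.1 _).1 (hy i)
    obtain rfl : (fun i => π (z i)) = y := funext hz
    exact (key z).1 (H z)
  · intro H y
    exact (key y).2 (H _)

theorem realize_delta0Rel_iff {R : Pi1Predicate} {A : Struc edgeVocabulary.{u}} {M : ZFSet.{u}}
    {π : A.dom PUnit.unit → ZFSet.{u}} (h : IsMemIso A M π) (hM : M.IsTransitive)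
    (hR : R.Correct M) {n : ℕ} (ψ : Delta0Rel R n) (v : Fin n → A.dom PUnit.unit) :
    Delta0.Realize A.E (fun _ => R.Realize A.E) ψ v ↔ ψ.Holds fun i => π (v i) :=
  Delta0.realize_endEmbedding h.1 h.2.2
    (fun a b hb => (h.2.1 b).1 (hM _ ((h.2.1 _).2 ⟨a, rfl⟩) hb))
    (fun _ v => realize_pi1_iff h hM hR v) ψ v

/-- A structure with a sort isomorphic to a transitive correct set. -/
structure CorrectModel (R : Pi1Predicate) {τ : Vocabulary.{u}}
    (ι : edgeVocabulary.{u}.Embedding τ) : Type (u + 1) where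
  struc : Struc τ
  M : ZFSet.{u}
  π : struc.dom (ι.onSort PUnit.unit) → ZFSet.{u}
  isMemIso : IsMemIso (struc.reduct ι) M π
  isTransitive : M.IsTransitive
  correct : R.Correct M

section

variable {R : Pi1Predicate} {τ : Vocabulary.{u}} {ι : edgeVocabulary.{u}.Embedding τ}

/-- The bridge between the two languages: a `Δ₀(R)` property of the sets that terms denote after the
collapse is expressed by one first-order formula, uniformly in all models with a correct part. -/
theorem FODef.of_d0 {k : ℕ} {Q : (Fin k → ZFSet.{u}) → Prop} (hQ : D0 R Q) {n : ℕ}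
    {Γ : Fin n → τ.Sorts}
    {f : Fin k → ∀ A : Struc τ, (∀ i, A.dom (Γ i)) → A.dom (ι.onSort PUnit.unit)}
    (hf : ∀ i, TermDef Γ (f i)) :
    FODef (CorrectModel.struc (R := R) (ι := ι)) Γ
      (fun w v => Q fun i => w.π (f i w.struc v)) := by
  obtain ⟨ψ, hψ⟩ := hQ
  refine (((MDef.delta0Rel ι ψ).subst Γ f hf).comap (CorrectModel.struc (R := R) (ι := ι))).congr ?_
  intro w v
  rw [← hψ]
  exact (realize_delta0Rel_iff w.isMemIso w.isTransitive w.correct ψ _).symm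

variable {W : Type v} {st : W → Struc τ}

theorem FOSent.forall₁ {s : τ.Sorts} {P : ∀ w, (st w).dom s → Prop}
    (h : FODef st (fun _ : Fin 1 => s) (fun w v => P w (v 0))) :
    FOSent st (fun w => ∀ x, P w x) :=
  h.closure.congr fun _ => ⟨fun H v => H (v 0), fun H x => H fun _ => x⟩

theorem FOSent.forall₂ {s : τ.Sorts} {P : ∀ w, (st w).dom s → (st w).dom s → Prop}
    (h : FODef st (fun _ : Fin 2 => s) (fun w v => P w (v 0) (v 1))) :
    FOSent st (fun w => ∀ x y, P w x y) :=
  h.closure.congr fun w => ⟨fun H v => H (v 0) (v 1), fun H x y =>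
    H (![x, y] : Fin 2 → (st w).dom s)⟩

theorem FOSent.of_d0 {k : ℕ} {Q : (Fin k → ZFSet.{u}) → Prop} (hQ : D0 R Q)
    {f : Fin k → ∀ A : Struc τ, (∀ i : Fin 0, A.dom (Fin.elim0 i)) → A.dom (ι.onSort PUnit.unit)}
    (hf : ∀ i, TermDef Fin.elim0 (f i)) {P : CorrectModel R ι → Prop}
    (h : ∀ w v, P w ↔ Q fun i => w.π (f i w.struc v)) :
    FOSent (CorrectModel.struc (R := R) (ι := ι)) P :=
  (FODef.of_d0 hQ hf).closure.congr fun w => ⟨fun hP v => (h w v).1 hP, fun H =>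
    (h w fun i => i.elim0).2 (H _)⟩

end

/-! ### The set `ω` -/

/-- `w` is the set of the finite von Neumann ordinals. -/
def IsOmega (w : ZFSet.{u}) : Prop :=
  (∃ n ∈ w, n = ∅) ∧ (∀ n ∈ w, ∃ m ∈ w, n ∈ m ∧ (∀ k ∈ n, k ∈ m) ∧ ∀ k ∈ m, k ∈ n ∨ k = n) ∧
    ∀ n ∈ w, n = ∅ ∨ ∃ m ∈ w, m ∈ n ∧ (∀ k ∈ m, k ∈ n) ∧ ∀ k ∈ n, k ∈ m ∨ k = m

theorem D0.isOmega {R : Pi1Predicate} {n : ℕ} (i : Fin n) :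
    D0 R (fun v : Fin n → ZFSet.{u} => IsOmega (v i)) :=
  ((D0.empty 0).bex i).and (((((D0.mem 1 0).and (((D0.mem 0 1).ball 1).and
    (((D0.mem 0 2).or (D0.eq 0 2)).ball 0))).bex i.succ).ball i).and
    (((D0.empty 0).or (((D0.mem 0 1).and (((D0.mem 0 2).ball 0).and
      (((D0.mem 0 1).or (D0.eq 0 1)).ball 1))).bex i.succ)).ball i))

theorem eq_insert_iff {n m : ZFSet.{u}} :
    (n ∈ m ∧ (∀ k ∈ n, k ∈ m) ∧ ∀ k ∈ m, k ∈ n ∨ k = n) ↔ m = insert n n := by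
  constructor
  · rintro ⟨h1, h2, h3⟩
    ext k
    rw [ZFSet.mem_insert_iff]
    constructor
    · intro hk; exact (h3 k hk).symm
    · rintro (rfl | hk)
      · exact h1
      · exact h2 k hk
  · rintro rfl
    refine ⟨by simp, fun k hk => by simp [hk], fun k hk => ?_⟩
    rw [ZFSet.mem_insert_iff] at hk
    exact hk.symm

/-- The finite von Neumann ordinals. -/
noncomputable def finOrd : ℕ → ZFSet.{u}
  | 0 => ∅
  | n + 1 => insert (finOrd n) (finOrd n)

theorem finOrd_mem {n m : ℕ} (h : n < m) : finOrd.{u} n ∈ finOrd.{u} m := by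
  induction m with
  | zero => omega
  | succ m ih =>
    rw [finOrd, ZFSet.mem_insert_iff]
    rcases Nat.lt_succ_iff_lt_or_eq.1 h with h | rfl
    · exact Or.inr (ih h)
    · exact Or.inl rfl

theorem finOrd_injective : Function.Injective finOrd.{u} := by
  intro n m h
  by_contra hne
  rcases Nat.lt_or_gt_of_ne hne with hl | hl
  · have := finOrd_mem.{u} hl
    rw [h] at this
    exact ZFSet.mem_irrefl _ this
  · have := finOrd_mem.{u} hl
    rw [h] at this
    exact ZFSet.mem_irrefl _ this

/-- Each element is empty or the successor of another element, so `∈`-induction leaves no room for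
nonstandard ones. -/
theorem IsOmega.mem_iff {w : ZFSet.{u}} (h : IsOmega w) (x : ZFSet.{u}) :
    x ∈ w ↔ ∃ n, finOrd n = x := by
  simp only [IsOmega, eq_insert_iff] at h
  obtain ⟨⟨z, hz, rfl⟩, h1, h2⟩ := h
  constructor
  · induction x using ZFSet.inductionOn with
    | _ x ih =>
      intro hx
      rcases h2 x hx with rfl | ⟨m, hm, rfl⟩
      · exact ⟨0, rfl⟩
      · obtain ⟨n, rfl⟩ := ih m (by simp) hm
        exact ⟨n + 1, rfl⟩
  · rintro ⟨n, rfl⟩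
    induction n with
    | zero => exact hz
    | succ n ih =>
      obtain ⟨m, hm, rfl⟩ := h1 _ ih
      exact hm

theorem exists_isOmega : ∃ w : ZFSet.{u}, IsOmega w ∧ HC ℵ₀ w ∧ ℵ₀ ≤ w.card := by
  let f : ULift.{u} ℕ → ZFSet.{u} := fun n => finOrd n.down
  have hf : Function.Injective f := finOrd_injective.comp ULift.down_injective
  have hm : ∀ n, finOrd n ∈ ZFSet.range f := fun n => ZFSet.mem_range_self (f := f) ⟨n⟩
  refine ⟨ZFSet.range f, ?_, ?_, ?_⟩
  · simp only [IsOmega, eq_insert_iff]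
    refine ⟨⟨_, hm 0, rfl⟩, fun n hn => ?_, fun n hn => ?_⟩
    · obtain ⟨⟨n⟩, rfl⟩ := ZFSet.mem_range.1 hn
      exact ⟨_, hm (n + 1), rfl⟩
    · obtain ⟨⟨n⟩, rfl⟩ := ZFSet.mem_range.1 hn
      cases n with
      | zero => exact Or.inl rfl
      | succ n => exact Or.inr ⟨_, hm n, rfl⟩
  · refine hc_range le_rfl (by simp) fun n => ?_
    obtain ⟨n⟩ := n
    change HC ℵ₀ (finOrd n)
    induction n with
    | zero => exact hc_empty le_rfl
    | succ n ih => exact hc_insert le_rfl ih ih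
  · rw [card_range_of_injective hf]
    simp

/-! ### Codes of structures in correct models -/

section link

variable {τ τ₁ τ₂ : Vocabulary.{u}} (l : τ.Listing) (ι : edgeVocabulary.{u}.Embedding τ₁)
  (a b : τ₂.Sorts)

/-- The vocabulary of a structure, a model of set theory, and a further structure. -/
abbrev linkVocabulary : Vocabulary.{u} :=
  joinVocabulary τ τ₁ τ₂ (LinkConst τ.Sorts l.numRels l.numFuns) (ι.onSort PUnit.unit) a b

/-- The inclusion of the vocabulary of the model of set theory. -/
abbrev linkEdge : edgeVocabulary.{u}.Embedding (linkVocabulary l ι a b) :=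
  ι.comp (joinMid τ τ₁ τ₂ _ (ι.onSort PUnit.unit) a b)

variable {l ι a b}

/-- The element of the model with the name `c`. -/
def linkConst (B : Struc (linkVocabulary l ι a b)) (c : LinkConst τ.Sorts l.numRels l.numFuns) :
    B.dom (.mid (ι.onSort PUnit.unit)) :=
  B.fn (JoinFun.const c) fun i => i.elim0

/-- The embedding of the sort `s` in the model. -/
def linkEmb (B : Struc (linkVocabulary l ι a b)) (s : τ.Sorts) (x : B.dom (.left s)) :
    B.dom (.mid (ι.onSort PUnit.unit)) :=
  B.fn (JoinFun.emb s) fun _ => x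

/-- The embedding of the sort `a` in the model. -/
def linkIncl (B : Struc (linkVocabulary l ι a b)) (x : B.dom (.right a)) :
    B.dom (.mid (ι.onSort PUnit.unit)) :=
  B.fn JoinFun.incl fun _ => x

/-- The function from the model to the sort `a`. -/
def linkFst (B : Struc (linkVocabulary l ι a b)) (x : B.dom (.mid (ι.onSort PUnit.unit))) :
    B.dom (.right a) :=
  B.fn JoinFun.fst fun _ => x

/-- The function from the model to the sort `b`. -/
def linkSnd (B : Struc (linkVocabulary l ι a b)) (x : B.dom (.mid (ι.onSort PUnit.unit))) :
    B.dom (.right b) :=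
  B.fn JoinFun.snd fun _ => x

section terms

variable {n : ℕ} {Γ : Fin n → (linkVocabulary l ι a b).Sorts}

theorem TermDef.linkConst (c : LinkConst τ.Sorts l.numRels l.numFuns) :
    TermDef (τ := linkVocabulary l ι a b) Γ (fun A _ => linkConst A c) := by
  obtain ⟨t, ht⟩ := TermDef.app (τ := linkVocabulary l ι a b) (Γ := Γ) (JoinFun.const c)
    (a := fun i => i.elim0) fun i => i.elim0
  exact ⟨t, fun A v => (ht A v).trans (congrArg (A.fn (JoinFun.const c))
    (funext fun i => i.elim0))⟩

theorem TermDef.linkEmb {s : τ.Sorts}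
    {f : ∀ A : Struc (linkVocabulary l ι a b), (∀ i, A.dom (Γ i)) → A.dom (.left s)}
    (hf : TermDef Γ f) : TermDef Γ (fun A v => linkEmb A s (f A v)) :=
  TermDef.app (τ := linkVocabulary l ι a b) (Γ := Γ) (JoinFun.emb s) fun _ => hf

theorem TermDef.linkIncl
    {f : ∀ A : Struc (linkVocabulary l ι a b), (∀ i, A.dom (Γ i)) → A.dom (.right a)}
    (hf : TermDef Γ f) : TermDef Γ (fun A v => linkIncl A (f A v)) :=
  TermDef.app (τ := linkVocabulary l ι a b) (Γ := Γ) JoinFun.incl fun _ => hf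

theorem TermDef.linkFst {f : ∀ A : Struc (linkVocabulary l ι a b), (∀ i, A.dom (Γ i)) →
      A.dom (.mid (ι.onSort PUnit.unit))}
    (hf : TermDef Γ f) : TermDef Γ (fun A v => linkFst A (f A v)) :=
  TermDef.app (τ := linkVocabulary l ι a b) (Γ := Γ) JoinFun.fst fun _ => hf

theorem TermDef.linkSnd {f : ∀ A : Struc (linkVocabulary l ι a b), (∀ i, A.dom (Γ i)) →
      A.dom (.mid (ι.onSort PUnit.unit))}
    (hf : TermDef Γ f) : TermDef Γ (fun A v => linkSnd A (f A v)) :=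
  TermDef.app (τ := linkVocabulary l ι a b) (Γ := Γ) JoinFun.snd fun _ => hf

end terms

section conditions

variable (B : Struc (linkVocabulary l ι a b)) (π : B.dom (.mid (ι.onSort PUnit.unit)) → ZFSet.{u})

/-- The model knows the domain of the sort `s`. -/
def SortLinked (s : τ.Sorts) : Prop :=
  (∀ x, π (linkEmb B s x) ∈ π (linkConst B (.dom s))) ∧
  (∀ z, π z ∈ π (linkConst B (.dom s)) → ∃ x, linkEmb B s x = z) ∧
  ∀ x y, linkEmb B s x = linkEmb B s y → x = y

/-- The model knows the relation `r`. -/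
def RelLinked (k : Fin l.numRels) {n : ℕ} {s : Fin n → τ.Sorts} (r : τ.Rel s) : Prop :=
  (∀ z ∈ π (linkConst B (.rel k)), ∃ c : Fin n → ZFSet.{u},
    (∀ i, c i ∈ π (linkConst B (.dom (s i)))) ∧ z = tuple c) ∧
  ∀ v : ∀ i, B.dom (.left (s i)), B.rel (JoinRel.left r) v ↔
    tuple (fun i => π (linkEmb B (s i) (v i))) ∈ π (linkConst B (.rel k))

/-- The model knows the function `f`. -/
def FunLinked (k : Fin l.numFuns) {n : ℕ} {s : Fin n → τ.Sorts} {t : τ.Sorts} (f : τ.Fun s t) :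
    Prop :=
  (∀ z ∈ π (linkConst B (.fn k)), ∃ (c : Fin n → ZFSet.{u}) (d : ZFSet.{u}),
    (∀ i, c i ∈ π (linkConst B (.dom (s i)))) ∧ d ∈ π (linkConst B (.dom t)) ∧
      z = ZFSet.pair (tuple c) d) ∧
  ∀ (v : ∀ i, B.dom (.left (s i))) (y : B.dom (.left t)), B.fn (JoinFun.left f) v = y ↔
    ZFSet.pair (tuple fun i => π (linkEmb B (s i) (v i))) (π (linkEmb B t y)) ∈
      π (linkConst B (.fn k))

/-- The model knows the code of the structure. -/
def CodeLinked : Prop :=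
  π (linkConst B .code) =
    tuple ![π (linkConst B .doms), π (linkConst B .rels), π (linkConst B .funs)] ∧
  π (linkConst B .doms) = tuple (fun k => π (linkConst B (.dom (l.sorts k)))) ∧
  π (linkConst B .rels) = tuple (fun k => π (linkConst B (.rel k))) ∧
  π (linkConst B .funs) = tuple (fun k => π (linkConst B (.fn k))) ∧
  (∀ k, SortLinked B π (l.sorts k)) ∧
  (∀ k, RelLinked B π k (l.rels k).2.2) ∧
  ∀ k, FunLinked B π k (l.funs k).2.2.2

/-- The cardinality of the model is bounded in terms of the sorts `a` and `b`, and that of `a` in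
terms of the structure. -/
def BoundLinked : Prop :=
  IsOmega (π (linkConst B .omega)) ∧
  (∀ x, π (linkIncl B x) ∈ π (linkConst B .omega) ∨
    ∃ k, π (linkIncl B x) ∈ π (linkConst B (.dom (l.sorts k)))) ∧
  (∀ x y, linkIncl B x = linkIncl B y → x = y) ∧
  ∀ x y, linkFst B x = linkFst B y ∧ linkSnd B x = linkSnd B y → x = y

end conditions

section sentences

variable {R : Pi1Predicate}

theorem foSent_tuple {N : ℕ} (c : LinkConst τ.Sorts l.numRels l.numFuns)
    (d : Fin N → LinkConst τ.Sorts l.numRels l.numFuns) :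
    FOSent (CorrectModel.struc (R := R) (ι := linkEdge l ι a b)) (fun w =>
      w.π (linkConst w.struc c) = tuple fun k => w.π (linkConst w.struc (d k))) :=
  FOSent.of_d0 (D0.tuple 0 Fin.succ) (f := Fin.cons (fun A _ => linkConst A c)
    fun k A _ => linkConst A (d k))
    (Fin.cases (TermDef.linkConst c) fun k => TermDef.linkConst (d k)) fun _ _ => Iff.rfl

theorem foSent_sortLinked (s : τ.Sorts) :
    FOSent (CorrectModel.struc (R := R) (ι := linkEdge l ι a b)) (fun w =>
      SortLinked w.struc w.π s) := by
  have hv : ∀ (s : (linkVocabulary l ι a b).Sorts) (N : ℕ) (i : Fin N),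
      TermDef (τ := linkVocabulary l ι a b) (fun _ : Fin N => s) (fun _ v => v i) :=
    fun s N i => TermDef.var i
  refine FOSent.and (FOSent.forall₁ ?_) (FOSent.and (FOSent.forall₁ ?_) (FOSent.forall₂ ?_))
  · refine (FODef.of_d0 (D0.mem 0 1) (f := ![fun A v => linkEmb A s (v 0),
      fun A v => linkConst A (.dom s)]) ?_).congr fun _ _ => Iff.rfl
    intro i
    fin_cases i
    exacts [TermDef.linkEmb (hv _ _ 0), TermDef.linkConst _]
  · refine FODef.imp ?_ ?_
    · refine (FODef.of_d0 (D0.mem 0 1) (f := ![fun A v => v 0,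
        fun A v => linkConst A (.dom s)]) ?_).congr fun _ _ => Iff.rfl
      intro i
      fin_cases i
      exacts [hv _ _ 0, TermDef.linkConst _]
    · exact FODef.ex (τ := linkVocabulary l ι a b) (.left s) (FODef.eq (TermDef.linkEmb
        (TermDef.var (Γ := (Fin.cons (.left s) _ : Fin 2 → (linkVocabulary l ι a b).Sorts)) 0))
        (TermDef.var (Γ := (Fin.cons (.left s) fun _ => .mid (ι.onSort PUnit.unit) :
          Fin 2 → (linkVocabulary l ι a b).Sorts)) 1))
  · exact (FODef.eq (TermDef.linkEmb (hv _ _ 0)) (TermDef.linkEmb (hv _ _ 1))).imp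
      (FODef.eq (hv _ _ 0) (hv _ _ 1))

theorem foSent_relLinked (k : Fin l.numRels) {n : ℕ} {s : Fin n → τ.Sorts} (r : τ.Rel s) :
    FOSent (CorrectModel.struc (R := R) (ι := linkEdge l ι a b)) (fun w =>
      RelLinked w.struc w.π k r) := by
  refine FOSent.and ?_ (FODef.closure (FODef.iff ?_ ?_))
  · exact FOSent.of_d0 ((D0.ex_tuple 0 fun i : Fin n => i.succ.succ).ball 0)
      (f := Fin.cons (fun A _ => linkConst A (.rel k)) fun i A _ => linkConst A (.dom (s i)))
      (Fin.cases (TermDef.linkConst _) fun i => TermDef.linkConst _) fun _ _ => Iff.rfl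
  · exact FODef.rel (τ := linkVocabulary l ι a b) (JoinRel.left r) fun i => TermDef.var i
  · exact (FODef.of_d0 (D0.tuple_mem 0 (Fin.succ : Fin n → Fin (n + 1)))
      (f := Fin.cons (fun A _ => linkConst A (.rel k)) fun i A v => linkEmb A (s i) (v i))
      (Fin.cases (TermDef.linkConst _) fun i => TermDef.linkEmb (TermDef.var i))).congr
        fun _ _ => Iff.rfl

theorem foSent_funLinked (k : Fin l.numFuns) {n : ℕ} {s : Fin n → τ.Sorts} {t : τ.Sorts}
    (f : τ.Fun s t) :
    FOSent (CorrectModel.struc (R := R) (ι := linkEdge l ι a b)) (fun w =>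
      FunLinked w.struc w.π k f) := by
  have hl : ∀ i, TermDef (τ := linkVocabulary l ι a b) (Fin.cons (.left t) fun i => .left (s i) :
      Fin (n + 1) → (linkVocabulary l ι a b).Sorts) (s := .left (s i)) (fun _ v => v i.succ) :=
    fun i => TermDef.var (τ := linkVocabulary l ι a b) (Γ := (Fin.cons (.left t) fun i =>
      .left (s i) : Fin (n + 1) → (linkVocabulary l ι a b).Sorts)) i.succ
  have h0 : TermDef (τ := linkVocabulary l ι a b) (Fin.cons (.left t) fun i => .left (s i) :
      Fin (n + 1) → (linkVocabulary l ι a b).Sorts) (s := .left t) (fun _ v => v 0) :=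
    TermDef.var (τ := linkVocabulary l ι a b) (Γ := (Fin.cons (.left t) fun i =>
      .left (s i) : Fin (n + 1) → (linkVocabulary l ι a b).Sorts)) 0
  refine FOSent.and ?_ ((FODef.all (τ := linkVocabulary l ι a b) (.left t) (FODef.iff
    (FODef.eq (TermDef.app (τ := linkVocabulary l ι a b) (JoinFun.left f) hl) h0)
    (FODef.of_d0 (D0.graph_mem 0 1 (fun i : Fin n => i.succ.succ))
      (f := Fin.cons (fun A _ => linkConst A (.fn k)) (Fin.cons (fun A v => linkEmb A t (v 0))
        fun i A v => linkEmb A (s i) (v i.succ)))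
      (Fin.cases (TermDef.linkConst _) (Fin.cases (TermDef.linkEmb h0) fun i =>
        TermDef.linkEmb (hl i)))))).closure.congr fun _ => Iff.rfl)
  exact FOSent.of_d0 ((D0.ex_graph 0 2 fun i : Fin n => i.succ.succ.succ).ball 0)
      (f := Fin.cons (fun A _ => linkConst A (.fn k)) (Fin.cons (fun A _ => linkConst A (.dom t))
        fun i A _ => linkConst A (.dom (s i))))
      (Fin.cases (TermDef.linkConst _) (Fin.cases (TermDef.linkConst _) fun i =>
        TermDef.linkConst _)) fun _ _ => Iff.rfl

theorem foSent_codeLinked :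
    FOSent (CorrectModel.struc (R := R) (ι := linkEdge l ι a b)) (fun w =>
      CodeLinked w.struc w.π) := by
  refine FOSent.and ?_ (FOSent.and (foSent_tuple _ _) (FOSent.and (foSent_tuple _ _)
    (FOSent.and (foSent_tuple _ _) (FOSent.and (FOSent.forall_fin fun k => foSent_sortLinked _)
    (FOSent.and (FOSent.forall_fin fun k => foSent_relLinked _ _)
      (FOSent.forall_fin fun k => foSent_funLinked _ _))))))
  refine (foSent_tuple .code ![.doms, .rels, .funs]).congr fun w => ?_
  refine iff_of_eq (congrArg _ (congrArg tuple ?_))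
  funext i
  fin_cases i <;> rfl

theorem foSent_boundLinked :
    FOSent (CorrectModel.struc (R := R) (ι := linkEdge l ι a b)) (fun w =>
      BoundLinked w.struc w.π) := by
  have hv : ∀ (s : (linkVocabulary l ι a b).Sorts) (N : ℕ) (i : Fin N),
      TermDef (τ := linkVocabulary l ι a b) (fun _ : Fin N => s) (fun _ v => v i) :=
    fun s N i => TermDef.var i
  refine FOSent.and ?_ (FOSent.and (FOSent.forall₁ ?_) (FOSent.and (FOSent.forall₂ ?_)
    (FOSent.forall₂ ?_)))
  · exact FOSent.of_d0 (D0.isOmega (0 : Fin 1)) (f := fun _ A _ => linkConst A .omega)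
      (fun _ => TermDef.linkConst _) fun _ _ => Iff.rfl
  · exact (FODef.of_d0 ((D0.mem 0 1).or (D0.exists_fin fun k : Fin l.numSorts =>
      D0.mem 0 k.succ.succ)) (f := Fin.cons (fun A v => linkIncl A (v 0)) (Fin.cons
        (fun A _ => linkConst A .omega) fun k A _ => linkConst A (.dom (l.sorts k))))
      (Fin.cases (TermDef.linkIncl (hv _ _ 0)) (Fin.cases (TermDef.linkConst _) fun k =>
        TermDef.linkConst _))).congr fun _ _ => Iff.rfl
  · exact (FODef.eq (TermDef.linkIncl (hv _ _ 0)) (TermDef.linkIncl (hv _ _ 1))).imp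
      (FODef.eq (hv _ _ 0) (hv _ _ 1))
  · exact ((FODef.eq (TermDef.linkFst (hv _ _ 0)) (TermDef.linkFst (hv _ _ 1))).and
      (FODef.eq (TermDef.linkSnd (hv _ _ 0)) (TermDef.linkSnd (hv _ _ 1)))).imp
        (FODef.eq (hv _ _ 0) (hv _ _ 1))

theorem foSent_formula (ψ : Delta0Rel R 2) :
    FOSent (CorrectModel.struc (R := R) (ι := linkEdge l ι a b)) (fun w =>
      ψ.Holds ![w.π (linkConst w.struc .code), w.π (linkConst w.struc .wit)]) := by
  refine FOSent.of_d0 (Q := ψ.Holds) ⟨ψ, fun _ => Iff.rfl⟩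
    (f := ![fun A _ => linkConst A .code, fun A _ => linkConst A .wit]) ?_ fun w v => ?_
  · intro i; fin_cases i
    exacts [TermDef.linkConst _, TermDef.linkConst _]
  · refine iff_of_eq (congrArg _ ?_)
    funext i; fin_cases i <;> rfl

end sentences

/-- In a model that knows the code, the code is the code. -/
theorem CodeLinked.code_eq {B : Struc (linkVocabulary l ι a b)} {M : ZFSet.{u}}
    {π : B.dom (.mid (ι.onSort PUnit.unit)) → ZFSet.{u}}
    (hπ : IsMemIso (B.reduct (linkEdge l ι a b)) M π) (hM : M.IsTransitive)
    (h : CodeLinked B π) :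
    (∀ s, Function.Injective fun x => π (linkEmb B s x)) ∧ π (linkConst B .code) =
      code l (B.reduct (joinLeft τ τ₁ τ₂ _ (ι.onSort PUnit.unit) a b))
        (fun s x => π (linkEmb B s x)) := by
  obtain ⟨h1, h2, h3, h4, h5, h6, h7⟩ := h
  have h5' : ∀ s, SortLinked B π s := fun s => by
    have := h5 (l.sorts.symm s)
    rwa [Equiv.apply_symm_apply] at this
  have hmem : ∀ c x, x ∈ π c → ∃ z, π z = x := fun c x hx =>
    (hπ.2.1 x).1 (hM _ ((hπ.2.1 _).2 ⟨c, rfl⟩) hx)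
  have hdom : ∀ s x, x ∈ π (linkConst B (.dom s)) → ∃ y, π (linkEmb B s y) = x := by
    intro s x hx
    obtain ⟨z, rfl⟩ := hmem _ _ hx
    obtain ⟨y, rfl⟩ := (h5' s).2.1 z hx
    exact ⟨y, rfl⟩
  refine ⟨fun s x y hxy => (h5' s).2.2 x y (hπ.1 hxy), ?_⟩
  rw [h1, h2, h3, h4, code]
  congr 2
  · congr 1
    funext k
    ext x
    rw [ZFSet.mem_range]
    exact ⟨fun hx => hdom _ _ hx, by rintro ⟨y, rfl⟩; exact (h5' _).1 y⟩
  · congr 2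
    · funext k
      ext x
      rw [ZFSet.mem_range]
      constructor
      · intro hx
        obtain ⟨c, hc, rfl⟩ := (h6 k).1 x hx
        choose v hv using fun i => hdom _ _ (hc i)
        obtain rfl : (fun i => π (linkEmb B _ (v i))) = c := funext hv
        exact ⟨⟨v, ((h6 k).2 v).2 hx⟩, rfl⟩
      · rintro ⟨⟨v, hv⟩, rfl⟩
        exact ((h6 k).2 v).1 hv
    · congr 2
      funext k
      ext x
      rw [ZFSet.mem_range]
      constructor
      · intro hx
        obtain ⟨c, d, hc, hd, rfl⟩ := (h7 k).1 x hx
        choose v hv using fun i => hdom _ _ (hc i)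
        obtain rfl : (fun i => π (linkEmb B _ (v i))) = c := funext hv
        obtain ⟨y, rfl⟩ := hdom _ _ hd
        refine ⟨v, ?_⟩
        obtain rfl := ((h7 k).2 v y).2 hx
        rfl
      · rintro ⟨v, rfl⟩
        exact ((h7 k).2 v _).1 rfl

end link

/-! ### The code of a structure as an element of a transitive set -/

theorem mem_of_pair_mem {N a b : ZFSet.{u}} (hN : N.IsTransitive) (h : ZFSet.pair a b ∈ N) :
    a ∈ N ∧ b ∈ N := by
  have h1 : ({a, b} : ZFSet.{u}) ∈ N := hN _ h (by simp [ZFSet.pair])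
  exact ⟨hN _ h1 (by simp), hN _ h1 (by simp)⟩

theorem mem_of_tuple_mem {N : ZFSet.{u}} (hN : N.IsTransitive) :
    ∀ {n : ℕ} {a : Fin n → ZFSet.{u}}, tuple a ∈ N → ∀ i, a i ∈ N
  | 0, _, _, i => i.elim0
  | _ + 1, _, h, i => by
      obtain ⟨h0, h1⟩ := mem_of_pair_mem hN h
      exact Fin.cases h0 (fun i => mem_of_tuple_mem hN h1 i) i

theorem mk_pi_fin_le {κ : Cardinal.{u}} (hκ : ℵ₀ ≤ κ) {n : ℕ} (D : Fin n → Type u)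
    (h : ∀ i, #(D i) ≤ κ) : #(∀ i, D i) ≤ κ := by
  have e : ∀ i, Nonempty (D i ↪ κ.out) := fun i => by
    rw [← Cardinal.le_def, Cardinal.mk_out]
    exact h i
  have h1 : #(∀ i, D i) ≤ #(Fin n → κ.out) :=
    Cardinal.mk_le_of_injective (f := fun v i => (e i).some (v i)) fun v w hvw => by
      funext i
      exact (e i).some.injective (congrFun hvw i)
  refine h1.trans ?_
  simpa using Cardinal.power_nat_le hκ

theorem hc_code {κ : Cardinal.{u}} (hκ : ℵ₀ ≤ κ) {τ : Vocabulary.{u}} (l : τ.Listing) (A : Struc τ)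
    (e : ∀ s, A.dom s → ZFSet.{u}) (hA : ∀ s, #(A.dom s) ≤ κ) (he : ∀ s x, HC κ (e s x)) :
    HC κ (code l A e) := by
  refine hc_tuple hκ fun i => ?_
  fin_cases i
  · exact hc_tuple hκ fun k => hc_range hκ (hA _) (he _)
  · refine hc_tuple hκ fun k => hc_range hκ ((Cardinal.mk_subtype_le _).trans
      (mk_pi_fin_le hκ _ fun i => hA _)) fun v => hc_tuple hκ fun i => he _ _
  · exact hc_tuple hκ fun k => hc_range hκ (mk_pi_fin_le hκ _ fun i => hA _) fun v =>
      hc_pair hκ (hc_tuple hκ fun i => he _ _) (he _ _)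

section

variable {τ τ₁ τ₂ : Vocabulary.{u}} {l : τ.Listing} {ι : edgeVocabulary.{u}.Embedding τ₁}
  {a b : τ₂.Sorts}

/-- The sets named by the constants. -/
noncomputable def linkValue (l : τ.Listing) (A : Struc τ) (e : ∀ s, A.dom s → ZFSet.{u})
    (y w : ZFSet.{u}) : LinkConst τ.Sorts l.numRels l.numFuns → ZFSet.{u}
  | .code => code l A e
  | .wit => y
  | .omega => w
  | .doms => tuple fun k => ZFSet.range (e (l.sorts k))
  | .rels => tuple fun k => ZFSet.range
      fun v : {v : ∀ i, A.dom ((l.rels k).2.1 i) // A.rel (l.rels k).2.2 v} =>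
        tuple fun i => e _ (v.1 i)
  | .funs => tuple fun k => ZFSet.range
      fun v : (∀ i, A.dom ((l.funs k).2.1 i)) =>
        ZFSet.pair (tuple fun i => e _ (v i)) (e _ (A.fn (l.funs k).2.2.2 v))
  | .dom s => ZFSet.range (e s)
  | .rel k => ZFSet.range
      fun v : {v : ∀ i, A.dom ((l.rels k).2.1 i) // A.rel (l.rels k).2.2 v} =>
        tuple fun i => e _ (v.1 i)
  | .fn k => ZFSet.range
      fun v : (∀ i, A.dom ((l.funs k).2.1 i)) =>
        ZFSet.pair (tuple fun i => e _ (v i)) (e _ (A.fn (l.funs k).2.2.2 v))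

/-- Apart from the witness and `ω`, every named set is the code or an entry of the nested tuple that
forms it, and transitive sets contain the entries of their tuples. -/
theorem linkValue_mem {A : Struc τ} {e : ∀ s, A.dom s → ZFSet.{u}} {y w N : ZFSet.{u}}
    (hN : N.IsTransitive) (hx : code l A e ∈ N) (hy : y ∈ N) (hw : w ∈ N)
    (c : LinkConst τ.Sorts l.numRels l.numFuns) : linkValue l A e y w c ∈ N := by
  have h := mem_of_tuple_mem hN hx
  cases c with
  | code => exact hx
  | wit => exact hy
  | omega => exact hw
  | doms => exact h 0
  | rels => exact h 1
  | funs => exact h 2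
  | dom s =>
    obtain ⟨k, rfl⟩ := l.sorts.surjective s
    exact mem_of_tuple_mem hN (h 0) k
  | rel k => exact mem_of_tuple_mem hN (h 1) k
  | fn k => exact mem_of_tuple_mem hN (h 2) k

theorem codeLinked_of_value (B : Struc (linkVocabulary l ι a b))
    (π : B.dom (.mid (ι.onSort PUnit.unit)) → ZFSet.{u}) (hπ : Function.Injective π)
    (e : ∀ s : τ.Sorts, B.dom (.left s) → ZFSet.{u}) (he : ∀ s, Function.Injective (e s))
    (y w : ZFSet.{u})
    (hc : ∀ c, π (linkConst B c) =
      linkValue l (B.reduct (joinLeft τ τ₁ τ₂ _ (ι.onSort PUnit.unit) a b)) e y w c)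
    (hemb : ∀ s x, π (linkEmb B s x) = e s x) : CodeLinked B π := by
  have hinj : ∀ {n : ℕ} {s : Fin n → τ.Sorts} {v v' : ∀ i, B.dom (.left (s i))},
      (tuple fun i => e (s i) (v i)) = (tuple fun i => e (s i) (v' i)) → v = v' := by
    intro n s v v' h
    funext i
    exact he _ (congrFun (tuple_injective h) i)
  refine ⟨?_, ?_, ?_, ?_, fun k => ⟨?_, ?_, ?_⟩, fun k => ⟨?_, ?_⟩, fun k => ⟨?_, ?_⟩⟩
  · simp only [hc]; rfl
  · simp only [hc]; rfl
  · simp only [hc]; rfl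
  · simp only [hc]; rfl
  · intro x
    rw [hc, hemb]
    exact ZFSet.mem_range_self x
  · intro z hz
    rw [hc] at hz
    obtain ⟨x, hx⟩ := ZFSet.mem_range.1 hz
    exact ⟨x, hπ ((hemb _ x).trans hx)⟩
  · intro x y h
    exact he _ (by rw [← hemb, ← hemb, h])
  · intro z hz
    rw [hc] at hz
    obtain ⟨⟨v, hv⟩, rfl⟩ := ZFSet.mem_range.1 hz
    refine ⟨_, fun i => ?_, rfl⟩
    rw [hc]
    exact ZFSet.mem_range_self (v i)
  · intro v
    simp only [hemb]
    rw [hc]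
    refine Iff.trans ?_ (ZFSet.mem_range).symm
    constructor
    · intro hv
      exact ⟨⟨v, hv⟩, rfl⟩
    · rintro ⟨⟨v', hv⟩, h⟩
      obtain rfl : v' = v := hinj h
      exact hv
  · intro z hz
    rw [hc] at hz
    obtain ⟨v, rfl⟩ := ZFSet.mem_range.1 hz
    refine ⟨_, _, fun i => ?_, ?_, rfl⟩
    · rw [hc]
      exact ZFSet.mem_range_self (v i)
    · rw [hc]
      exact ZFSet.mem_range_self _
  · intro v y
    simp only [hemb]
    rw [hc]
    refine Iff.trans ?_ (ZFSet.mem_range).symm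
    constructor
    · rintro rfl
      exact ⟨v, rfl⟩
    · rintro ⟨v', h⟩
      obtain ⟨h1, h2⟩ := ZFSet.pair_inj.1 h
      obtain rfl : v' = v := hinj h1
      exact he _ h2

theorem card_link (B : Struc (linkVocabulary l ι a b)) :
    B.card = (B.reduct (joinLeft τ τ₁ τ₂ _ (ι.onSort PUnit.unit) a b)).card +
      ((B.reduct (joinMid τ τ₁ τ₂ _ (ι.onSort PUnit.unit) a b)).card +
        (B.reduct (joinRight τ τ₁ τ₂ _ (ι.onSort PUnit.unit) a b)).card) := by
  simp only [Struc.card, ← Cardinal.mk_sigma]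
  have h : ∀ {α β : Type u} (D : α ⊕ β → Type u),
      #(Σ i, D i) = #(Σ i, D (.inl i)) + #(Σ i, D (.inr i)) := fun D => by
    rw [Cardinal.mk_congr (Equiv.sumSigmaDistrib D), Cardinal.mk_sum, Cardinal.lift_id,
      Cardinal.lift_id]
  exact (h (α := τ.Sorts) (β := τ₁.Sorts ⊕ τ₂.Sorts) fun i => B.dom i).trans
    (congrArg (_ + ·) (h (α := τ₁.Sorts) (β := τ₂.Sorts) fun i => B.dom (.inr i)))

/-- Each element of the sort `a` names a natural number or an element of the structure, without
repetition; the model embeds in `a × b`. -/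
theorem BoundLinked.card_le {B : Struc (linkVocabulary l ι a b)} {M : ZFSet.{u}}
    {π : B.dom (.mid (ι.onSort PUnit.unit)) → ZFSet.{u}}
    (hπ : IsMemIso (B.reduct (linkEdge l ι a b)) M π) (h : BoundLinked B π)
    (hS : ∀ k, SortLinked B π (l.sorts k)) :
    #(B.dom (.right a)) ≤
        ℵ₀ + (B.reduct (joinLeft τ τ₁ τ₂ _ (ι.onSort PUnit.unit) a b)).card ∧
      #(B.dom (.mid (ι.onSort PUnit.unit))) ≤ #(B.dom (.right a)) * #(B.dom (.right b)) := by
  obtain ⟨h1, h2, h3, h4⟩ := h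
  constructor
  · let T : Type u := ULift.{u} ℕ ⊕ Σ s : τ.Sorts, B.dom (.left s)
    let g : T → ZFSet.{u} := Sum.elim (fun n => finOrd n.down) fun p => π (linkEmb B p.1 p.2)
    have hg : ∀ x, ∃ t, g t = π (linkIncl B x) := by
      intro x
      rcases h2 x with hx | ⟨k, hx⟩
      · obtain ⟨n, hn⟩ := (h1.mem_iff _).1 hx
        exact ⟨Sum.inl ⟨n⟩, hn⟩
      · obtain ⟨y, hy⟩ := (hS k).2.1 _ hx
        exact ⟨Sum.inr ⟨_, y⟩, congrArg π hy⟩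
    choose t ht using hg
    have hT : #T = ℵ₀ + (B.reduct (joinLeft τ τ₁ τ₂ _ (ι.onSort PUnit.unit) a b)).card := by
      rw [Cardinal.mk_sum, Cardinal.lift_id, Cardinal.lift_id, Cardinal.mk_sigma]
      simp only [Cardinal.mk_uLift, Cardinal.mk_nat, Cardinal.lift_aleph0]
      rfl
    rw [← hT]
    refine Cardinal.mk_le_of_injective (f := t) fun x y hxy => h3 x y (hπ.1 ?_)
    rw [← ht, ← ht, hxy]
  · rw [← Cardinal.lift_id #(B.dom (.right a)), ← Cardinal.lift_id #(B.dom (.right b)),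
      ← Cardinal.mk_prod]
    refine Cardinal.mk_le_of_injective (f := fun x => (linkFst B x, linkSnd B x)) fun x y hxy => ?_
    exact h4 x y (Prod.ext_iff.1 hxy)

end

/-! ### From `Σ₁` definitions with bound `F` to bounded projections -/

theorem IsMemIso.of_iso {A B : Struc edgeVocabulary.{u}} (f : A.Iso B) {M : ZFSet.{u}}
    {F : A.dom PUnit.unit → ZFSet.{u}} (h : IsMemIso A M F) :
    IsMemIso B M fun x => F ((f.equiv PUnit.unit).symm x) := by
  refine ⟨h.1.comp (Equiv.injective _), fun x => (h.2.1 x).trans ?_, fun x y => ?_⟩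
  · constructor
    · rintro ⟨a, rfl⟩
      exact ⟨f.equiv _ a, by simp⟩
    · rintro ⟨b, rfl⟩
      exact ⟨_, rfl⟩
  · rw [← h.2.2]
    refine (f.symm.map_rel EdgeRel.edge ![x, y]).trans (iff_of_eq (congrArg _ ?_))
    funext i; fin_cases i <;> rfl

/-- Every transitive set is isomorphic to a structure. -/
theorem exists_isMemIso {N : ZFSet.{u}} (hne : ∃ x, x ∈ N) :
    ∃ (A : Struc edgeVocabulary.{u}) (F : A.dom PUnit.unit → ZFSet.{u}), IsMemIso A N F := by
  obtain ⟨α, f, -, hf, hm⟩ := exists_enum N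
  obtain ⟨x, hx⟩ := hne
  obtain ⟨a, -⟩ := (hm x).1 hx
  exact ⟨⟨fun _ => α, fun _ => ⟨a⟩, fun r => match r with
    | .edge => fun v => f (v (0 : Fin 2)) ∈ f (v (1 : Fin 2)), fun f => f.elim⟩, f, hf, hm,
      fun _ _ => Iff.rfl⟩

/-- The expansions consist of the structure, a model from `Q R` and a pair of sorts controlled by
`F`. The class `C` has to agree with `K` on codes only; this allows `C` to be a complement, which
also contains sets that are not codes. -/
theorem sigmaB_of_sigma1 (L : AbstractLogic.{u, w}) {R : Pi1Predicate}
    (hQ : SigmaB L.toSemantics (Q.{u} R)) {F : Cardinal.{u} → Cardinal.{u}}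
    (hF : DefinablyBounding F) {τ : Vocabulary.{u}} (l : τ.Listing) {K : Set (Struc τ)}
    (hK : IsoClosed K) {C : Set ZFSet.{u}}
    (hKC : ∀ A e, (∀ s, Function.Injective (e s)) → (A ∈ K ↔ code l A e ∈ C))
    (hC : Sigma1 F R C) : SigmaB L.toSemantics K := by
  obtain ⟨τ₁, ι, φ₁, h₁, b₁⟩ := hQ
  obtain ⟨hmono, τ₂, ι₂, φ₂, h₂, b₂⟩ := hF
  obtain ⟨ψ, hψ, hψF⟩ := hC
  obtain ⟨θ, hθ⟩ := ((foSent_formula (l := l) (ι := ι) (a := ι₂.onSort ⟨false⟩)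
    (b := ι₂.onSort ⟨true⟩) ψ).and (foSent_codeLinked.and foSent_boundLinked))
  obtain ⟨θ', hθ'⟩ := L.first_order θ
  obtain ⟨φ₂', hφ₂'⟩ := L.first_order φ₂
  obtain ⟨χ₁, hχ₁⟩ := L.reduct (joinMid τ τ₁ τ₂ (LinkConst τ.Sorts l.numRels l.numFuns)
    (ι.onSort PUnit.unit) (ι₂.onSort ⟨false⟩) (ι₂.onSort ⟨true⟩)) φ₁
  obtain ⟨χ₂, hχ₂⟩ := L.reduct (joinRight τ τ₁ τ₂ (LinkConst τ.Sorts l.numRels l.numFuns)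
    (ι.onSort PUnit.unit) (ι₂.onSort ⟨false⟩) (ι₂.onSort ⟨true⟩)) φ₂'
  obtain ⟨χ₃, hχ₃⟩ := L.conj χ₁ χ₂
  obtain ⟨χ, hχ⟩ := L.conj χ₃ θ'
  have hsat : ∀ B, L.Sat B χ ↔ L.Sat (B.reduct (joinMid _ _ _ _ _ _ _)) φ₁ ∧
      firstOrder.Sat (B.reduct (joinRight _ _ _ _ _ _ _)) φ₂ ∧ firstOrder.Sat B θ := by
    intro B
    rw [hχ, hχ₃, hχ₁, hχ₂, hφ₂', hθ', and_assoc]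
  -- The sentence `θ` has its intended meaning only over correct models. The conjunct for `Q R`
  -- guarantees that every model of `χ` is one.
  have hmodel : ∀ B, L.Sat B χ → ∃ w : CorrectModel R (linkEdge l ι _ _), w.struc = B ∧
      ψ.Holds ![w.π (linkConst w.struc .code), w.π (linkConst w.struc .wit)] ∧
      CodeLinked w.struc w.π ∧ BoundLinked w.struc w.π := by
    intro B hB
    rw [hsat] at hB
    obtain ⟨M, ⟨hM, hR⟩, π, hπ⟩ := mem_Q_iff.1 ((h₁ _).2 ⟨_, hB.1, ⟨Struc.Iso.refl _⟩⟩)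
    exact ⟨⟨B, M, π, hπ, hM, hR⟩, rfl, (hθ ⟨B, M, π, hπ, hM, hR⟩).1 hB.2.2⟩
  refine ⟨_, joinLeft _ _ _ _ _ _ _, χ, fun A => ⟨fun hA => ?_, ?_⟩, fun A => ?_⟩
  · choose e he htr using fun s => exists_transitive_enum (A.dom s)
    obtain ⟨w, hw, hwc, hwinf⟩ := exists_isOmega.{u}
    obtain ⟨α, fα, hα, hfi, hfα⟩ := exists_enum
      (w ∪ ZFSet.range fun p : Σ s, A.dom s => e p.1 p.2)
    -- This cardinal is infinite because of `ω`, and it will be the size of the sort `a`.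
    set κ := (w ∪ ZFSet.range fun p : Σ s, A.dom s => e p.1 p.2).card
    have hκ : ℵ₀ ≤ κ := hwinf.trans (ZFSet.card_mono fun z hz => ZFSet.mem_union.2 (Or.inl hz))
    have hκ0 : κ ≠ 0 := (Cardinal.aleph0_pos.trans_le hκ).ne'
    have hsub : ∀ s, ZFSet.range (e s) ⊆ w ∪ ZFSet.range fun p : Σ s, A.dom s => e p.1 p.2 := by
      intro s z hz
      obtain ⟨x, rfl⟩ := ZFSet.mem_range.1 hz
      exact ZFSet.mem_union.2 (Or.inr (ZFSet.mem_range.2 ⟨⟨s, x⟩, rfl⟩))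
    have hrange : ∀ s, (ZFSet.range (e s)).card ≤ κ := fun s => ZFSet.card_mono (hsub s)
    have hdom : ∀ s, #(A.dom s) ≤ κ := fun s => card_range_of_injective (he s) ▸ hrange s
    have hx : HC κ (code l A e) := hc_code hκ l A e hdom fun s x =>
      hc_of_mem (htr s) (hrange s) (ZFSet.mem_range_self x)
    obtain ⟨y, hyr, hy⟩ := hψF _ ((hKC A e he).1 hA)
    have hyF : hRank y ≤ F κ := hyr.trans (hmono ((hRank_le_iff hκ).2 hx))
    -- An `H`-rank is infinite, so `F κ` is not zero and the sort `b` can be nonempty.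
    have hF0 : ℵ₀ ≤ F κ := (aleph0_le_hRank y).trans hyF
    have hFκ0 : F κ ≠ 0 := (Cardinal.aleph0_pos.trans_le hF0).ne'
    have hμ : ℵ₀ ≤ max κ (F κ) := hκ.trans (le_max_left _ _)
    -- Since `F κ` may be smaller than `κ`, the size of the hull is bounded by the maximum of both.
    obtain ⟨N, hXN, hN, hNR, hNc⟩ := exists_correct_hull R hμ (hc_insert hμ
      (hx.mono (le_max_left _ _)) (hc_insert hμ (((hRank_le_iff hF0).1 hyF).mono (le_max_right _ _))
        (hc_singleton hμ (hwc.mono hμ))))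
    have hxN : code l A e ∈ N := hXN (by simp)
    have hyN : y ∈ N := hXN (by simp)
    have hwN : w ∈ N := hXN (by simp)
    have hval := linkValue_mem hN hxN hyN hwN
    have hemN : ∀ s x, e s x ∈ N := fun s x => hN _ (hval (.dom s)) (ZFSet.mem_range_self x)
    obtain ⟨A₁, F₁, hF₁⟩ := exists_isMemIso ⟨_, hxN⟩
    obtain ⟨B₁, hB₁, ⟨j₁⟩⟩ := (h₁ A₁).1 (mem_Q_iff.2 ⟨N, ⟨hN, hNR⟩, F₁, hF₁⟩)
    obtain ⟨π, hπ⟩ : ∃ π, IsMemIso (B₁.reduct ι) N π := ⟨_, hF₁.of_iso j₁⟩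
    have hπN : ∀ z ∈ N, ∃ x, π x = z := fun z hz => (hπ.2.1 z).1 hz
    have hne : Nonempty α := Cardinal.mk_ne_zero_iff.1 (hα.symm ▸ hκ0)
    have hne' : Nonempty (F κ).out := Cardinal.mk_ne_zero_iff.1 (by rwa [Cardinal.mk_out])
    -- The two sorts are as large as allowed: `κ` and `F κ`.
    obtain ⟨B₂, hB₂, ⟨j₂⟩⟩ := (h₂ ⟨fun s => if s.down then (F κ).out else α,
      fun s => by split <;> assumption, fun r => r.elim, fun f => f.elim⟩).1 (by
        change #(F κ).out ≤ F #α
        rw [hα, Cardinal.mk_out])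
    let ea : α ≃ B₂.dom (ι₂.onSort ⟨false⟩) := j₂.equiv ⟨false⟩
    let eb : (F κ).out ≃ B₂.dom (ι₂.onSort ⟨true⟩) := j₂.equiv ⟨true⟩
    have hprod : #(B₁.dom (ι.onSort PUnit.unit)) ≤
        #(B₂.dom (ι₂.onSort ⟨false⟩) × B₂.dom (ι₂.onSort ⟨true⟩)) := by
      rw [Cardinal.mk_prod, Cardinal.lift_id, Cardinal.lift_id, ← Cardinal.mk_congr ea,
        ← Cardinal.mk_congr eb, hα, Cardinal.mk_out]
      refine ((card_range_of_injective hπ.1).symm.le.trans (ZFSet.card_mono fun z hz => ?_)).trans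
        (hNc.trans (max_le ?_ ?_))
      · obtain ⟨x, rfl⟩ := ZFSet.mem_range.1 hz
        exact (hπ.2.1 _).2 ⟨x, rfl⟩
      · exact Cardinal.le_mul_right hFκ0
      · exact Cardinal.le_mul_left hκ0
    obtain ⟨p⟩ := hprod
    choose const hconst using fun c => hπN _ (hval c)
    choose emb hemb using fun s x => hπN _ (hemN s x)
    have hαN : ∀ x, fα x ∈ N := by
      intro x
      rcases ZFSet.mem_union.1 ((hfα _).2 ⟨x, rfl⟩) with h | h
      · exact hN _ hwN h
      · obtain ⟨⟨s, z⟩, h⟩ := ZFSet.mem_range.1 h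
        exact h ▸ hemN s z
    choose incl hincl using fun x => hπN _ (hαN (ea.symm x))
    let B := joinStruc (τ := τ) (C := LinkConst τ.Sorts l.numRels l.numFuns) A B₁ B₂ const emb incl
      (fun x => (p x).1) fun x => (p x).2
    have hB : L.Sat B χ := by
      rw [hsat]
      refine ⟨hB₁, hB₂, (hθ ⟨B, N, π, hπ, hN, hNR⟩).2 ⟨?_, ?_, ?_, ?_, ?_, ?_⟩⟩
      · have h1 : π (linkConst B .code) = code l A e := hconst _
        have h2 : π (linkConst B .wit) = y := hconst _
        change ψ.Holds ![π (linkConst B .code), π (linkConst B .wit)]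
        rw [h1, h2]
        exact hy
      · exact codeLinked_of_value B π hπ.1 e he y w hconst hemb
      · exact (hconst .omega).symm.subst (motive := IsOmega) hw
      · intro x
        have h1 : π (linkIncl B x) = fα (ea.symm x) := hincl x
        change π (linkIncl B x) ∈ π (linkConst B .omega) ∨
          ∃ k, π (linkIncl B x) ∈ π (linkConst B (.dom (l.sorts k)))
        have h2 : ∀ c, π (linkConst B c) = linkValue l A e y w c := hconst
        rw [h1, h2]
        rcases ZFSet.mem_union.1 ((hfα _).2 ⟨ea.symm x, rfl⟩) with h | h
        · exact Or.inl h
        · obtain ⟨⟨s, z⟩, h⟩ := ZFSet.mem_range.1 h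
          obtain ⟨k, rfl⟩ := l.sorts.surjective s
          refine Or.inr ⟨k, ?_⟩
          rw [h2, ← h]
          exact ZFSet.mem_range_self z
      · intro x y h
        have h' := congrArg π h
        have h1 : ∀ x, π (linkIncl B x) = fα (ea.symm x) := hincl
        rw [h1, h1] at h'
        exact ea.symm.injective (hfi h')
      · intro x y h
        exact p.injective (Prod.ext h.1 h.2)
    exact ⟨B, hB, ⟨Struc.Iso.refl A⟩⟩
  · rintro ⟨B, hB, ⟨f⟩⟩
    -- The element named as code collapses to a code of the reduct, and the truth of `ψ` in the
    -- universe puts it in `C`.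
    obtain ⟨w, rfl, hw, hcode, -⟩ := hmodel B hB
    obtain ⟨he, heq⟩ := hcode.code_eq w.isMemIso w.isTransitive
    refine hK _ _ ⟨f.symm⟩ ((hKC _ _ he).2 ?_)
    exact heq.subst (motive := (· ∈ C)) ((hψ _).2 ⟨_, hw⟩)
  · obtain ⟨κ₁, hκ₁⟩ := exists_uniform_bound (fun (A : Struc edgeVocabulary.{u}) κ =>
      ∀ B, L.Sat B φ₁ → Nonempty (A.Iso (B.reduct ι)) → B.card ≤ κ)
      (fun A B κ ⟨f⟩ h B' hB' ⟨g⟩ => h B' hB' ⟨f.symm.trans g⟩)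
      (fun A κ μ hκμ h B hB hf => (h B hB hf).trans hκμ) b₁
      ((ℵ₀ + A.card) * F (ℵ₀ + A.card))
    obtain ⟨κ₂, hκ₂⟩ := exists_uniform_bound (fun (A : Struc twoSorts.{u}) κ =>
      ∀ B, firstOrder.Sat B φ₂ → Nonempty (A.Iso (B.reduct ι₂)) → B.card ≤ κ)
      (fun A B κ ⟨f⟩ h B' hB' ⟨g⟩ => h B' hB' ⟨f.symm.trans g⟩)
      (fun A κ μ hκμ h B hB hf => (h B hB hf).trans hκμ) b₂
      (max (ℵ₀ + A.card) (F (ℵ₀ + A.card)))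
    refine ⟨A.card + (κ₁ + κ₂), ?_⟩
    rintro B hB ⟨f⟩
    obtain ⟨w, rfl, hw, hcode, hbound⟩ := hmodel B hB
    obtain ⟨ha, hm⟩ := hbound.card_le w.isMemIso hcode.2.2.2.2.1
    rw [← f.card_eq] at ha
    rw [hsat] at hB
    have hb : #(w.struc.dom (.right (ι₂.onSort ⟨true⟩))) ≤
        F #(w.struc.dom (.right (ι₂.onSort ⟨false⟩))) :=
      (h₂ _).2 ⟨_, hB.2.1, ⟨Struc.Iso.refl _⟩⟩
    have hb' := hb.trans (hmono ha)
    rw [card_link, ← f.card_eq]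
    refine add_le_add le_rfl (add_le_add ?_ ?_)
    · exact hκ₁ _ (fun _ => hm.trans (mul_le_mul' ha hb')) _ hB.1 ⟨Struc.Iso.refl _⟩
    · refine hκ₂ _ ?_ _ hB.2.1 ⟨Struc.Iso.refl _⟩
      rintro ⟨_ | _⟩
      · exact ha.trans (le_max_left _ _)
      · exact hb'.trans (le_max_right _ _)

/-- The code of a structure determines it up to isomorphism. -/
theorem iso_of_code_eq {τ : Vocabulary.{u}} (l : τ.Listing) {A A' : Struc τ}
    {e : ∀ s, A.dom s → ZFSet.{u}} {e' : ∀ s, A'.dom s → ZFSet.{u}}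
    (he : ∀ s, Function.Injective (e s)) (he' : ∀ s, Function.Injective (e' s))
    (h : code l A e = code l A' e') : Nonempty (A.Iso A') := by
  have h3 := tuple_injective h
  have hdom : ∀ s, ZFSet.range (e s) = ZFSet.range (e' s) := fun s => by
    obtain ⟨k, rfl⟩ := l.sorts.surjective s
    exact congrFun (tuple_injective (congrFun h3 0)) k
  -- Stated for symbols instead of indices, this applies below to `⟨n, s, r⟩` without casts.
  have hrel : ∀ p : Σ (n : ℕ) (s : Fin n → τ.Sorts), τ.Rel s,
      (ZFSet.range fun v : {v : ∀ i, A.dom (p.2.1 i) // A.rel p.2.2 v} =>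
        tuple fun i => e _ (v.1 i)) =
      ZFSet.range fun v : {v : ∀ i, A'.dom (p.2.1 i) // A'.rel p.2.2 v} =>
        tuple fun i => e' _ (v.1 i) := fun p => by
    obtain ⟨k, rfl⟩ := l.rels.surjective p
    exact congrFun (tuple_injective (congrFun h3 1)) k
  have hfun : ∀ p : Σ (n : ℕ) (s : Fin n → τ.Sorts) (t : τ.Sorts), τ.Fun s t,
      (ZFSet.range fun v : (∀ i, A.dom (p.2.1 i)) =>
        ZFSet.pair (tuple fun i => e _ (v i)) (e _ (A.fn p.2.2.2 v))) =
      ZFSet.range fun v : (∀ i, A'.dom (p.2.1 i)) =>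
        ZFSet.pair (tuple fun i => e' _ (v i)) (e' _ (A'.fn p.2.2.2 v)) := fun p => by
    obtain ⟨k, rfl⟩ := l.funs.surjective p
    exact congrFun (tuple_injective (congrFun h3 2)) k
  have h1 : ∀ s x, ∃ y, e' s y = e s x := fun s x =>
    ZFSet.mem_range.1 (hdom s ▸ ZFSet.mem_range_self x)
  have h2 : ∀ s y, ∃ x, e s x = e' s y := fun s y =>
    ZFSet.mem_range.1 ((hdom s).symm ▸ ZFSet.mem_range_self y)
  -- The isomorphism sends an element to the one that is represented by the same set.
  choose f hf using h1
  have hfs : ∀ s, Function.Bijective (f s) := fun s => by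
    refine ⟨fun x y hxy => he s ?_, fun y => ?_⟩
    · rw [← hf, ← hf, hxy]
    · obtain ⟨x, hx⟩ := h2 s y
      exact ⟨x, he' s ((hf s x).trans hx)⟩
  refine ⟨⟨fun s => Equiv.ofBijective _ (hfs s), fun {n s} r v => ?_, fun {n s t} g v => ?_⟩⟩
  · have hv : (tuple fun i => e' _ (f _ (v i))) = tuple fun i => e _ (v i) :=
      congrArg tuple (funext fun i => hf _ _)
    change A.rel r v ↔ A'.rel r fun i => f _ (v i)
    constructor
    · intro h
      have hm := ZFSet.mem_range_self (f := fun v : {v : ∀ i, A.dom (s i) // A.rel r v} =>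
        tuple fun i => e _ (v.1 i)) ⟨v, h⟩
      rw [hrel ⟨n, s, r⟩] at hm
      obtain ⟨⟨v', h'⟩, hv'⟩ := ZFSet.mem_range.1 hm
      have : v' = fun i => f _ (v i) := funext fun i =>
        he' _ (congrFun (tuple_injective (hv'.trans hv.symm)) i)
      exact this ▸ h'
    · intro h
      have hm := ZFSet.mem_range_self (f := fun v : {v : ∀ i, A'.dom (s i) // A'.rel r v} =>
        tuple fun i => e' _ (v.1 i)) ⟨_, h⟩
      rw [← hrel ⟨n, s, r⟩] at hm
      obtain ⟨⟨v', h'⟩, hv'⟩ := ZFSet.mem_range.1 hm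
      have : v' = v := funext fun i =>
        he _ (congrFun (tuple_injective (hv'.trans hv)) i)
      exact this ▸ h'
  · change f t (A.fn g v) = A'.fn g fun i => f _ (v i)
    have hm := ZFSet.mem_range_self (f := fun v : (∀ i, A.dom (s i)) =>
        ZFSet.pair (tuple fun i => e _ (v i)) (e _ (A.fn g v))) v
    rw [hfun ⟨n, s, t, g⟩] at hm
    obtain ⟨v', hv'⟩ := ZFSet.mem_range.1 hm
    obtain ⟨hv1, hv2⟩ := ZFSet.pair_inj.1 hv'
    have : v' = fun i => f _ (v i) := funext fun i => by
      refine he' _ ((congrFun (tuple_injective hv1) i).trans (hf _ _).symm)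
    refine he' _ ((hf _ _).trans (hv2.symm.trans ?_))
    exact congrArg (fun v => e' t (A'.fn g v)) this

theorem mem_setClass_code {τ : Vocabulary.{u}} (l : τ.Listing) {K : Set (Struc τ)}
    (hK : IsoClosed K) (A : Struc τ) (e : ∀ s, A.dom s → ZFSet.{u})
    (he : ∀ s, Function.Injective (e s)) : A ∈ K ↔ code l A e ∈ setClass l K := by
  constructor
  · intro hA
    exact ⟨A, hA, e, he, rfl⟩
  · rintro ⟨A', hA', e', he', h⟩
    exact hK A' A (iso_of_code_eq l he' he h.symm) hA'

theorem IsoClosed.compl {τ : Vocabulary.{u}} {K : Set (Struc τ)} (hK : IsoClosed K) :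
    IsoClosed Kᶜ := fun A B ⟨f⟩ hA hB => hA (hK B A ⟨f.symm⟩ hB)

end BoundedSymbiosis

theorem lemma4p7 (L : AbstractLogic.{u, w}) (R : Pi1Predicate) :
    List.TFAE [
      ∀ F : Cardinal.{u} → Cardinal.{u}, DefinablyBounding F →
        ∀ (τ : Vocabulary.{u}) (l : τ.Listing) (K : Set (Struc τ)),
          IsoClosed K → Delta1 F R (setClass l K) → DeltaB L.toSemantics K,
      ∀ (τ : Vocabulary.{u}) (l : τ.Listing) (K : Set (Struc τ)),
        IsoClosed K → Delta1 (id : Cardinal.{u} → Cardinal.{u}) R (setClass l K) →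
          DeltaB L.toSemantics K,
      DeltaB L.toSemantics (Q.{u} R)] := by
  tfae_have 1 → 2 := fun h => h id definablyBounding_id
  tfae_have 2 → 3 := fun h => h _ edgeListing _ (isoClosed_Q R) ⟨sigma1_Q R, sigma1_Q_compl R⟩
  tfae_have 3 → 1 := fun h F hF τ l K hK hD =>
    ⟨sigmaB_of_sigma1 L h.1 hF l hK (mem_setClass_code l hK) hD.1,
      -- The complement of `setClass l K` is larger than `setClass l Kᶜ`, but both contain the same
      -- codes of structures.
      sigmaB_of_sigma1 L h.1 hF l hK.compl
        (C := (setClass l K)ᶜ) (fun A e he => not_congr (mem_setClass_code l hK A e he)) hD.2⟩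
  tfae_finish
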